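/- **Conventions.** For a space $Y$ with a proper coarse structure, $C_h(Y)$ is the $C^*$-algebra of bounded continuous functions $f\colon Y\to\mathbb C$ of vanishing variation (for each controlled set $E$, $f(y)-f(x)\to 0$ as $(x,y)\in E$ leaves bounded sets), $hY$ is its spectrum, $\nu Y=hY\setminus Y$ the Higson corona. A corona of $Y$ is a pair $(W,\zeta)$ of a compact metrizable space $W$ and a continuous map $\zeta\colon\nu Y\to W$; $\bar\zeta=\mathrm{id}\sqcup\zeta\colon hY\to Y\sqcup W$, and $Y\cup_\zeta W$ is the set $Y\sqcup W$ with the topology of $hY$ glued to $W$ along $\zeta$ (the final topology for $\bar\zeta$ and $W\hookrightarrow Y\sqcup W$). **Setting.** Let $G$ be a group with a finite symmetric generating set $S$ and word metric $d_S$, and let $\mathbb P=\{P_1,\dots,P_k\}$, $k\ge 1$, be infinite subgroups. Let $(g_i)_{i\ge1}$ be a sequence in $G$ with $g_1=\dots=g_k=1$ such that for each $r\in\{1,\dots,k\}$ the map $a\mapsto g_{ak+r}P_r$ is a bijection $\{0,1,2,\dots\}\to G/P_r$; let $(i)\in\{1,\dots,k\}$ be the residue of $i$ modulo $k$. The augmented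 space $X$ is obtained from the Cayley graph $\Gamma$ by attaching to each coset $g_iP_{(i)}$ the combinatorial horoball $\mathcal H_i$ with vertices $(i,p,l)$, $p\in g_iP_{(i)}$, $l\ge0$, where $(i,p,0)=p$, with vertical edges between $(i,p,l)$ and $(i,p,l+1)$ and horizontal edges between $(i,p,l)$ and $(i,q,l)$ when $0<d_S(p,q)\le 2^l$. All these graphs are regarded as the metric spaces of their vertices. Assume that $G$ is hyperbolic relative to $\mathbb P$, that is, $X$ is Gromov hyperbolic. Let $\delta_0>0$ be such that geodesic triangles in $X$ are $\delta_0$-thin, let $N>\delta_0+1$ be an integer and $e_i=(i,g_i,N)$. Let $\partial X$ be the Gromov boundary of $X$, $\overline X=X\cup\partial X$ the Gromov compactification, $s_i\in\partial X$ the endpoint of the vertical rays of $\mathcal H_i$, and $$X^i=\Gamma\cup\bigcup_{j\ne i}\mathcal H_j,\qquad X_n=\Gamma\cup\bigcup_{j>n}\mathcal H_j,\qquad \hat P_i=\partial X\setminus\{s_i\}.$$ For each $i$ choose, for each $u\in\hat P_i$, a geodesic ray $l^u$ from $e_i$ to $u$, and for each $x\in X^i$ a geodesic ray $l_x$ from $e_i$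 with $[l_x]\ne s_i$ and a time $t_x$ with $l_x(t_x)\in X^i$, such that $d(x,l_x(t_x))$ is bounded uniformly in $x$. Put $F_i(x)=[l_x]\in\hat P_i$, and let $L_i(u)$ be the last point of $l^u$ in $g_iP_{(i)}$. Give $\hat P_i$ the subspace topology and the pullback along $L_i$ of the coarse structure of $g_iP_{(i)}$. Let $(W_r,\zeta_r)$ be coronae of $P_r$, with $W_r\neq\emptyset$, $r=1,\dots,k$; put $W_i=W_{(i)}$ for all $i$, and let $\zeta_i\colon\nu\hat P_i\to W_i$ be the composite of $\zeta_{(i)}$ with the map $\nu\hat P_i\to\nu P_{(i)}$ induced by the coarse equivalence $u\mapsto g_i^{-1}L_i(u)$. Let $\alpha\colon hX\to\overline X$ and $hF_i\colon hX^i\to h\hat P_i$ be the continuous extensions of $\mathrm{id}_X$ and $F_i$. Regard $\nu G\subset\nu X_n\subset \nu X^i\subset\nu X$ for $i\le n$. For $n\ge0$ let $\partial X_n=(\partial X\setminus\{s_1,\dots,s_n\})\sqcup\bigsqcup_{i=1}^nW_i$, with the weakest topology for which the maps $\sigma_i\colon\partial X_n\to\hat P_i\cup_{\zeta_i}W_i$,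 $1\le i\le n$, are continuous, where $\sigma_i$ collapses $W_j$ to $s_j$ for $j\ne i$ and is the identity elsewhere ($\partial X_0=\partial X$ with its own topology). Let $\partial X_\infty=\varprojlim\partial X_n$ along the maps collapsing $W_{n+1}$ to $s_{n+1}$. Define $\xi_n\colon\nu X_n\to\partial X_n$ by $$\xi_n(x)=\begin{cases}\alpha(x)&\text{if }\alpha(x)\notin\{s_1,\dots,s_n\},\\ \bar\zeta_i(hF_i(x))&\text{if }\alpha(x)=s_i,\ 1\le i\le n,\end{cases}$$ and let $\xi_\infty\colon\nu G\to\partial X_\infty$ have components $\xi_n|_{\nu G}$. **Proposition.** The above choices of rays exist for every $i$, and for every such choice the maps $\alpha$, $hF_i$, $\zeta_i$ (which is a corona of $\hat P_i$), $\xi_n$ and $\xi_\infty$ are well defined. For all $n\ge0$, $\partial X_n$ is compact metrizable and $\xi_n$ is continuous, so $(\partial X_n,\xi_n)$ is a corona of $X_n$; likewise $\partial X_\infty$ is compact metrizable and $\xi_\infty$ is continuous, so $(\partial X_\infty,\xi_\infty)$ is a corona of $G$. If $\zeta_r$ is surjective for $r=1,\dots,k$, then $\xi_n$ is surjective for all $n\in\{0,1,2,\dots\}\cup\{\infty\}$;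 consequently $X_n\cup_{\xi_n}\partial X_n$ and $G\cup_{\xi_\infty}\partial X_\infty$ are coarse compactifications (compact metrizable spaces that contain $X_n$, respectively $G$, as a dense open subspace). -/

import Mathlib

open Filter Topology
open scoped BoundedContinuousFunction

namespace BlownUp

universe u v w

/-! ## Coarse structures -/

/-- A (coarsely connected) coarse structure on a set. -/
structure CoarseStructure (X : Type u) where
  controlled : Set (Set (X × X))
  diagonal_mem : {z : X × X | z.1 = z.2} ∈ controlled
  subset_mem : ∀ E ∈ controlled, ∀ E' ⊆ E, E' ∈ controlled
  inverse_mem : ∀ E ∈ controlled, {z : X × X | (z.2, z.1) ∈ E} ∈ controlled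
  product_mem : ∀ E ∈ controlled, ∀ E' ∈ controlled,
    {z : X × X | ∃ y, (z.1, y) ∈ E ∧ (y, z.2) ∈ E'} ∈ controlled
  union_mem : ∀ E ∈ controlled, ∀ E' ∈ controlled, E ∪ E' ∈ controlled
  connected : ∀ x y : X, {(x, y)} ∈ controlled

namespace CoarseStructure

/-- A subset `B` is bounded if `B × B` is controlled. -/
def IsBdd {X : Type u} (E : CoarseStructure X) (B : Set X) : Prop :=
  B ×ˢ B ∈ E.controlled

theorem IsBdd.union {X : Type u} {E : CoarseStructure X} {B B' : Set X} (hB : E.IsBdd B)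
    (hB' : E.IsBdd B') : E.IsBdd (B ∪ B') := by
  rcases B.eq_empty_or_nonempty with rfl | ⟨b, hb⟩
  · simpa using hB'
  rcases B'.eq_empty_or_nonempty with rfl | ⟨b', hb'⟩
  · simpa using hB
  have h1 := E.product_mem _ hB _ (E.product_mem _ (E.connected b b') _ hB')
  have h2 := E.inverse_mem _ h1
  refine E.subset_mem _ (E.union_mem _ (E.union_mem _ hB _ hB') _ (E.union_mem _ h1 _ h2)) _ ?_
  rintro ⟨x, y⟩ ⟨hx | hx, hy | hy⟩
  · exact Or.inl (Or.inl ⟨hx, hy⟩)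
  · exact Or.inr (Or.inl ⟨b, ⟨hx, hb⟩, b', rfl, hb', hy⟩)
  · exact Or.inr (Or.inr ⟨b, ⟨hy, hb⟩, b', rfl, hb', hx⟩)
  · exact Or.inl (Or.inr ⟨hx, hy⟩)

/-- The bounded coarse structure of the vertex set of a connected graph with its path metric. -/
noncomputable def ofGraph {X : Type u} (Γ : SimpleGraph X) (hΓ : Γ.Connected) :
    CoarseStructure X where
  controlled := {E | ∃ R : ℕ, ∀ z ∈ E, Γ.dist z.1 z.2 ≤ R}
  diagonal_mem := by
    refine ⟨0, fun z hz => ?_⟩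
    have hz' : z.1 = z.2 := hz
    simp [hz']
  subset_mem := by
    rintro E ⟨R, hR⟩ E' h
    exact ⟨R, fun z hz => hR z (h hz)⟩
  inverse_mem := by
    rintro E ⟨R, hR⟩
    refine ⟨R, fun z hz => ?_⟩
    rw [SimpleGraph.dist_comm]
    exact hR _ hz
  product_mem := by
    rintro E ⟨R, hR⟩ E' ⟨R', hR'⟩
    refine ⟨R + R', ?_⟩
    rintro z ⟨y, h, h'⟩
    exact (hΓ.dist_triangle (v := y)).trans (add_le_add (hR _ h) (hR' _ h'))
  union_mem := by
    rintro E ⟨R, hR⟩ E' ⟨R', hR'⟩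
    refine ⟨max R R', ?_⟩
    rintro z (h | h)
    · exact (hR z h).trans (le_max_left R R')
    · exact (hR' z h).trans (le_max_right R R')
  connected := fun x y => ⟨Γ.dist x y, by rintro _ rfl; exact le_rfl⟩

/-- The pullback coarse structure along a map. -/
def pullback {X : Type u} {Y : Type v} (f : X → Y) (E : CoarseStructure Y) :
    CoarseStructure X where
  controlled := {A | Prod.map f f '' A ∈ E.controlled}
  diagonal_mem := by
    refine E.subset_mem _ E.diagonal_mem _ ?_
    rintro _ ⟨z, hz, rfl⟩
    exact congrArg f (show z.1 = z.2 from hz)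
  subset_mem := fun A hA A' h => E.subset_mem _ hA _ (Set.image_mono h)
  inverse_mem := by
    intro A hA
    refine E.subset_mem _ (E.inverse_mem _ hA) _ ?_
    rintro _ ⟨z, hz, rfl⟩
    exact ⟨_, hz, rfl⟩
  product_mem := by
    intro A hA A' hA'
    refine E.subset_mem _ (E.product_mem _ hA _ hA') _ ?_
    rintro _ ⟨z, ⟨y, h, h'⟩, rfl⟩
    exact ⟨f y, ⟨_, h, rfl⟩, ⟨_, h', rfl⟩⟩
  union_mem := by
    intro A hA A' hA'
    have := E.union_mem _ hA _ hA'
    rwa [← Set.image_union] at this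
  connected := fun x y => by
    simpa using E.connected (f x) (f y)

end CoarseStructure

/-! ## Higson compactification and coronae -/

/-- Vanishing variation: on each controlled set, `f y - f x` vanishes at infinity. -/
def IsHigson {X : Type u} (E : CoarseStructure X) (f : X → ℂ) : Prop :=
  ∀ A ∈ E.controlled, ∀ ε : ℝ, 0 < ε → ∃ B : Set X, E.IsBdd B ∧
    ∀ z ∈ A, z ∉ B ×ˢ B → ‖f z.2 - f z.1‖ < ε

theorem IsHigson.of_bound {X : Type u} {E : CoarseStructure X} {f g h : X → ℂ} {C : ℝ}
    (hC : 0 < C) (hf : IsHigson E f) (hg : IsHigson E g)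
    (hb : ∀ x y, ‖h y - h x‖ ≤ C * ‖f y - f x‖ + C * ‖g y - g x‖) : IsHigson E h := by
  intro A hA ε hε
  obtain ⟨B, hB, h1⟩ := hf A hA (ε / (2 * C)) (by positivity)
  obtain ⟨B', hB', h2⟩ := hg A hA (ε / (2 * C)) (by positivity)
  refine ⟨B ∪ B', hB.union hB', fun z hz hn => ?_⟩
  have a1 := h1 z hz fun hh => hn ⟨Or.inl hh.1, Or.inl hh.2⟩
  have a2 := h2 z hz fun hh => hn ⟨Or.inr hh.1, Or.inr hh.2⟩
  have a3 := hb z.1 z.2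
  have e : C * (ε / (2 * C)) = ε / 2 := by field_simp
  have b1 := mul_lt_mul_of_pos_left a1 hC
  have b2 := mul_lt_mul_of_pos_left a2 hC
  rw [e] at b1 b2
  linarith

theorem isHigson_const {X : Type u} (E : CoarseStructure X) (c : ℂ) :
    IsHigson E (fun _ => c) := by
  intro A _ ε hε
  refine ⟨∅, ?_, fun z _ _ => by simpa using hε⟩
  exact E.subset_mem _ E.diagonal_mem _ (by simp)

section Higson

variable {X : Type u} [TopologicalSpace X]

/-- The unital C*-algebra `C_h(X)` of bounded continuous Higson functions. -/
noncomputable def higsonAlgebra (E : CoarseStructure X) : StarSubalgebra ℂ (X →ᵇ ℂ) where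
  carrier := {f | IsHigson E f}
  mul_mem' := by
    intro f g hf hg
    refine IsHigson.of_bound (C := ‖f‖ + ‖g‖ + 1) (by positivity) hf hg fun x y => ?_
    have key : (f * g) y - (f * g) x = (f y - f x) * g y + f x * (g y - g x) := by
      simp only [BoundedContinuousFunction.mul_apply]; ring
    rw [key]
    refine (norm_add_le _ _).trans ?_
    rw [norm_mul, norm_mul]
    have h1 := f.norm_coe_le_norm x
    have h2 := g.norm_coe_le_norm y
    have h3 := norm_nonneg (f y - f x)
    have h4 := norm_nonneg (g y - g x)
    have h5 := norm_nonneg f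
    have h6 := norm_nonneg g
    nlinarith
  add_mem' := by
    intro f g hf hg
    refine IsHigson.of_bound (C := 1) one_pos hf hg fun x y => ?_
    have key : (f + g) y - (f + g) x = (f y - f x) + (g y - g x) := by
      simp only [BoundedContinuousFunction.add_apply]; ring
    rw [key, one_mul, one_mul]
    exact norm_add_le _ _
  algebraMap_mem' := fun c => isHigson_const E c
  star_mem' := by
    intro f hf
    refine IsHigson.of_bound (C := 1) one_pos hf hf fun x y => ?_
    have key : (star f) y - (star f) x = star (f y - f x) := by
      simp [BoundedContinuousFunction.star_apply]
    rw [key, norm_star, one_mul]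
    have := norm_nonneg (f y - f x)
    linarith

/-- The Higson compactification `hX`: the Gelfand spectrum of `C_h(X)`. -/
abbrev HigsonComp (E : CoarseStructure X) : Type u :=
  WeakDual.characterSpace ℂ (higsonAlgebra E)

/-- The canonical map `X → hX`, by evaluation of functions. -/
noncomputable def toHigson (E : CoarseStructure X) (x : X) : HigsonComp E :=
  ⟨(BoundedContinuousFunction.evalCLM ℂ x).comp
      (higsonAlgebra E).toSubalgebra.toSubmodule.subtypeL, by
    constructor
    · intro h
      have h1 := DFunLike.congr_fun h (1 : higsonAlgebra E)
      exact one_ne_zero (α := ℂ) h1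
    · intro f g
      rfl⟩

/-- The Higson corona `νX = hX ∖ X`. -/
abbrev HigsonCorona (E : CoarseStructure X) : Type u :=
  {χ : HigsonComp E // ¬ ∃ x, toHigson E x = χ}

instance (E : CoarseStructure X) [Nonempty X] : Nonempty (HigsonComp E) :=
  ⟨toHigson E (Classical.arbitrary X)⟩

/-- The map induced on `hX` by a map `f : X → Z`: the value at `χ ∈ hX` is the limit of `f x`
as `x ∈ X` tends to `χ`. -/
noncomputable def higsonExt (E : CoarseStructure X) {Z : Type v} [TopologicalSpace Z]
    [Nonempty Z] (f : X → Z) (χ : HigsonComp E) : Z :=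
  limUnder (comap (toHigson E) (𝓝 χ)) f

/-- `F : hX → Z` is a continuous extension of `f : X → Z`. -/
def IsHigsonExtension (E : CoarseStructure X) {Z : Type v} [TopologicalSpace Z]
    (f : X → Z) (F : HigsonComp E → Z) : Prop :=
  Continuous F ∧ ∀ x, F (toHigson E x) = f x

/-- The map `hX → hY` induced by a coarse map `f : X → Y`. On `νX` this is the functorial map
`νf : νX → νY`, also when `f` is not continuous. -/
noncomputable def higsonMap (E : CoarseStructure X) {Y : Type v} [TopologicalSpace Y]
    [Nonempty Y] (E' : CoarseStructure Y) (f : X → Y) : HigsonComp E → HigsonComp E' :=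
  higsonExt E fun x => toHigson E' (f x)

/-- `(W, ζ)` is a corona of `X`. -/
structure IsCorona {E : CoarseStructure X} {W : Type v} [TopologicalSpace W]
    (ζ : HigsonCorona E → W) : Prop where
  compact : CompactSpace W
  metrizable : TopologicalSpace.MetrizableSpace W
  continuous : Continuous ζ

/-- The underlying set `X ⊔ W` of the space `X ∪_ζ W`. -/
inductive CoronaUnion {E : CoarseStructure X} {W : Type v} (ζ : HigsonCorona E → W) :
    Type (max u v)
  | inner (x : X)
  | outer (z : W)

open Classical in
/-- The map `ζ̄ = id ⊔ ζ : hX → X ⊔ W`. -/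
noncomputable def coronaBar {E : CoarseStructure X} {W : Type v} (ζ : HigsonCorona E → W)
    (χ : HigsonComp E) : CoronaUnion ζ :=
  if h : ∃ x, toHigson E x = χ then .inner h.choose else .outer (ζ ⟨χ, h⟩)

/-- The topology of `X ∪_ζ W`: the final topology for `ζ̄ : hX → X ⊔ W` and the inclusion of `W`,
that is, `hX` with `νX` glued to `W` along `ζ`. If `ζ` is surjective this is the final topology
for `ζ̄` alone. -/
noncomputable instance {E : CoarseStructure X} {W : Type v} [TopologicalSpace W] (ζ : HigsonCorona E → W) :
    TopologicalSpace (CoronaUnion ζ) :=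
  TopologicalSpace.coinduced (coronaBar ζ) inferInstance ⊔
    TopologicalSpace.coinduced CoronaUnion.outer inferInstance

/-- `X ∪_ζ W` is a compactification of `X` (a coarse compactification). -/
structure IsCoarseCompactification {E : CoarseStructure X} {W : Type v} [TopologicalSpace W]
    (ζ : HigsonCorona E → W) : Prop where
  compact : CompactSpace (CoronaUnion ζ)
  metrizable : TopologicalSpace.MetrizableSpace (CoronaUnion ζ)
  isOpenEmbedding : IsOpenEmbedding (CoronaUnion.inner : X → CoronaUnion ζ)
  denseRange : DenseRange (CoronaUnion.inner : X → CoronaUnion ζ)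

end Higson

/-! ## The augmented space -/

/-- The residue of `i` modulo `k`. -/
def residue (k : ℕ) [NeZero k] (i : ℕ) : Fin k := ⟨i % k, Nat.mod_lt _ (NeZero.pos k)⟩

/-- A group `G` with a finite symmetric generating set `S`, a finite family of infinite
subgroups `P`, and an order `g` of the cosets of `P` (indexed from `0`). -/
structure PeripheralGroup (G : Type u) [Group G] (k : ℕ) [NeZero k] where
  S : Set G
  S_finite : S.Finite
  S_symm : ∀ s ∈ S, s⁻¹ ∈ S
  S_generates : Subgroup.closure S = ⊤
  P : Fin k → Subgroup G
  P_infinite : ∀ r, Infinite (P r)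
  g : ℕ → G
  g_eq_one : ∀ i < k, g i = 1
  g_bijective : ∀ r : Fin k,
    Function.Bijective fun a : ℕ => (QuotientGroup.mk (g (a * k + r)) : G ⧸ P r)

namespace PeripheralGroup

variable {G : Type u} [Group G] {k : ℕ} [NeZero k] (D : PeripheralGroup G k)

/-- The Cayley graph; its path metric is the left invariant word metric. -/
def cayley : SimpleGraph G := SimpleGraph.mulCayley D.S

/-- The coset `g_i P_(i)`. -/
def coset (i : ℕ) : Set G := {x | (D.g i)⁻¹ * x ∈ D.P (residue k i)}

/-- Vertices of the augmented space: elements of `G`, and triples `(i, p, l + 1)` with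
`p ∈ g_i P_(i)`. -/
inductive Vertex
  | group (x : G)
  | horo (i : ℕ) (p : D.coset i) (l : ℕ)

instance : Nonempty D.Vertex := ⟨.group 1⟩
instance : TopologicalSpace D.Vertex := ⊥
instance : DiscreteTopology D.Vertex := ⟨rfl⟩

/-- Edges of the augmented space. -/
inductive Edge : D.Vertex → D.Vertex → Prop
  | cayley (x y : G) (h : D.cayley.Adj x y) : Edge (.group x) (.group y)
  | bottom (i : ℕ) (p : D.coset i) : Edge (.group p) (.horo i p 0)
  | vertical (i : ℕ) (p : D.coset i) (l : ℕ) : Edge (.horo i p l) (.horo i p (l + 1))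
  | horizontal (i : ℕ) (p q : D.coset i) (l : ℕ) (hpq : p ≠ q)
      (h : D.cayley.dist p q ≤ 2 ^ (l + 1)) : Edge (.horo i p l) (.horo i q l)

/-- The augmented space `X(G, P, S)`. As all rays, maps and coronae below only see vertices at
integral distances, the space is represented by its vertex set (a discrete proper metric space
coarsely equivalent to the geometric realization) with the path metric. -/
def graph : SimpleGraph D.Vertex := SimpleGraph.fromRel D.Edge

/-- The vertex `(i, p, l)`, where `(i, p, 0)` is `p ∈ G`. -/
def vert (i : ℕ) (p : D.coset i) : ℕ → D.Vertex
  | 0 => .group p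
  | l + 1 => .horo i p l

/-- The depth of a vertex in the `i`-th horoball. -/
def depth (i : ℕ) : D.Vertex → ℕ
  | .group _ => 0
  | .horo j _ l => if j = i then l + 1 else 0

theorem cayley_connected : D.cayley.Connected := by
  have key : ∀ x : G, D.cayley.Reachable 1 x := by
    intro x
    have hx : x ∈ Subgroup.closure D.S := by rw [D.S_generates]; trivial
    have step : ∀ a s : G, s ∈ D.S → D.cayley.Reachable a (a * s) := by
      intro a s hs
      by_cases h : a = a * s
      · rw [← h]
      · exact SimpleGraph.Adj.reachable
          ((SimpleGraph.mulCayley_adj' _ _ _).2 ⟨h, s, hs, Or.inl rfl⟩)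
    induction hx using Subgroup.closure_induction_right with
    | one => exact SimpleGraph.Reachable.refl _
    | mul_right a _ s hs ih => exact ih.trans (step a s hs)
    | mul_inv_cancel a _ s hs ih => exact ih.trans (step a _ (D.S_symm _ hs))
  exact { preconnected := fun x y => (key x).symm.trans (key y), nonempty := ⟨1⟩ }

theorem edge_ne {a b : D.Vertex} (h : D.Edge a b) : a ≠ b := by
  cases h with
  | cayley x y h => intro e; injection e with e; exact h.ne e
  | bottom i p => intro e; cases e
  | vertical i p l => intro e; injection e with _ _ e; omega
  | horizontal i p q l hpq h => intro e; injection e with _ e; exact hpq (eq_of_heq (heq_of_eq e))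

theorem adj_of_edge {a b : D.Vertex} (h : D.Edge a b) : D.graph.Adj a b :=
  (SimpleGraph.fromRel_adj _ _ _).2 ⟨D.edge_ne h, Or.inl h⟩

theorem edge_vert (i : ℕ) (p : D.coset i) (l : ℕ) : D.Edge (D.vert i p l) (D.vert i p (l + 1)) := by
  cases l with
  | zero => exact .bottom i p
  | succ l => exact .vertical i p l

theorem graph_connected : D.graph.Connected := by
  have h1 : ∀ x y : G, D.graph.Reachable (.group x) (.group y) := by
    intro x y
    obtain ⟨p⟩ := D.cayley_connected.preconnected x y
    induction p with
    | nil => exact SimpleGraph.Reachable.refl _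
    | cons h _ ih => exact (D.adj_of_edge (.cayley _ _ h)).reachable.trans ih
  have h2 : ∀ (i : ℕ) (p : D.coset i) (l : ℕ),
      D.graph.Reachable (.group p) (D.vert i p l) := by
    intro i p l
    induction l with
    | zero => exact SimpleGraph.Reachable.refl _
    | succ l ih => exact ih.trans (D.adj_of_edge (D.edge_vert i p l)).reachable
  have h3 : ∀ a : D.Vertex, D.graph.Reachable (.group 1) a := by
    rintro (x | ⟨i, p, l⟩)
    · exact h1 _ _
    · exact (h1 _ _).trans (h2 i p (l + 1))
  exact { preconnected := fun x y => (h3 x).symm.trans (h3 y), nonempty := ⟨.group 1⟩ }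

theorem depth_le_of_edge (i : ℕ) {a b : D.Vertex} (h : D.Edge a b) :
    D.depth i a ≤ D.depth i b + 1 ∧ D.depth i b ≤ D.depth i a + 1 := by
  cases h <;> simp only [depth] <;> (try split_ifs) <;> constructor <;> omega

theorem depth_le (i : ℕ) (a b : D.Vertex) :
    D.depth i a ≤ D.depth i b + D.graph.dist a b := by
  obtain ⟨p, hp⟩ := D.graph_connected.exists_walk_length_eq_dist a b
  rw [← hp]
  clear hp
  induction p with
  | nil => simp
  | cons h p ih =>
    rw [SimpleGraph.Walk.length_cons]
    rcases ((SimpleGraph.fromRel_adj _ _ _).1 h).2 with h | h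
    · have := (D.depth_le_of_edge i h).1
      omega
    · have := (D.depth_le_of_edge i h).2
      omega

theorem depth_vert (i : ℕ) (p : D.coset i) (l : ℕ) : D.depth i (D.vert i p l) = l := by
  cases l <;> simp [vert, depth]

theorem depth_vert_of_ne {i j : ℕ} (h : j ≠ i) (p : D.coset j) (l : ℕ) :
    D.depth i (D.vert j p l) = 0 := by
  cases l <;> simp [vert, depth, h]

/-- The element `g_i` of `g_i P_(i)`. -/
def cosetRep (i : ℕ) : D.coset i := ⟨D.g i, by simp [coset, one_mem]⟩

/-! ## Hyperbolicity and the Gromov boundary -/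

/-- The Gromov product `(x|y)_p`. -/
noncomputable def gromovProduct (p x y : D.Vertex) : ℝ :=
  ((D.graph.dist x p : ℝ) + D.graph.dist y p - D.graph.dist x y) / 2

/-- `G` is hyperbolic relative to the family `P`: the augmented space is Gromov hyperbolic. -/
def IsRelativelyHyperbolic : Prop :=
  ∃ δ : ℝ, ∀ p x y z : D.Vertex,
    min (D.gromovProduct p x y) (D.gromovProduct p y z) - δ ≤ D.gromovProduct p x z

/-- Every geodesic triangle is `δ`-thin: if `u ∈ [x, y]` and `v ∈ [x, z]` satisfy
`d(x, u) = d(x, v) ≤ (y|z)_x`, then `d(u, v) ≤ δ`. -/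
def HasThinTriangles (δ : ℝ) : Prop :=
  ∀ x y z a b : D.Vertex,
    D.graph.dist x a + D.graph.dist a y = D.graph.dist x y →
    D.graph.dist x b + D.graph.dist b z = D.graph.dist x z →
    D.graph.dist x a = D.graph.dist x b →
    (D.graph.dist x a : ℝ) ≤ D.gromovProduct x y z → (D.graph.dist a b : ℝ) ≤ δ

/-- Geodesic rays. -/
structure Ray where
  toFun : ℕ → D.Vertex
  isGeodesic : ∀ m n, m ≤ n → D.graph.dist (toFun m) (toFun n) = n - m

/-- Rays are equivalent if their images are at finite Hausdorff distance. -/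
instance raySetoid : Setoid D.Ray where
  r l l' := ∃ C : ℕ, (∀ m, ∃ n, D.graph.dist (l.toFun m) (l'.toFun n) ≤ C) ∧
    ∀ n, ∃ m, D.graph.dist (l'.toFun n) (l.toFun m) ≤ C
  iseqv :=
    { refl := fun l => ⟨0, fun m => ⟨m, by simp⟩, fun m => ⟨m, by simp⟩⟩
      symm := fun ⟨C, h, h'⟩ => ⟨C, h', h⟩
      trans := by
        rintro l l' l'' ⟨C, h1, h2⟩ ⟨C', h3, h4⟩
        refine ⟨C + C', fun m => ?_, fun m => ?_⟩
        · obtain ⟨n, hn⟩ := h1 m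
          obtain ⟨n', hn'⟩ := h3 n
          exact ⟨n', (D.graph_connected.dist_triangle (v := l'.toFun n)).trans
            (add_le_add hn hn')⟩
        · obtain ⟨n, hn⟩ := h4 m
          obtain ⟨n', hn'⟩ := h2 n
          refine ⟨n', (D.graph_connected.dist_triangle (v := l'.toFun n)).trans ?_⟩
          omega }

/-- The Gromov boundary `∂X(G, P, S)`. -/
def Boundary : Type u := Quotient D.raySetoid

/-- The boundary point `[l]` of a ray. -/
def endpoint (l : D.Ray) : D.Boundary := Quotient.mk _ l

/-- The underlying set of the Gromov compactification of `X(G, P, S)`. -/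
inductive Bordification
  | vertex (x : D.Vertex)
  | bdry (ω : D.Boundary)

instance : Nonempty D.Bordification := ⟨.vertex (.group 1)⟩

/-- A sequence of vertices tends to a point of `X ∪ ∂X`. -/
def TendsTo (x : ℕ → D.Vertex) : D.Bordification → Prop
  | .vertex y => ∀ᶠ n in atTop, x n = y
  | .bdry ω => ∃ l : D.Ray, D.endpoint l = ω ∧
      Tendsto (fun t : ℕ × ℕ => D.gromovProduct (.group 1) (x t.1) (l.toFun t.2)) atTop atTop

/-- The Gromov product on `X ∪ ∂X`, based at the identity of `G`. -/
noncomputable def extGromovProduct (a b : D.Bordification) : EReal :=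
  sSup {c | ∃ x y : ℕ → D.Vertex, D.TendsTo x a ∧ D.TendsTo y b ∧
    c = liminf (fun t : ℕ × ℕ =>
      ((D.gromovProduct (.group 1) (x t.1) (y t.2) : ℝ) : EReal)) atTop}

/-- The topology of the Gromov compactification: vertices are isolated, and the sets
`{z | (ω|z) > R}` are a basis of neighbourhoods of `ω ∈ ∂X`. -/
instance : TopologicalSpace D.Bordification where
  IsOpen U := ∀ ω, .bdry ω ∈ U → ∃ R : ℝ, ∀ z,
    (R : EReal) < D.extGromovProduct (.bdry ω) z → z ∈ U
  isOpen_univ := fun _ _ => ⟨0, fun _ _ => trivial⟩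
  isOpen_inter := by
    intro U V hU hV ω hω
    obtain ⟨R, hR⟩ := hU ω hω.1
    obtain ⟨R', hR'⟩ := hV ω hω.2
    refine ⟨max R R', fun z hz => ⟨hR z (lt_of_le_of_lt ?_ hz), hR' z (lt_of_le_of_lt ?_ hz)⟩⟩
    · exact_mod_cast le_max_left R R'
    · exact_mod_cast le_max_right R R'
  isOpen_sUnion := by
    intro 𝒰 h ω hω
    obtain ⟨U, hU, hω⟩ := hω
    obtain ⟨R, hR⟩ := h U hU ω hω
    exact ⟨R, fun z hz => ⟨U, hU, hR z hz⟩⟩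

instance : TopologicalSpace D.Boundary :=
  TopologicalSpace.induced Bordification.bdry inferInstance

/-- The vertical ray in the `i`-th horoball. -/
def verticalRay (i : ℕ) : D.Ray where
  toFun := D.vert i (D.cosetRep i)
  isGeodesic := by
    intro m n hmn
    apply le_antisymm
    · induction n, hmn using Nat.le_induction with
      | base => simp
      | succ n hmn ih =>
        refine (D.graph_connected.dist_triangle
          (v := D.vert i (D.cosetRep i) n)).trans ?_
        have := SimpleGraph.dist_eq_one_iff_adj.2
          (D.adj_of_edge (D.edge_vert i (D.cosetRep i) n))
        omega
    · have := D.depth_le i (D.vert i (D.cosetRep i) n) (D.vert i (D.cosetRep i) m)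
      rw [depth_vert, depth_vert, SimpleGraph.dist_comm] at this
      omega

/-- The parabolic point `s_i` of the `i`-th horoball. -/
def parabolicPoint (i : ℕ) : D.Boundary := D.endpoint (D.verticalRay i)

theorem parabolicPoint_ne {i j : ℕ} (h : i ≠ j) : D.parabolicPoint i ≠ D.parabolicPoint j := by
  intro e
  obtain ⟨C, h1, -⟩ := Quotient.exact e
  obtain ⟨n, hn⟩ := h1 (C + 1)
  have := D.depth_le i (D.vert i (D.cosetRep i) (C + 1)) (D.vert j (D.cosetRep j) n)
  rw [depth_vert, D.depth_vert_of_ne h.symm] at this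
  have hn' : D.graph.dist (D.vert i (D.cosetRep i) (C + 1)) (D.vert j (D.cosetRep j) n) ≤ C := hn
  omega

/-! ## Subspaces of the augmented space -/

/-- (The vertex set of) `X_n`: the Cayley graph and the horoballs of index at least `n`. -/
def level (n : ℕ) : Set D.Vertex := {a | ∀ i < n, D.depth i a = 0}

/-- (The vertex set of) `X^i`: the Cayley graph and all horoballs but the `i`-th. -/
def offHoroball (i : ℕ) : Set D.Vertex := {a | D.depth i a = 0}

instance (n : ℕ) : Nonempty (D.level n) := ⟨⟨.group 1, fun _ _ => rfl⟩⟩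
instance (i : ℕ) : Nonempty (D.offHoroball i) := ⟨⟨.group 1, rfl⟩⟩

/-- The coarse structure of the augmented space. -/
noncomputable def augCoarse : CoarseStructure D.Vertex :=
  .ofGraph D.graph D.graph_connected

/-- The coarse structure of `X_n`. -/
noncomputable def levelCoarse (n : ℕ) : CoarseStructure (D.level n) :=
  D.augCoarse.pullback Subtype.val

/-- The coarse structure of `X^i`. -/
noncomputable def omitCoarse (i : ℕ) : CoarseStructure (D.offHoroball i) :=
  D.augCoarse.pullback Subtype.val

/-- The coarse structure of `G` given by the word metric. -/
noncomputable def groupCoarse : CoarseStructure G := .ofGraph D.cayley D.cayley_connected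

/-- The coarse structure of `P_r` given by the restriction of the word metric. -/
noncomputable def peripheralCoarse (r : Fin k) : CoarseStructure (D.P r) :=
  D.groupCoarse.pullback Subtype.val

/-- The inclusion `G → X_n`. -/
def groupToLevel (n : ℕ) (x : G) : D.level n := ⟨.group x, fun _ _ => rfl⟩

/-- The inclusion `X_n → X^i` for `i < n`. -/
def levelToOmit {n : ℕ} (i : Fin n) (a : D.level n) : D.offHoroball i := ⟨a.1, a.2 i i.2⟩

/-! ## The complement of a parabolic point -/

/-- `P̂_i = ∂X ∖ {s_i}`, with the subspace topology. -/
abbrev Punctured (i : ℕ) : Type u := {ω : D.Boundary // ω ≠ D.parabolicPoint i}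

instance (i : ℕ) : Nonempty (D.Punctured i) :=
  ⟨⟨D.parabolicPoint (i + 1), D.parabolicPoint_ne (by omega)⟩⟩

/-- A choice of geodesic rays from `e_i = (i, g_i, N)`: a ray `l^ω` to each `ω ∈ P̂_i`, and for
each vertex `x ∈ X^i` a ray `l_x` with `[l_x] ≠ s_i` and a time `t_x` with `l_x(t_x) ∈ X^i`,
at uniformly bounded distance from `x`. -/
structure RayChoice (N i : ℕ) where
  rayTo : D.Punctured i → D.Ray
  rayTo_zero : ∀ ω, (rayTo ω).toFun 0 = D.vert i (D.cosetRep i) N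
  rayTo_endpoint : ∀ ω, D.endpoint (rayTo ω) = ω.1
  rayNear : D.offHoroball i → D.Ray
  time : D.offHoroball i → ℕ
  rayNear_zero : ∀ x, (rayNear x).toFun 0 = D.vert i (D.cosetRep i) N
  rayNear_endpoint : ∀ x, D.endpoint (rayNear x) ≠ D.parabolicPoint i
  rayNear_mem : ∀ x, (rayNear x).toFun (time x) ∈ D.offHoroball i
  rayNear_dist : ∃ R : ℕ, ∀ x, D.graph.dist x.1 ((rayNear x).toFun (time x)) ≤ R

namespace RayChoice

variable {D} {N i : ℕ} (c : D.RayChoice N i)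

/-- The last time `n_i(l)` at which a ray is in `g_i P_(i)`. -/
noncomputable def exitTime (i : ℕ) (l : D.Ray) : ℕ :=
  sSup {n | ∃ p : D.coset i, l.toFun n = .group p}

open Classical in
/-- The map `L_i : P̂_i → g_i P_(i)`, `ω ↦ l^ω(n_i(l^ω))`. -/
noncomputable def L (ω : D.Punctured i) : D.coset i :=
  if h : ∃ p : D.coset i, (c.rayTo ω).toFun (exitTime i (c.rayTo ω)) = .group p then h.choose
  else D.cosetRep i

/-- The map `F_i : X^i → P̂_i`, `x ↦ [l_x]`. -/
def F (x : D.offHoroball i) : D.Punctured i :=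
  ⟨D.endpoint (c.rayNear x), c.rayNear_endpoint x⟩

/-- The coarse structure of `P̂_i`: the pullback along `L_i`. -/
noncomputable def puncturedCoarse : CoarseStructure (D.Punctured i) :=
  D.groupCoarse.pullback fun ω => (c.L ω : G)

/-- The coarse equivalence `P̂_i → g_i P_(i) → P_(i)`, `ω ↦ g_i⁻¹ L_i(ω)`. -/
noncomputable def toPeripheral (ω : D.Punctured i) : D.P (residue k i) :=
  ⟨(D.g i)⁻¹ * (c.L ω : G), (c.L ω).2⟩

/-- The map `hF_i : hX^i → hP̂_i`. -/
noncomputable def hF : HigsonComp (D.omitCoarse i) → HigsonComp c.puncturedCoarse :=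
  higsonMap (D.omitCoarse i) c.puncturedCoarse c.F

variable [TopologicalSpace G] {W : Fin k → Type w} [∀ r, Nonempty (W r)]

/-- The map `hP̂_i → hP_(i)` which identifies `νP̂_i` with `νP_(i)`. -/
noncomputable def hPeripheral :
    HigsonComp c.puncturedCoarse → HigsonComp (D.peripheralCoarse (residue k i)) :=
  higsonMap c.puncturedCoarse (D.peripheralCoarse (residue k i)) c.toPeripheral

open Classical in
/-- The map `ζ_i : νP̂_i ≅ ν(g_i P_(i)) ≅ νP_(i) → W_(i)`. -/
noncomputable def zeta (ζ : ∀ r, HigsonCorona (D.peripheralCoarse r) → W r)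
    (χ : HigsonCorona c.puncturedCoarse) : W (residue k i) :=
  if h : ¬ ∃ x, toHigson (D.peripheralCoarse (residue k i)) x = c.hPeripheral χ.1 then
    ζ (residue k i) ⟨c.hPeripheral χ.1, h⟩
  else Classical.arbitrary _

end RayChoice

/-! ## The blown-up spaces -/

/-- The extension `α : hX → X ∪ ∂X` of the identity of `X`. -/
noncomputable def alpha : HigsonComp D.augCoarse → D.Bordification :=
  higsonExt D.augCoarse Bordification.vertex

/-- `α` on `νX_n ⊆ νX`. -/
noncomputable def alphaLevel (n : ℕ) (χ : HigsonComp (D.levelCoarse n)) : D.Bordification :=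
  D.alpha (higsonMap (D.levelCoarse n) D.augCoarse Subtype.val χ)

section Blowup

variable {D} [TopologicalSpace G] {N : ℕ} {W : Fin k → Type w} [∀ r, Nonempty (W r)]
  (c : ∀ i, D.RayChoice N i) (ζ : ∀ r, HigsonCorona (D.peripheralCoarse r) → W r)

/-- The underlying set `(∂X ∖ {s_i | i < n}) ⊔ ⨆_{i < n} W_i` of the `n`-th blown-up `∂X_n`. -/
inductive Blowup (c : ∀ i, D.RayChoice N i)
    (ζ : ∀ r, HigsonCorona (D.peripheralCoarse r) → W r) (n : ℕ) : Type (max u w)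
  | base (ω : {ω : D.Boundary // ∀ i : Fin n, ω ≠ D.parabolicPoint i})
  | blown (i : Fin n) (z : W (residue k i))

namespace Blowup

variable {c ζ}

/-- The map `∂X_n → ∂X` which collapses `W_i` to `s_i`. -/
def collapse {n : ℕ} : Blowup c ζ n → D.Boundary
  | .base ω => ω.1
  | .blown i _ => D.parabolicPoint i

/-- The map `σ_i : ∂X_n → P̂_i ∪ W_i`, which collapses `W_j` to `s_j` for `j ≠ i`. -/
noncomputable def sigma {n : ℕ} (i : Fin n) : Blowup c ζ n → CoronaUnion ((c i).zeta ζ)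
  | .base ω => .inner ⟨ω.1, ω.2 i⟩
  | .blown j z =>
    if h : j = i then .outer (h ▸ z)
    else .inner ⟨D.parabolicPoint j, D.parabolicPoint_ne fun e => h (Fin.ext e)⟩

/-- The weakest topology making all `σ_i` continuous. For `n ≥ 1` the collapsing map to `∂X`
is then continuous as well; for `n = 0` it gives `∂X_0` the topology of `∂X`. -/
noncomputable instance [∀ r, TopologicalSpace (W r)] (n : ℕ) : TopologicalSpace (Blowup c ζ n) :=
  TopologicalSpace.induced collapse inferInstance ⊓
    ⨅ i : Fin n, TopologicalSpace.induced (sigma i) inferInstance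

/-- The projection `∂X_{n+1} → ∂X_n`, which collapses `W_n` to `s_n`. -/
def proj {n : ℕ} : Blowup c ζ (n + 1) → Blowup c ζ n
  | .base ω => .base ⟨ω.1, fun i => ω.2 i.castSucc⟩
  | .blown i z =>
    if h : i.1 < n then .blown ⟨i.1, h⟩ z
    else .base ⟨D.parabolicPoint i, fun j => D.parabolicPoint_ne (by omega)⟩

end Blowup

/-- The blown-up corona `∂X_∞`, the projective limit of the `∂X_n`. -/
abbrev BlowupLimit : Type (max u w) :=
  {x : ∀ n, Blowup c ζ n // ∀ n, Blowup.proj (x (n + 1)) = x n}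

/-- `ξ : νX_n → ∂X_n` is the map `ξ_n`: if `α(χ)` is none of the `s_i`, `i < n`, then
`ξ(χ) = α(χ) ∈ ∂X`, and if `α(χ) = s_i` then `ξ(χ) = ζ̄_i(hF_i(χ)) ∈ W_i`.
This determines `ξ`. -/
def IsXi (n : ℕ) (ξ : HigsonCorona (D.levelCoarse n) → Blowup c ζ n) : Prop :=
  ∀ χ : HigsonCorona (D.levelCoarse n),
    ((∀ i : Fin n, D.alphaLevel n χ.1 ≠ .bdry (D.parabolicPoint i)) →
      ∃ ω, D.alphaLevel n χ.1 = .bdry ω.1 ∧ ξ χ = .base ω) ∧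
    ∀ i : Fin n, D.alphaLevel n χ.1 = .bdry (D.parabolicPoint i) →
      ∃ z, coronaBar ((c i).zeta ζ)
          ((c i).hF (higsonMap (D.levelCoarse n) (D.omitCoarse i) (D.levelToOmit i) χ.1)) =
            .outer z ∧ ξ χ = .blown i z

/-- `ξ : νG → ∂X_∞` is the map `ξ_∞` with components the restrictions of `ξ_n` to
`νG ⊆ νX_n`. -/
def IsXiLimit (ξ : ∀ n, HigsonCorona (D.levelCoarse n) → Blowup c ζ n)
    (ξ' : HigsonCorona D.groupCoarse → BlowupLimit c ζ) : Prop :=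
  ∀ χ n, ∃ y : HigsonCorona (D.levelCoarse n),
    y.1 = higsonMap D.groupCoarse (D.levelCoarse n) (D.groupToLevel n) χ.1 ∧
      (ξ' χ).1 n = ξ n y

end Blowup

end PeripheralGroup

end BlownUp

namespace BlownUp
universe u v w

/-! ## Leaving bounded sets -/

section Bounded

variable {X : Type u}

/-! A map from a discrete coarse space to a compact Hausdorff space extends continuously to the
Higson compactification as soon as pairs that stay a controlled distance apart and leave every
bounded set have the same limit (`isHigsonExtension_of_asymptotic`, tested on ultrafilters). All the
maps that start in the augmented space or in `G` are obtained in this way, or by pulling back Higson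
functions along coarse maps. For `alpha` the criterion is immediate: vertices at bounded distance
that go to infinity have unbounded Gromov product, so they have the same limit in `X ∪ ∂X`.

For `F_i` it rests on the geometry of rays from the apex `e_i`. The distance to a very deep vertical
point is, up to an error of 1, a Busemann function of the horoball, and the four-point inequality
shows that a geodesic from `e_i` to a point near the horosphere is shallow only near its two ends
(`FourPoint.shallow`). Hence a ray that has left the horoball does not come back near it, and
fellow-travelling rays leave it at close points. It follows that `L_i` is locally constant up to a
bounded error (`exists_L_local`), that `L_i ∘ F_i` is bornologous (`exists_LF_dist_le`), and that
`L_i ∘ F_i` is close to the identity on the coset (`exists_LF_coset`). The first fact, together with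
`exists_not_close`, makes the coarse structure of `P̂_i` proper. To extend `F_i`, consider an
asymptotic pair: either its image leaves the bounded sets of `P̂_i`, and then it is again
asymptotic, or the image stays in a compact set, and then `F_i(x)` and `x` converge to the same
boundary point (`isHigsonExtension_hF`). `L_i` need not be continuous, so it is replaced by
continuous selections when passing to coronae (`IsCoarseMap.exists_tendsto_of_local`).

For a corona `(W, ζ)` of a proper second countable locally compact Hausdorff space `Y`, the space `Y
∪_ζ W` is compact, and countably many continuous real functions separate its points, so it is
metrizable. The maps `collapse` and `sigma` identify `∂X_n` with the closed subspace of the product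
of `∂X` and the spaces `P̂_i ∪ W_i` given by equality of the images in `∂X` (`range_toProd`,
`isClosedEmbedding_toProd`). Compactness and metrizability of `∂X_n` follow, and so does the
continuity of `ξ_n`, whose coordinates are `alpha` and the composites `hX_n → hX^i → hP̂_i → P̂_i ∪
W_i`. The limit `∂X_∞` is closed in a countable product.

Surjectivity is already visible on `νG`. Elements of `G` accumulate at every boundary point, which
settles the points of `∂X` that are not blown up. A point `ζ θ` of `W_i` is hit by any limit in `νG`
of the elements `g_i p` as `p` tends to `θ`, because `L_i(F_i(g_i p))` stays close to `g_i p`. For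
`ξ_∞`, the fibres at the finite levels form a decreasing sequence of nonempty closed subsets of the
compact space `νG`. -/

theorem CoarseStructure.IsBdd.mono {E : CoarseStructure X} {B B' : Set X} (h : E.IsBdd B')
    (hB : B ⊆ B') : E.IsBdd B :=
  E.subset_mem _ h _ (Set.prod_mono hB hB)

theorem CoarseStructure.isBdd_singleton (E : CoarseStructure X) (x : X) : E.IsBdd {x} := by
  refine E.subset_mem _ (E.connected x x) _ ?_
  rintro ⟨a, b⟩ ⟨ha, hb⟩
  simp_all

theorem CoarseStructure.isBdd_empty (E : CoarseStructure X) : E.IsBdd ∅ :=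
  E.subset_mem _ E.diagonal_mem _ (by simp)

theorem CoarseStructure.IsBdd.thicken {E : CoarseStructure X} {B : Set X} (h : E.IsBdd B)
    {A : Set (X × X)} (hA : A ∈ E.controlled) : E.IsBdd {y | ∃ x ∈ B, (x, y) ∈ A} := by
  refine E.subset_mem _ (E.product_mem _ (E.inverse_mem _ hA) _ (E.product_mem _ h _ hA)) _ ?_
  rintro ⟨y, y'⟩ ⟨⟨x, hx, hxy⟩, ⟨x', hx', hxy'⟩⟩
  exact ⟨x, hxy, x', ⟨hx, hx'⟩, hxy'⟩

theorem CoarseStructure.IsBdd.biUnion {E : CoarseStructure X} {ι : Type*} (s : Finset ι)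
    {B : ι → Set X} (h : ∀ i ∈ s, E.IsBdd (B i)) : E.IsBdd (⋃ i ∈ s, B i) := by
  classical
  induction s using Finset.induction_on with
  | empty => simpa using E.isBdd_empty
  | insert a s ha ih =>
    rw [Finset.set_biUnion_insert]
    exact (h a (by simp)).union (ih fun i hi => h i (by simp [hi]))

theorem CoarseStructure.isBdd_finite (E : CoarseStructure X) {B : Set X} (h : B.Finite) :
    E.IsBdd B := by
  refine (CoarseStructure.IsBdd.biUnion h.toFinset fun i _ => E.isBdd_singleton i).mono ?_
  intro x hx
  simpa using hx

/-- A family of pairs `(u i, v i)` is asymptotic if it is controlled and leaves bounded sets. -/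
structure IsAsymptotic (E : CoarseStructure X) {ι : Type*} (l : Filter ι) (u v : ι → X) :
    Prop where
  controlled : ∃ A ∈ E.controlled, ∀ᶠ i in l, (u i, v i) ∈ A
  left : ∀ B, E.IsBdd B → ∀ᶠ i in l, u i ∉ B
  right : ∀ B, E.IsBdd B → ∀ᶠ i in l, v i ∉ B

theorem IsAsymptotic.tendsto_sub {E : CoarseStructure X} {ι : Type*} {l : Filter ι} {u v : ι → X}
    (h : IsAsymptotic E l u v) {g : X → ℂ} (hg : IsHigson E g) :
    Tendsto (fun i => g (v i) - g (u i)) l (𝓝 0) := by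
  obtain ⟨A, hA, hl⟩ := h.controlled
  rw [Metric.tendsto_nhds]
  intro ε hε
  obtain ⟨B, hB, hgB⟩ := hg A hA ε hε
  filter_upwards [hl, h.left B hB] with i hi hiB
  rw [dist_zero_right]
  exact hgB _ hi fun hh => hiB hh.1

/-- A map to a compact space which identifies the limits of asymptotic pairs pulls back continuous
functions to functions of vanishing variation. -/
theorem isHigson_comp_of_asymptotic {E : CoarseStructure X} {Z : Type v} [TopologicalSpace Z]
    [CompactSpace Z] {f : X → Z}
    (h : ∀ (U : Ultrafilter (X × X)) (a b : Z),
        IsAsymptotic E (U : Filter (X × X)) Prod.fst Prod.snd →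
      Tendsto (fun z : X × X => f z.1) U (𝓝 a) → Tendsto (fun z : X × X => f z.2) U (𝓝 b) → a = b)
    {φ : Z → ℂ} (hφ : Continuous φ) : IsHigson E (fun x => φ (f x)) := by
  intro A hA ε hε
  by_contra! hcon
  -- The pairs of `A` that violate the estimate outside `B × B` form a filter base as `B` grows,
  -- since a union of two bounded sets is bounded. Any finer ultrafilter is asymptotic.
  let l : Filter (X × X) :=
    ⨅ B : {B : Set X // E.IsBdd B}, 𝓟 {z | z ∈ A ∧ z ∉ B.1 ×ˢ B.1 ∧ ε ≤ ‖φ (f z.2) - φ (f z.1)‖}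
  have hmem : ∀ B, E.IsBdd B →
      {z | z ∈ A ∧ z ∉ B ×ˢ B ∧ ε ≤ ‖φ (f z.2) - φ (f z.1)‖} ∈ l := fun B hB =>
    mem_iInf_of_mem ⟨B, hB⟩ (mem_principal_self _)
  have : Nonempty {B : Set X // E.IsBdd B} := ⟨⟨∅, E.isBdd_empty⟩⟩
  have : l.NeBot := by
    refine iInf_neBot_of_directed' ?_ ?_
    · rintro ⟨B, hB⟩ ⟨B', hB'⟩
      refine ⟨⟨B ∪ B', hB.union hB'⟩, ?_, ?_⟩ <;>
      · refine principal_mono.2 ?_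
        rintro z ⟨h1, h2, h3⟩
        refine ⟨h1, fun hz => h2 ?_, h3⟩
        first
        | exact ⟨Or.inl hz.1, Or.inl hz.2⟩
        | exact ⟨Or.inr hz.1, Or.inr hz.2⟩
    · rintro ⟨B, hB⟩
      rw [principal_neBot_iff]
      obtain ⟨z, h1, h2, h3⟩ := hcon B hB
      exact ⟨z, h1, h2, h3⟩
  let U := Ultrafilter.of l
  have hU : ∀ B, E.IsBdd B → ∀ᶠ z in (U : Filter (X × X)), z ∈ A ∧ z ∉ B ×ˢ B ∧
      ε ≤ ‖φ (f z.2) - φ (f z.1)‖ := fun B hB => Ultrafilter.of_le l (hmem B hB)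
  have has : IsAsymptotic E (U : Filter (X × X)) Prod.fst Prod.snd := by
    refine ⟨⟨A, hA, (hU ∅ E.isBdd_empty).mono fun z hz => hz.1⟩, fun B hB => ?_, fun B hB => ?_⟩
    -- If the first point were in `B`, the second would be in the `A`-thickening of `B`, and the
    -- pair would lie in the square of a bounded set.
    · filter_upwards [hU _ (hB.union (hB.thicken hA))] with z hz hzB
      exact hz.2.1 ⟨Or.inl hzB, Or.inr ⟨_, hzB, hz.1⟩⟩
    · filter_upwards [hU _ (hB.union (hB.thicken (E.inverse_mem _ hA)))] with z hz hzB
      exact hz.2.1 ⟨Or.inr ⟨_, hzB, hz.1⟩, Or.inl hzB⟩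
  have hlim : ∀ p : X × X → Z, ∃ z, Tendsto p U (𝓝 z) := fun p => by
    obtain ⟨z, -, hz⟩ := isCompact_iff_ultrafilter_le_nhds.1 (isCompact_univ (X := Z))
      (U.map p) (by simp)
    exact ⟨z, hz⟩
  obtain ⟨a, ha⟩ := hlim fun z => f z.1
  obtain ⟨b, hb⟩ := hlim fun z => f z.2
  have hab := h U a b has ha hb
  subst hab
  have h1 := ((hφ.tendsto _).comp hb).sub ((hφ.tendsto _).comp ha)
  rw [sub_self] at h1
  have h2 := h1.norm
  rw [norm_zero] at h2
  have h3 : ε ≤ 0 := ge_of_tendsto h2 ((hU ∅ E.isBdd_empty).mono fun z hz => hz.2.2)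
  linarith

end Bounded

/-! ## Generalities on the Higson compactification -/

section HigsonGeneral

variable {X : Type u} [TopologicalSpace X]

/-- Vanishing variation passes to uniform limits by an `ε / 3` estimate. The resulting completeness
is what allows Gelfand duality in `denseRange_toHigson`. -/
theorem isClosed_higsonAlgebra (E : CoarseStructure X) :
    IsClosed (higsonAlgebra E : Set (X →ᵇ ℂ)) := by
  refine isClosed_of_closure_subset fun f hf A hA ε hε => ?_
  obtain ⟨g, hg, hfg⟩ := Metric.mem_closure_iff.1 hf (ε / 3) (by positivity)
  obtain ⟨B, hB, h⟩ := hg A hA (ε / 3) (by positivity)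
  refine ⟨B, hB, fun z hz hn => ?_⟩
  have h1 := h z hz hn
  have h2 : dist (f z.1) (g z.1) < ε / 3 := (f.dist_coe_le_dist z.1).trans_lt hfg
  have h3 : dist (f z.2) (g z.2) < ε / 3 := (f.dist_coe_le_dist z.2).trans_lt hfg
  rw [← dist_eq_norm] at h1 ⊢
  have h4 := dist_triangle4 (f z.2) (g z.2) (g z.1) (f z.1)
  rw [dist_comm (g z.1)] at h4
  linarith

instance (E : CoarseStructure X) : IsClosed (higsonAlgebra E : Set (X →ᵇ ℂ)) :=
  isClosed_higsonAlgebra E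

instance (E : CoarseStructure X) : CompleteSpace (higsonAlgebra E) :=
  (isClosed_higsonAlgebra E).completeSpace_coe

instance (E : CoarseStructure X) : CompactSpace (HigsonComp E) := inferInstance

instance (E : CoarseStructure X) : T2Space (HigsonComp E) := inferInstance

theorem toHigson_apply (E : CoarseStructure X) (x : X) (g : higsonAlgebra E) :
    toHigson E x g = g.1 x := rfl

theorem tendsto_higsonComp_iff {E : CoarseStructure X} {ι : Type*} {l : Filter ι}
    {u : ι → HigsonComp E} {χ : HigsonComp E} :
    Tendsto u l (𝓝 χ) ↔ ∀ g : higsonAlgebra E, Tendsto (fun i => u i g) l (𝓝 (χ g)) := by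
  rw [tendsto_subtype_rng, tendsto_iff_forall_eval_tendsto_topDualPairing]
  rfl

theorem continuous_higsonComp_apply {E : CoarseStructure X} (g : higsonAlgebra E) :
    Continuous fun χ : HigsonComp E => χ g :=
  continuous_iff_continuousAt.2 fun _ => tendsto_higsonComp_iff.1 tendsto_id g

theorem continuous_toHigson (E : CoarseStructure X) : Continuous (toHigson E) :=
  continuous_iff_continuousAt.2 fun x =>
    tendsto_higsonComp_iff.2 fun g => g.1.continuous.tendsto x

/-- A Urysohn function that vanishes on the closure of `X` and is 1 at a missed point would be the
Gelfand transform of some `g`. Its values on `X` show that `g` is zero, a contradiction. -/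
theorem denseRange_toHigson (E : CoarseStructure X) : DenseRange (toHigson E) := by
  by_contra hd
  obtain ⟨χ, hχ⟩ : ∃ χ, χ ∉ closure (Set.range (toHigson E)) := by
    simpa [DenseRange, Dense] using hd
  obtain ⟨f, hf0, hf1, -⟩ := exists_continuous_zero_one_of_isClosed
    (isClosed_closure (s := Set.range (toHigson E))) (isClosed_singleton (x := χ))
    (Set.disjoint_singleton_right.2 hχ)
  obtain ⟨g, hg⟩ := (gelfandTransform_bijective (higsonAlgebra E)).2
    ⟨fun θ => (f θ : ℂ), by fun_prop⟩
  have hgv : ∀ θ : HigsonComp E, θ g = f θ := fun θ => DFunLike.congr_fun hg θ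
  have hg0 : g = 0 := by
    ext x
    have h1 := hgv (toHigson E x)
    rw [hf0 (subset_closure ⟨x, rfl⟩)] at h1
    simpa [toHigson_apply] using h1
  have h1 := hgv χ
  rw [hf1 rfl, hg0] at h1
  simp at h1

/-- The trace on `X` of the neighbourhoods of a point of `hX`. -/
noncomputable def higsonFilter (E : CoarseStructure X) (χ : HigsonComp E) : Filter X :=
  comap (toHigson E) (𝓝 χ)

instance (E : CoarseStructure X) (χ : HigsonComp E) : (higsonFilter E χ).NeBot :=
  comap_neBot_iff.2 fun t ht => by
    obtain ⟨_, h, x, rfl⟩ := mem_closure_iff_nhds.1 (denseRange_toHigson E χ) t ht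
    exact ⟨x, h⟩

theorem tendsto_toHigson_higsonFilter (E : CoarseStructure X) (χ : HigsonComp E) :
    Tendsto (toHigson E) (higsonFilter E χ) (𝓝 χ) := tendsto_comap

theorem tendsto_apply_higsonFilter {E : CoarseStructure X} (χ : HigsonComp E)
    (g : higsonAlgebra E) : Tendsto (fun x => g.1 x) (higsonFilter E χ) (𝓝 (χ g)) :=
  tendsto_higsonComp_iff.1 (tendsto_toHigson_higsonFilter E χ) g

theorem le_higsonFilter {E : CoarseStructure X} {χ : HigsonComp E} {l : Filter X}
    (h : Tendsto (toHigson E) l (𝓝 χ)) : l ≤ higsonFilter E χ :=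
  tendsto_iff_comap.1 h

theorem higsonFilter_toHigson (E : CoarseStructure X) (x : X) :
    𝓝 x ≤ higsonFilter E (toHigson E x) :=
  le_higsonFilter (continuous_toHigson E).continuousAt

theorem higsonComp_ext {E : CoarseStructure X} {χ θ : HigsonComp E} (h : ∀ g, χ g = θ g) :
    χ = θ := by
  have h1 : Tendsto (fun _ : Unit => χ) ⊤ (𝓝 θ) :=
    tendsto_higsonComp_iff.2 fun g => by rw [← h g]; exact tendsto_const_nhds
  exact tendsto_nhds_unique tendsto_const_nhds h1

/-- Compactness gives every finer ultrafilter a limit. The limits agree because a point-separating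
family of continuous functions takes the same values on them. -/
theorem exists_tendsto_of_separating {Y : Type*} {Z : Type*} [TopologicalSpace Z] [CompactSpace Z]
    {D : Set (Z → ℂ)} (hD : ∀ φ ∈ D, Continuous φ)
    (hsep : ∀ a b : Z, (∀ φ ∈ D, φ a = φ b) → a = b)
    {l : Filter Y} [l.NeBot] {f : Y → Z} (h : ∀ φ ∈ D, ∃ c, Tendsto (fun y => φ (f y)) l (𝓝 c)) :
    ∃ z, Tendsto f l (𝓝 z) := by
  have hlim : ∀ U : Ultrafilter Y, ∃ z, Tendsto f U (𝓝 z) := fun U => by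
    obtain ⟨z, -, hz⟩ := isCompact_iff_ultrafilter_le_nhds.1 (isCompact_univ (X := Z))
      (U.map f) (by simp)
    exact ⟨z, hz⟩
  obtain ⟨z, hz⟩ := hlim (Ultrafilter.of l)
  refine ⟨z, tendsto_iff_ultrafilter _ _ _ |>.2 fun U hU => ?_⟩
  obtain ⟨z', hz'⟩ := hlim U
  have : z' = z := hsep _ _ fun φ hφ => by
    obtain ⟨c, hc⟩ := h φ hφ
    have h1 := tendsto_nhds_unique ((hD φ hφ).continuousAt.tendsto.comp hz') (hc.mono_left hU)
    have h2 := tendsto_nhds_unique ((hD φ hφ).continuousAt.tendsto.comp hz)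
      (hc.mono_left (Ultrafilter.of_le l))
    rw [h1, h2]
  exact this ▸ hz'

theorem tendsto_higsonExt {E : CoarseStructure X} {Z : Type v} [TopologicalSpace Z] [Nonempty Z]
    {f : X → Z} {χ : HigsonComp E} (h : ∃ z, Tendsto f (higsonFilter E χ) (𝓝 z)) :
    Tendsto f (higsonFilter E χ) (𝓝 (higsonExt E f χ)) :=
  tendsto_nhds_limUnder h

/-- Extension by continuity. In a regular space it is enough to test closed neighbourhoods `V` of
the value at `χ`; if `f` maps the trace on `X` of an open set into `V`, then all limits at points of
that open set lie in `V`. -/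
theorem continuousOn_higsonExt {E : CoarseStructure X} {Z : Type v} [TopologicalSpace Z]
    [RegularSpace Z] [Nonempty Z] {f : X → Z} {S : Set (HigsonComp E)}
    (h : ∀ χ ∈ S, ∃ z, Tendsto f (higsonFilter E χ) (𝓝 z)) : ContinuousOn (higsonExt E f) S := by
  intro χ hχ
  refine (closed_nhds_basis (higsonExt E f χ)).tendsto_right_iff.2 ?_
  rintro V ⟨hV, hVc⟩
  obtain ⟨O, hO, hOV⟩ := mem_comap.1 (tendsto_higsonExt (h χ hχ) hV)
  obtain ⟨O', hO'O, hO', hχO'⟩ := mem_nhds_iff.1 hO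
  filter_upwards [mem_nhdsWithin_of_mem_nhds (hO'.mem_nhds hχO'), self_mem_nhdsWithin]
    with θ hθ hθS
  refine hVc.mem_of_tendsto (tendsto_higsonExt (h θ hθS)) ?_
  filter_upwards [preimage_mem_comap (m := toHigson E) (hO'.mem_nhds hθ)] with x hx
  exact hOV (hO'O hx)

theorem isHigsonExtension_higsonExt {E : CoarseStructure X} {Z : Type v} [TopologicalSpace Z]
    [T3Space Z] [Nonempty Z] {f : X → Z}
    (hf : Continuous f) (h : ∀ χ, ∃ z, Tendsto f (higsonFilter E χ) (𝓝 z)) :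
    IsHigsonExtension E f (higsonExt E f) := by
  refine ⟨continuousOn_univ.1 (continuousOn_higsonExt fun χ _ => h χ), fun x => ?_⟩
  exact tendsto_nhds_unique ((tendsto_higsonExt (h _)).mono_left (higsonFilter_toHigson E x))
    hf.continuousAt

/-- An extension to `hX` computes limits. -/
theorem IsHigsonExtension.tendsto {E : CoarseStructure X} {Z : Type v} [TopologicalSpace Z]
    {f : X → Z} {F : HigsonComp E → Z} (h : IsHigsonExtension E f F) {ι : Type*} {l : Filter ι}
    {u : ι → X} {χ : HigsonComp E} (hu : Tendsto (fun i => toHigson E (u i)) l (𝓝 χ)) :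
    Tendsto (fun i => f (u i)) l (𝓝 (F χ)) := by
  have h1 := (h.1.tendsto χ).comp hu
  refine h1.congr fun i => h.2 _

/-- A bounded continuous function of vanishing variation, as an element of the algebra. -/
noncomputable def mkHigson (E : CoarseStructure X) (f : X → ℂ) (hc : Continuous f) (C : ℝ)
    (hC : ∀ x, ‖f x‖ ≤ C) (hf : IsHigson E f) : higsonAlgebra E :=
  ⟨BoundedContinuousFunction.ofNormedAddCommGroup f hc C hC, hf⟩

theorem mkHigson_apply {E : CoarseStructure X} {f : X → ℂ} {hc : Continuous f} {C : ℝ}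
    {hC : ∀ x, ‖f x‖ ≤ C} {hf : IsHigson E f} (x : X) : (mkHigson E f hc C hC hf).1 x = f x := rfl

theorem tendsto_of_isHigson {E : CoarseStructure X} {f : X → ℂ} (hc : Continuous f) {C : ℝ}
    (hC : ∀ x, ‖f x‖ ≤ C) (hf : IsHigson E f) (χ : HigsonComp E) :
    Tendsto f (higsonFilter E χ) (𝓝 (χ (mkHigson E f hc C hC hf))) :=
  tendsto_apply_higsonFilter χ (mkHigson E f hc C hC hf)

/-- Extension of maps to compact metrizable spaces. -/
theorem isHigsonExtension_of_asymptotic {E : CoarseStructure X} {Z : Type v} [TopologicalSpace Z]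
    [CompactSpace Z] [T2Space Z] [Nonempty Z] {f : X → Z} (hf : Continuous f)
    (h : ∀ (U : Ultrafilter (X × X)) (a b : Z),
        IsAsymptotic E (U : Filter (X × X)) Prod.fst Prod.snd →
      Tendsto (fun z : X × X => f z.1) U (𝓝 a) → Tendsto (fun z : X × X => f z.2) U (𝓝 b) → a = b) :
    IsHigsonExtension E f (higsonExt E f) := by
  refine isHigsonExtension_higsonExt hf fun χ => ?_
  refine exists_tendsto_of_separating (D := {φ | Continuous φ}) (fun _ h => h) ?_ ?_
  · intro a b hab
    by_contra hne
    obtain ⟨g, hg0, hg1, -⟩ := exists_continuous_zero_one_of_isClosed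
      (isClosed_singleton (x := a)) (isClosed_singleton (x := b))
      (Set.disjoint_singleton.2 hne)
    have := hab (fun z => (g z : ℂ)) (by show Continuous _; fun_prop)
    simp only [hg0 rfl, hg1 rfl] at this
    simp at this
  · intro φ hφ
    obtain ⟨C, hC⟩ := (isCompact_range (f := φ) hφ).isBounded.exists_norm_le
    exact ⟨_, tendsto_of_isHigson ((show Continuous φ from hφ).comp hf)
      (fun x => hC _ ⟨_, rfl⟩) (isHigson_comp_of_asymptotic h hφ) χ⟩

end HigsonGeneral

end BlownUp

namespace BlownUp
universe u v w

/-! ## Proper coarse structures -/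

/-- A coarse structure is proper if the bounded sets are the relatively compact sets. -/
structure IsProperCoarse {X : Type u} [TopologicalSpace X] (E : CoarseStructure X) : Prop where
  isCompact_closure : ∀ B, E.IsBdd B → IsCompact (closure B)
  isBdd_of_isCompact : ∀ K, IsCompact K → E.IsBdd K

theorem isProperCoarse_of_finite {X : Type u} [TopologicalSpace X] [DiscreteTopology X]
    {E : CoarseStructure X} (h : ∀ B, E.IsBdd B → B.Finite) : IsProperCoarse E where
  isCompact_closure B hB := by
    rw [closure_discrete]
    exact (h B hB).isCompact
  isBdd_of_isCompact K hK := E.isBdd_finite hK.finite_of_discrete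

/-- A controlled pair that meets `B` lies in the square of a bounded thickening of `B`, and on every
other pair of the controlled set the difference is zero. -/
theorem isHigson_of_eq_zero {X : Type u} {E : CoarseStructure X} {f : X → ℂ} {B : Set X}
    (hB : E.IsBdd B) (hf : ∀ x, x ∉ B → f x = 0) : IsHigson E f := by
  intro A hA ε hε
  refine ⟨_, hB.union ((hB.thicken hA).union (hB.thicken (E.inverse_mem _ hA))), fun z hz hn => ?_⟩
  have h1 : z.1 ∉ B := fun h => hn ⟨Or.inl h, Or.inr (Or.inl ⟨_, h, hz⟩)⟩
  have h2 : z.2 ∉ B := fun h => hn ⟨Or.inr (Or.inr ⟨_, h, hz⟩), Or.inl h⟩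
  rw [hf _ h1, hf _ h2]
  simpa using hε

/-- The function is 1 on a whole neighbourhood `V` and not only at `x`, so that
`exists_separating_bumps` can choose bumps that depend only on basic open sets. -/
theorem exists_bump {X : Type u} [TopologicalSpace X] [T2Space X] [LocallyCompactSpace X]
    {x : X} {U : Set X} (hU : U ∈ 𝓝 x) :
    ∃ (K V : Set X) (f : C(X, ℝ)), IsCompact K ∧ V ∈ 𝓝 x ∧ K ⊆ U ∧ (∀ y ∈ V, f y = 1) ∧
      (∀ y, y ∉ K → f y = 0) ∧ ∀ y, f y ∈ Set.Icc (0 : ℝ) 1 := by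
  obtain ⟨K, hK, hKU, hKc⟩ := local_compact_nhds hU
  obtain ⟨L, hL, hLK, hLc⟩ := local_compact_nhds (interior_mem_nhds.2 hK)
  obtain ⟨f, hf1, hf0, hf⟩ := exists_continuous_one_zero_of_isCompact hLc
    isOpen_interior.isClosed_compl (Set.disjoint_compl_right_iff_subset.2 hLK)
  refine ⟨K, L, f, hKc, hL, hKU, fun y hy => hf1 hy, fun y hy => hf0 fun h => hy ?_, hf.2⟩
  exact interior_subset h

section Proper

variable {X : Type u} [TopologicalSpace X] {E : CoarseStructure X}

/-- The image of the compact closure of `B` is closed in the Hausdorff space `hX` and does not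
contain a point of the corona. -/
theorem IsProperCoarse.compl_mem_higsonFilter (hE : IsProperCoarse E) {χ : HigsonComp E}
    (hχ : ¬ ∃ x, toHigson E x = χ) {B : Set X} (hB : E.IsBdd B) : Bᶜ ∈ higsonFilter E χ := by
  have hc : IsClosed (toHigson E '' closure B) :=
    ((hE.isCompact_closure B hB).image (continuous_toHigson E)).isClosed
  refine mem_of_superset (preimage_mem_comap (hc.isOpen_compl.mem_nhds ?_)) ?_
  · rintro ⟨x, -, hx⟩
    exact hχ ⟨x, hx⟩
  · intro x hx hxB
    exact hx ⟨x, subset_closure hxB, rfl⟩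

theorem IsProperCoarse.corona_apply_eq_zero (hE : IsProperCoarse E) {χ : HigsonComp E}
    (hχ : ¬ ∃ x, toHigson E x = χ) {B : Set X} (hB : E.IsBdd B) {g : higsonAlgebra E}
    (hg : ∀ x, x ∉ B → g.1 x = 0) : χ g = 0 := by
  refine tendsto_nhds_unique (tendsto_apply_higsonFilter χ g)
    (tendsto_const_nhds.congr' ?_)
  filter_upwards [hE.compl_mem_higsonFilter hχ hB] with x hx
  exact (hg x hx).symm

/-- A continuous function of compact support, extended by zero to `hX`. -/
theorem IsProperCoarse.exists_extension_of_compact_support (hE : IsProperCoarse E) (f : C(X, ℝ))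
    {K : Set X} (hK : IsCompact K) (hf : ∀ x, x ∉ K → f x = 0) :
    ∃ F : HigsonComp E → ℝ, Continuous F ∧ (∀ x, F (toHigson E x) = f x) ∧
      ∀ χ : HigsonCorona E, F χ.1 = 0 := by
  obtain ⟨C, hC⟩ := (hK.image f.continuous).isBounded.exists_norm_le
  have hb : ∀ x, ‖(f x : ℂ)‖ ≤ max C 0 := fun x => by
    rw [Complex.norm_real]
    by_cases hx : x ∈ K
    · exact (hC _ ⟨x, hx, rfl⟩).trans (le_max_left _ _)
    · simp [hf x hx]
  let g := mkHigson E (fun x => (f x : ℂ)) (by fun_prop) _ hb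
    (isHigson_of_eq_zero (hE.isBdd_of_isCompact K hK) fun x hx => by simp [hf x hx])
  refine ⟨fun χ => (χ g).re, Complex.continuous_re.comp (continuous_higsonComp_apply g),
    fun x => ?_, fun χ => ?_⟩
  · exact Complex.ofReal_re _
  · have h0 : χ.1 g = 0 := hE.corona_apply_eq_zero χ.2 (hE.isBdd_of_isCompact K hK)
      fun x hx => ?_
    · exact congrArg Complex.re h0
    rw [mkHigson_apply, hf x hx, Complex.ofReal_zero]

variable [T2Space X] [LocallyCompactSpace X]

theorem IsProperCoarse.exists_higson_bump (hE : IsProperCoarse E) {x : X} {U : Set X}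
    (hU : U ∈ 𝓝 x) : ∃ (g : higsonAlgebra E) (B : Set X), E.IsBdd B ∧ B ⊆ U ∧ g.1 x = 1 ∧
      ∀ y, y ∉ B → g.1 y = 0 := by
  obtain ⟨K, V, f, hK, hV, hKU, hf1, hf0, hf⟩ := exists_bump hU
  refine ⟨mkHigson E (fun y => (f y : ℂ)) (by fun_prop) 1 (fun y => ?_)
    (isHigson_of_eq_zero (hE.isBdd_of_isCompact K hK) fun y hy => by simp [hf0 y hy]), K,
    hE.isBdd_of_isCompact K hK, hKU, ?_, fun y hy => ?_⟩
  · rw [Complex.norm_real, Real.norm_of_nonneg (hf y).1]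
    exact (hf y).2
  · rw [mkHigson_apply, hf1 x (mem_of_mem_nhds hV), Complex.ofReal_one]
  · rw [mkHigson_apply, hf0 y hy, Complex.ofReal_zero]

/-- A Higson bump at `x` vanishes on the corona. The set where it is nonzero is therefore a
neighbourhood of `x` in `hX` that consists of points of `X` near `x`. -/
theorem IsProperCoarse.isOpenEmbedding_toHigson (hE : IsProperCoarse E) :
    IsOpenEmbedding (toHigson E) := by
  have key : ∀ x : X, ∀ U ∈ 𝓝 x, ∃ O ∈ 𝓝 (toHigson E x), O ⊆ toHigson E '' U := by
    intro x U hU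
    obtain ⟨g, B, hB, hBU, hg1, hg0⟩ := hE.exists_higson_bump hU
    refine ⟨{χ | χ g ≠ 0}, (isOpen_ne_fun (continuous_higsonComp_apply g)
      continuous_const).mem_nhds ?_, fun χ hχ => ?_⟩
    · simp [toHigson_apply, hg1]
    · by_cases h : ∃ y, toHigson E y = χ
      · obtain ⟨y, rfl⟩ := h
        refine ⟨y, hBU ?_, rfl⟩
        by_contra hy
        exact hχ (hg0 y hy)
      · exact absurd (hE.corona_apply_eq_zero h hB hg0) hχ
  have hinj : Function.Injective (toHigson E) := by
    intro x y hxy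
    by_contra hne
    obtain ⟨g, B, hB, hBU, hg1, hg0⟩ :=
      hE.exists_higson_bump (isOpen_compl_singleton.mem_nhds (show x ∈ ({y} : Set X)ᶜ from hne))
    have h1 := hg0 y fun h => hBU h rfl
    rw [← toHigson_apply E, ← hxy, toHigson_apply, hg1] at h1
    exact one_ne_zero h1
  refine .of_continuous_injective_isOpenMap (continuous_toHigson E) hinj ?_
  intro U hU
  rw [isOpen_iff_mem_nhds]
  rintro _ ⟨x, hx, rfl⟩
  obtain ⟨O, hO, hOU⟩ := key x U (hU.mem_nhds hx)
  exact mem_of_superset hO hOU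

theorem IsProperCoarse.higsonFilter_toHigson_eq (hE : IsProperCoarse E) (x : X) :
    higsonFilter E (toHigson E x) = 𝓝 x :=
  (hE.isOpenEmbedding_toHigson.isEmbedding.isInducing.nhds_eq_comap x).symm

/-- Limits in `hX` of filters leaving bounded sets are in the corona. -/
theorem IsProperCoarse.mem_corona (hE : IsProperCoarse E) {ι : Type*} {l : Filter ι} [l.NeBot]
    {x : ι → X} {χ : HigsonComp E} (hx : Tendsto (fun i => toHigson E (x i)) l (𝓝 χ))
    (hl : ∀ B, E.IsBdd B → ∀ᶠ i in l, x i ∉ B) : ¬ ∃ y, toHigson E y = χ := by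
  rintro ⟨y, rfl⟩
  obtain ⟨K, hK, hKy⟩ := exists_compact_mem_nhds y
  have h1 : Tendsto x l (𝓝 y) :=
    hE.isOpenEmbedding_toHigson.isEmbedding.tendsto_nhds_iff.2 hx
  obtain ⟨i, hi, hi'⟩ := ((h1.eventually hKy).and (hl K (hE.isBdd_of_isCompact K hK))).exists
  exact hi' hi

theorem IsProperCoarse.isClosed_corona (hE : IsProperCoarse E) :
    IsClosed {χ : HigsonComp E | ¬ ∃ x, toHigson E x = χ} :=
  hE.isOpenEmbedding_toHigson.isOpen_range.isClosed_compl

theorem IsProperCoarse.compactSpace_corona (hE : IsProperCoarse E) :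
    CompactSpace (HigsonCorona E) :=
  isCompact_iff_compactSpace.1 hE.isClosed_corona.isCompact

end Proper

/-! ### The space `X ∪_ζ W` -/

section CoronaUnion

variable {X : Type u} [TopologicalSpace X] {E : CoarseStructure X}
  {W : Type v} {ζ : HigsonCorona E → W}

theorem coronaBar_of_mem {χ : HigsonComp E} (h : ¬ ∃ x, toHigson E x = χ) :
    coronaBar ζ χ = .outer (ζ ⟨χ, h⟩) := dif_neg h

theorem IsProperCoarse.coronaBar_toHigson [T2Space X] [LocallyCompactSpace X]
    (hE : IsProperCoarse E) (x : X) : coronaBar ζ (toHigson E x) = .inner x := by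
  have h : ∃ y, toHigson E y = toHigson E x := ⟨x, rfl⟩
  rw [coronaBar, dif_pos h, hE.isOpenEmbedding_toHigson.injective h.choose_spec]

variable [TopologicalSpace W]

theorem CoronaUnion.continuous_iff {T : Type*} [TopologicalSpace T] {Φ : CoronaUnion ζ → T} :
    Continuous Φ ↔ Continuous (fun χ => Φ (coronaBar ζ χ)) ∧
      Continuous fun z => Φ (CoronaUnion.outer z) := by
  have h := continuous_sup_dom (f := Φ) (t₃ := inferInstance)
    (t₁ := TopologicalSpace.coinduced (coronaBar ζ) inferInstance)
    (t₂ := TopologicalSpace.coinduced CoronaUnion.outer inferInstance)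
  rw [continuous_coinduced_dom, continuous_coinduced_dom] at h
  exact h

theorem continuous_coronaBar : Continuous (coronaBar ζ) :=
  (CoronaUnion.continuous_iff.1 continuous_id).1

theorem CoronaUnion.continuous_outer : Continuous (CoronaUnion.outer : W → CoronaUnion ζ) :=
  (CoronaUnion.continuous_iff.1 continuous_id).2

/-- The map on `X ∪_ζ W` defined by compatible maps on `hX` and `W`. -/
noncomputable def CoronaUnion.glue {T : Type*} (ζ : HigsonCorona E → W) (F : HigsonComp E → T)
    (w : W → T) : CoronaUnion ζ → T
  | .inner x => F (toHigson E x)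
  | .outer z => w z

theorem IsProperCoarse.continuous_glue [T2Space X] [LocallyCompactSpace X]
    (hE : IsProperCoarse E) {T : Type*} [TopologicalSpace T] {F : HigsonComp E → T} {w : W → T}
    (hF : Continuous F) (hw : Continuous w) (h : ∀ χ : HigsonCorona E, F χ.1 = w (ζ χ)) :
    Continuous (CoronaUnion.glue ζ F w) := by
  refine CoronaUnion.continuous_iff.2 ⟨hF.congr fun χ => ?_, hw⟩
  by_cases hχ : ∃ x, toHigson E x = χ
  · obtain ⟨x, rfl⟩ := hχ
    rw [hE.coronaBar_toHigson]
    rfl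
  · rw [coronaBar_of_mem hχ]
    exact h ⟨χ, hχ⟩

variable [T2Space X] [LocallyCompactSpace X]

theorem IsProperCoarse.compactSpace_coronaUnion (hE : IsProperCoarse E) [CompactSpace W] :
    CompactSpace (CoronaUnion ζ) := by
  refine ⟨?_⟩
  have h : (Set.univ : Set (CoronaUnion ζ)) =
      Set.range (coronaBar ζ) ∪ Set.range CoronaUnion.outer := by
    refine (Set.eq_univ_of_forall ?_).symm
    rintro (x | z)
    · exact Or.inl ⟨_, hE.coronaBar_toHigson x⟩
    · exact Or.inr ⟨z, rfl⟩
  rw [h]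
  exact (isCompact_range continuous_coronaBar).union (isCompact_range CoronaUnion.continuous_outer)

/-- The index set is the countable set of pairs of basic open sets. For each pair a function of
compact support that is 1 on the first and 0 off the second is chosen whenever one exists. -/
theorem exists_separating_bumps (X : Type u) [TopologicalSpace X] [T2Space X]
    [LocallyCompactSpace X] [SecondCountableTopology X] :
    ∃ (ι : Type u) (_ : Countable ι) (f : ι → C(X, ℝ)),
      (∀ i, ∃ K, IsCompact K ∧ ∀ x, x ∉ K → f i x = 0) ∧
      ∀ x, ∃ i, f i x = 1 ∧ ∀ y, y ≠ x → ∃ i, f i x = 1 ∧ f i y = 0 := by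
  classical
  let b := TopologicalSpace.countableBasis X
  have hb := TopologicalSpace.isBasis_countableBasis X
  have hbc : Countable b := TopologicalSpace.countable_countableBasis X
  let Q : b × b → C(X, ℝ) → Prop := fun p f =>
    (∃ K, IsCompact K ∧ ∀ x, x ∉ K → f x = 0) ∧ (∀ x ∈ p.1.1, f x = 1) ∧ ∀ x, x ∉ p.2.1 → f x = 0
  let f : b × b → C(X, ℝ) := fun p => if h : ∃ f, Q p f then h.choose else 0
  have key : ∀ x : X, ∀ U ∈ 𝓝 x, ∃ p, f p x = 1 ∧ ∀ y, y ∉ U → f p y = 0 := by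
    intro x U hU
    obtain ⟨V, hV, hxV, hVU⟩ := hb.mem_nhds_iff.1 hU
    obtain ⟨K, L, φ, hK, hL, hKV, hφ1, hφ0, -⟩ := exists_bump (hb.mem_nhds hV hxV)
    obtain ⟨V', hV', hxV', hV'L⟩ := hb.mem_nhds_iff.1 hL
    have hQ : ∃ g, Q (⟨V', hV'⟩, ⟨V, hV⟩) g :=
      ⟨φ, ⟨K, hK, hφ0⟩, fun y hy => hφ1 y (hV'L hy), fun y hy => hφ0 y fun h => hy (hKV h)⟩
    have hf : Q (⟨V', hV'⟩, ⟨V, hV⟩) (f (⟨V', hV'⟩, ⟨V, hV⟩)) := by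
      simp only [f, dif_pos hQ]
      exact hQ.choose_spec
    exact ⟨_, hf.2.1 x hxV', fun y hy => hf.2.2 y fun h => hy (hVU h)⟩
  refine ⟨b × b, inferInstance, f, fun p => ?_, fun x => ?_⟩
  · by_cases h : ∃ g, Q p g
    · simp only [f, dif_pos h]
      exact h.choose_spec.1
    · simp only [f, dif_neg h]
      exact ⟨∅, isCompact_empty, fun x _ => rfl⟩
  · obtain ⟨p, hp, -⟩ := key x _ univ_mem
    refine ⟨p, hp, fun y hy => ?_⟩
    obtain ⟨q, hq, hq'⟩ := key x {y}ᶜ (isOpen_compl_singleton.mem_nhds hy.symm)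
    exact ⟨q, hq, hq' y (by simp)⟩

/-- A compact space with a countable point-separating family of continuous real functions embeds in
a countable product of lines. Here the family has two kinds of members: compactly supported bumps on
`X`, extended by zero to `W`, which separate points of `X` from everything else; and distances to a
countable dense subset of `W`, pulled back to the corona and extended to `hX` by Tietze, which
separate the points of `W`. -/
theorem IsProperCoarse.metrizableSpace_coronaUnion [SecondCountableTopology X]
    (hE : IsProperCoarse E) (hζ : IsCorona ζ) :
    TopologicalSpace.MetrizableSpace (CoronaUnion ζ) := by
  have := hζ.compact
  have := hζ.metrizable
  have := hE.compactSpace_coronaUnion (ζ := ζ)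
  let _ := TopologicalSpace.metrizableSpaceMetric W
  obtain ⟨ι, _, f, hf, hsep⟩ := exists_separating_bumps X
  choose K hK hfK using hf
  choose F hFc hF hF0 using fun i => hE.exists_extension_of_compact_support (f i) (hK i) (hfK i)
  obtain ⟨s, hsc, hsd⟩ := TopologicalSpace.exists_countable_dense W
  have _ := hsc.to_subtype
  have hext : ∀ z : s, ∃ G : C(HigsonComp E, ℝ), ∀ χ : HigsonCorona E, G χ.1 = dist (ζ χ) z.1 := by
    intro z
    have hcl : IsClosedEmbedding (Subtype.val : HigsonCorona E → HigsonComp E) :=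
      hE.isClosed_corona.isClosedEmbedding_subtypeVal
    obtain ⟨G, hG⟩ := ContinuousMap.exists_extension' hcl
      ⟨fun χ : HigsonCorona E => dist (ζ χ) z.1, by have := hζ.continuous; fun_prop⟩
    exact ⟨G, fun χ => congrFun hG χ⟩
  choose G hG using hext
  let Φ : CoronaUnion ζ → ι ⊕ s → ℝ := fun a j => match j with
    | .inl i => CoronaUnion.glue ζ (F i) (fun _ => 0) a
    | .inr z => CoronaUnion.glue ζ (G z) (fun w => dist w z.1) a
  have hΦ : Continuous Φ := by
    refine continuous_pi fun j => ?_
    rcases j with i | z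
    · exact hE.continuous_glue (hFc i) continuous_const (hF0 i)
    · exact hE.continuous_glue (G z).continuous (by fun_prop) (hG z)
  have hΦi : Function.Injective Φ := by
    have h1 : ∀ x i, Φ (.inner x) (.inl i) = f i x := fun x i => hF i x
    have h2 : ∀ w i, Φ (.outer w) (.inl i) = 0 := fun w i => rfl
    rintro (x | w) (x' | w') h
    · by_contra hne
      have hne' : x' ≠ x := fun e => hne (by rw [e])
      obtain ⟨-, -, hs⟩ := hsep x
      obtain ⟨i, hi, hi'⟩ := hs x' hne'
      have := congrFun h (.inl i)
      rw [h1, h1, hi, hi'] at this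
      exact one_ne_zero this
    · obtain ⟨i, hi, -⟩ := hsep x
      have := congrFun h (.inl i)
      rw [h1, h2, hi] at this
      exact absurd this one_ne_zero
    · obtain ⟨i, hi, -⟩ := hsep x'
      have := congrFun h (.inl i)
      rw [h1, h2, hi] at this
      exact absurd this.symm one_ne_zero
    · have h3 : ∀ z : s, dist w z.1 = dist w' z.1 := fun z => congrFun h (.inr z)
      have h4 : (fun z => dist w z) = fun z => dist w' z :=
        Continuous.ext_on hsd (by fun_prop) (by fun_prop) fun z hz => h3 ⟨z, hz⟩
      have h5 := congrFun h4 w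
      rw [dist_self] at h5
      rw [dist_eq_zero.1 h5.symm]
  exact (hΦ.isClosedEmbedding hΦi).isEmbedding.metrizableSpace

theorem IsProperCoarse.isOpenEmbedding_inner (hE : IsProperCoarse E) :
    IsOpenEmbedding (CoronaUnion.inner : X → CoronaUnion ζ) := by
  refine .of_continuous_injective_isOpenMap ?_ (fun x y h => by injection h) fun U hU => ?_
  · exact (continuous_coronaBar.comp (continuous_toHigson E)).congr fun x =>
      hE.coronaBar_toHigson x
  · refine isOpen_sup.2 ⟨isOpen_coinduced.2 ?_, isOpen_coinduced.2 ?_⟩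
    · convert hE.isOpenEmbedding_toHigson.isOpenMap U hU using 1
      ext χ
      by_cases hχ : ∃ x, toHigson E x = χ
      · obtain ⟨x, rfl⟩ := hχ
        rw [Set.mem_preimage, hE.coronaBar_toHigson]
        constructor
        · rintro ⟨y, hy, e⟩
          injection e with e
          exact ⟨y, hy, by rw [e]⟩
        · rintro ⟨y, hy, e⟩
          exact ⟨y, hy, by rw [hE.isOpenEmbedding_toHigson.injective e]⟩
      · rw [Set.mem_preimage, coronaBar_of_mem hχ]
        constructor
        · rintro ⟨y, -, e⟩
          cases e
        · rintro ⟨y, -, e⟩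
          exact absurd ⟨y, e⟩ hχ
    · convert isOpen_empty (X := W)
      ext z
      simp

theorem IsProperCoarse.isCoarseCompactification [SecondCountableTopology X]
    (hE : IsProperCoarse E) (hζ : IsCorona ζ) (hs : Function.Surjective ζ) :
    IsCoarseCompactification ζ where
  compact := by
    have := hζ.compact
    exact hE.compactSpace_coronaUnion
  metrizable := hE.metrizableSpace_coronaUnion hζ
  isOpenEmbedding := hE.isOpenEmbedding_inner
  denseRange := by
    have hsurj : Function.Surjective (coronaBar ζ) := by
      rintro (x | z)
      · exact ⟨_, hE.coronaBar_toHigson x⟩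
      · obtain ⟨χ, rfl⟩ := hs z
        exact ⟨χ.1, coronaBar_of_mem χ.2⟩
    have h := hsurj.denseRange.comp (denseRange_toHigson E) (continuous_coronaBar (ζ := ζ))
    convert h using 2
    funext x
    exact (hE.coronaBar_toHigson x).symm

end CoronaUnion

/-! ### Coarse maps -/

section CoarseMap

variable {X : Type u} {E : CoarseStructure X} {Y : Type v} {E' : CoarseStructure Y}

/-- A (not necessarily continuous) coarse map. -/
structure IsCoarseMap (E : CoarseStructure X) (E' : CoarseStructure Y) (f : X → Y) : Prop where
  controlled : ∀ A ∈ E.controlled, Prod.map f f '' A ∈ E'.controlled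
  proper : ∀ B, E'.IsBdd B → E.IsBdd (f ⁻¹' B)

theorem IsCoarseMap.isHigson {f : X → Y} (hf : IsCoarseMap E E' f) {g : Y → ℂ}
    (hg : IsHigson E' g) : IsHigson E (fun x => g (f x)) := by
  intro A hA ε hε
  obtain ⟨B, hB, h⟩ := hg _ (hf.controlled A hA) ε hε
  exact ⟨_, hf.proper B hB, fun z hz hn => h _ ⟨z, hz, rfl⟩ fun h' => hn ⟨h'.1, h'.2⟩⟩

theorem isCoarseMap_pullback_val {f : X → Y} : IsCoarseMap (E'.pullback f) E' f where
  controlled A hA := hA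
  proper B hB := by
    refine E'.subset_mem _ hB _ ?_
    rintro _ ⟨z, hz, rfl⟩
    exact ⟨hz.1, hz.2⟩

variable [TopologicalSpace X]

theorem IsCoarseMap.eventually_notMem (hE : IsProperCoarse E) {f : X → Y}
    (hf : IsCoarseMap E E' f) {χ : HigsonComp E} (hχ : ¬ ∃ x, toHigson E x = χ) {B : Set Y}
    (hB : E'.IsBdd B) : ∀ᶠ x in higsonFilter E χ, f x ∉ B :=
  hE.compl_mem_higsonFilter hχ (hf.proper B hB)

variable [TopologicalSpace Y]

/-- A coarse map which is locally constant up to a controlled error extends to the corona. -/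
theorem IsCoarseMap.exists_tendsto_of_local [NormalSpace X] [ParacompactSpace X]
    (hE : IsProperCoarse E) {f : X → Y} (hf : IsCoarseMap E E' f) {A : Set (Y × Y)}
    (hA : A ∈ E'.controlled) (hloc : ∀ x, ∀ᶠ y in 𝓝 x, (f y, f x) ∈ A) {χ : HigsonComp E}
    (hχ : ¬ ∃ x, toHigson E x = χ) :
    ∃ θ, Tendsto (fun x => toHigson E' (f x)) (higsonFilter E χ) (𝓝 θ) := by
  refine exists_tendsto_of_separating (D := Set.range fun g : higsonAlgebra E' => fun θ => θ g)
    ?_ ?_ ?_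
  · rintro _ ⟨g, rfl⟩
    exact continuous_higsonComp_apply g
  · intro a b h
    exact higsonComp_ext fun g => h _ ⟨g, rfl⟩
  rintro _ ⟨g, rfl⟩
  -- As `f` need not be continuous, `g ∘ f` is not available in the Higson algebra. It is replaced
  -- by a continuous selection `ψ` from the convex hulls of the values of `g` at points `A`-close to
  -- `f x`; the difference `ψ - g ∘ f` vanishes at infinity.
  let t : X → Set ℂ := fun x => convexHull ℝ {c | ∃ y, (f x, y) ∈ A ∧ c = g.1 y}
  obtain ⟨ψ, hψ⟩ := exists_continuous_forall_mem_convex_of_local_const (t := t)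
    (fun x => convex_convexHull ℝ _)
    (fun x => ⟨g.1 (f x), (hloc x).mono fun y hy => subset_convexHull ℝ _ ⟨_, hy, rfl⟩⟩)
  have hψb : ∀ x, ‖ψ x‖ ≤ ‖g.1‖ := fun x => by
    have h : t x ⊆ Metric.closedBall 0 ‖g.1‖ := by
      refine convexHull_min ?_ (convex_closedBall _ _)
      rintro _ ⟨y, -, rfl⟩
      rw [mem_closedBall_zero_iff]
      exact g.1.norm_coe_le_norm y
    simpa using h (hψ x)
  -- Since `g` has vanishing variation along `A`, outside a bounded set the convex set `t x` is
  -- contained in a small ball around `g (f x)`.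
  have hclose : ∀ ε : ℝ, 0 < ε → ∃ B, E'.IsBdd B ∧ ∀ x, f x ∉ B → ‖ψ x - g.1 (f x)‖ < ε := by
    intro ε hε
    obtain ⟨B, hB, h⟩ := g.2 A hA ε hε
    refine ⟨B, hB, fun x hx => ?_⟩
    have h' : t x ⊆ Metric.ball (g.1 (f x)) ε := by
      refine convexHull_min ?_ (convex_ball _ _)
      rintro _ ⟨y, hy, rfl⟩
      rw [mem_ball_iff_norm]
      exact h _ hy fun hh => hx hh.1
    exact mem_ball_iff_norm.1 (h' (hψ x))
  have hψH : IsHigson E ψ := by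
    intro A' hA' ε hε
    obtain ⟨B, hB, h1⟩ := hclose (ε / 3) (by positivity)
    obtain ⟨B', hB', h2⟩ := hf.isHigson g.2 A' hA' (ε / 3) (by positivity)
    have hB1 := hf.proper B hB
    refine ⟨_, hB'.union (hB1.union ((hB1.thicken hA').union
      (hB1.thicken (E.inverse_mem _ hA')))), fun z hz hn => ?_⟩
    have a1 : f z.1 ∉ B := fun h =>
      hn ⟨Or.inr (Or.inl h), Or.inr (Or.inr (Or.inl ⟨_, h, hz⟩))⟩
    have a2 : f z.2 ∉ B := fun h =>
      hn ⟨Or.inr (Or.inr (Or.inr ⟨_, h, hz⟩)), Or.inr (Or.inl h)⟩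
    have a3 := h2 z hz fun hh => hn ⟨Or.inl hh.1, Or.inl hh.2⟩
    have a4 := h1 _ a1
    have a5 := h1 _ a2
    have e : ψ z.2 - ψ z.1 = (ψ z.2 - g.1 (f z.2)) + (g.1 (f z.2) - g.1 (f z.1)) -
      (ψ z.1 - g.1 (f z.1)) := by ring
    rw [e]
    refine (norm_sub_le _ _).trans_lt ?_
    have a6 := norm_add_le (ψ z.2 - g.1 (f z.2)) (g.1 (f z.2) - g.1 (f z.1))
    linarith
  have h1 := tendsto_of_isHigson ψ.continuous hψb hψH χ
  have h2 : Tendsto (fun x => ψ x - g.1 (f x)) (higsonFilter E χ) (𝓝 0) := by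
    rw [Metric.tendsto_nhds]
    intro ε hε
    obtain ⟨B, hB, h⟩ := hclose ε hε
    filter_upwards [hf.eventually_notMem hE hχ hB] with x hx
    rw [dist_zero_right]
    exact h x hx
  exact ⟨_, (h1.sub h2).congr fun x => sub_sub_cancel (ψ x) (g.1 (f x))⟩

variable [Nonempty Y]

/-- Pulling back a Higson function along a continuous coarse map. -/
theorem IsCoarseMap.isHigsonExtension {f : X → Y} (hf : IsCoarseMap E E' f) (hc : Continuous f) :
    IsHigsonExtension E (fun x => toHigson E' (f x)) (higsonMap E E' f) := by
  refine isHigsonExtension_higsonExt ((continuous_toHigson E').comp hc) fun χ => ?_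
  refine exists_tendsto_of_separating (D := Set.range fun g : higsonAlgebra E' => fun θ => θ g)
    ?_ ?_ ?_
  · rintro _ ⟨g, rfl⟩
    exact continuous_higsonComp_apply g
  · intro a b h
    exact higsonComp_ext fun g => h _ ⟨g, rfl⟩
  · rintro _ ⟨g, rfl⟩
    exact ⟨_, tendsto_of_isHigson (f := fun x => g.1 (f x)) (g.1.continuous.comp hc)
      (C := ‖g.1‖) (fun x => g.1.norm_coe_le_norm _) (hf.isHigson g.2) χ⟩

theorem IsCoarseMap.higsonMap_mem_corona [T2Space Y] [LocallyCompactSpace Y]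
    (hE : IsProperCoarse E) (hE' : IsProperCoarse E') {f : X → Y}
    (hf : IsCoarseMap E E' f) (hc : Continuous f) {χ : HigsonComp E}
    (hχ : ¬ ∃ x, toHigson E x = χ) : ¬ ∃ y, toHigson E' y = higsonMap E E' f χ :=
  hE'.mem_corona
    ((hf.isHigsonExtension hc).tendsto (tendsto_toHigson_higsonFilter E χ))
    fun _ hB => hf.eventually_notMem hE hχ hB

end CoarseMap

end BlownUp

namespace BlownUp
universe u v w

namespace PeripheralGroup

variable {G : Type u} [Group G] {k : ℕ} [NeZero k] (D : PeripheralGroup G k)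

/-! ## Metric properties of the augmented space -/

theorem dist_tri (x y z : D.Vertex) : D.graph.dist x z ≤ D.graph.dist x y + D.graph.dist y z :=
  D.graph_connected.dist_triangle

theorem rdist_tri (x y z : D.Vertex) :
    (D.graph.dist x z : ℝ) ≤ D.graph.dist x y + D.graph.dist y z := by
  exact_mod_cast D.dist_tri x y z

theorem rdist_comm (x y : D.Vertex) : (D.graph.dist x y : ℝ) = D.graph.dist y x := by
  rw [SimpleGraph.dist_comm]

theorem rdist_nonneg (x y : D.Vertex) : (0 : ℝ) ≤ D.graph.dist x y := Nat.cast_nonneg _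

theorem cayley_tri (x y z : G) : D.cayley.dist x z ≤ D.cayley.dist x y + D.cayley.dist y z :=
  D.cayley_connected.dist_triangle

theorem cayley_adj_mul_left (a x y : G) (h : D.cayley.Adj x y) : D.cayley.Adj (a * x) (a * y) := by
  rw [cayley, SimpleGraph.mulCayley_adj'] at h ⊢
  obtain ⟨hne, s, hs, h⟩ := h
  refine ⟨fun e => hne (mul_left_cancel e), s, hs, ?_⟩
  rcases h with h | h
  · exact Or.inl (by rw [mul_assoc, h])
  · exact Or.inr (by rw [mul_assoc, h])

theorem cayley_dist_mul_left_le (a x y : G) :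
    D.cayley.dist (a * x) (a * y) ≤ D.cayley.dist x y := by
  obtain ⟨p, hp⟩ := D.cayley_connected.exists_walk_length_eq_dist x y
  rw [← hp]
  clear hp
  induction p with
  | nil => simp
  | cons h p ih =>
    rw [SimpleGraph.Walk.length_cons]
    have h1 := SimpleGraph.dist_eq_one_iff_adj.2 (D.cayley_adj_mul_left a _ _ h)
    refine (D.cayley_tri _ _ _).trans (add_le_add h1.le ih |>.trans ?_)
    omega

theorem cayley_dist_mul_left (a x y : G) :
    D.cayley.dist (a * x) (a * y) = D.cayley.dist x y := by
  refine le_antisymm (D.cayley_dist_mul_left_le a x y) ?_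
  simpa using D.cayley_dist_mul_left_le a⁻¹ (a * x) (a * y)

theorem finite_cayley_ball (x : G) (n : ℕ) : {y | D.cayley.dist x y ≤ n}.Finite := by
  induction n with
  | zero =>
    refine (Set.finite_singleton x).subset fun y hy => ?_
    have h : D.cayley.dist x y = 0 := Nat.le_zero.1 hy
    exact ((D.cayley_connected.dist_eq_zero_iff).1 h).symm
  | succ n ih =>
    refine (ih.union (ih.image2 (fun y s => y * s) D.S_finite)).subset fun y hy => ?_
    have hy' : D.cayley.dist x y ≤ n + 1 := hy
    obtain ⟨p, hp⟩ := D.cayley_connected.exists_walk_length_eq_dist y x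
    cases p with
    | nil => exact Or.inl (by simp)
    | @cons _ z _ h q =>
      rw [SimpleGraph.Walk.length_cons, SimpleGraph.dist_comm] at hp
      have hq := SimpleGraph.dist_le q
      have hz : D.cayley.dist x z ≤ n := by rw [SimpleGraph.dist_comm]; omega
      obtain ⟨-, s, hs, h⟩ := (SimpleGraph.mulCayley_adj' _ _ _).1 h
      refine Or.inr ?_
      rcases h with h | h
      · exact ⟨z, hz, s⁻¹, D.S_symm s hs, by simp [← h]⟩
      · exact ⟨z, hz, s, hs, h.symm⟩

/-- The element of `G` below a vertex. -/
def base : D.Vertex → G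
  | .group x => x
  | .horo _ p _ => p

/-- The height of a vertex. -/
def height : D.Vertex → ℕ
  | .group _ => 0
  | .horo _ _ l => l + 1

theorem depth_le_height (i : ℕ) (a : D.Vertex) : D.depth i a ≤ D.height a := by
  cases a
  · exact le_rfl
  · simp only [depth, height]
    split_ifs <;> omega

theorem height_le_of_edge {a b : D.Vertex} (h : D.Edge a b) :
    D.height a ≤ D.height b + 1 ∧ D.height b ≤ D.height a + 1 := by
  cases h <;> simp only [height] <;> constructor <;> omega

theorem cayley_dist_base_of_edge {a b : D.Vertex} (h : D.Edge a b) :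
    D.cayley.dist (D.base a) (D.base b) ≤ 2 ^ D.height a ∧
      D.cayley.dist (D.base a) (D.base b) ≤ 2 ^ D.height b := by
  cases h with
  | cayley x y h =>
    have := SimpleGraph.dist_eq_one_iff_adj.2 h
    simp [base, height, this]
  | bottom i p => simp [base]
  | vertical i p l => simp [base]
  | horizontal i p q l hpq h => exact ⟨h, h⟩

/-- A walk that ends at height 0 starts no higher than its length, and an edge with an end at height
`h` moves the base point by at most `2 ^ h`. So each further edge at most doubles the bound; the
summand 1 makes the induction close. -/
theorem walk_bounds {v w : D.Vertex} (p : D.graph.Walk v w) (hw : D.height w = 0) :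
    D.height v ≤ p.length ∧ D.cayley.dist (D.base v) (D.base w) + 1 ≤ 2 ^ p.length := by
  induction p with
  | nil => simp [hw]
  | @cons a b c h p ih =>
    obtain ⟨h1, h2⟩ := ih hw
    rw [SimpleGraph.Walk.length_cons]
    have h3 : D.height a ≤ D.height b + 1 ∧ D.cayley.dist (D.base a) (D.base b) ≤ 2 ^ D.height b := by
      rcases ((SimpleGraph.fromRel_adj _ _ _).1 h).2 with h | h
      · exact ⟨(D.height_le_of_edge h).1, (D.cayley_dist_base_of_edge h).2⟩
      · refine ⟨(D.height_le_of_edge h).2, ?_⟩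
        rw [SimpleGraph.dist_comm]
        exact (D.cayley_dist_base_of_edge h).1
    have h4 : 2 ^ D.height b ≤ 2 ^ p.length := Nat.pow_le_pow_right (by norm_num) h1
    have h5 := D.cayley_tri (D.base a) (D.base b) (D.base c)
    refine ⟨by omega, ?_⟩
    rw [pow_succ]
    omega

theorem cayley_dist_base_le (x : G) (v : D.Vertex) :
    D.cayley.dist (D.base v) x ≤ 2 ^ D.graph.dist v (.group x) := by
  obtain ⟨p, hp⟩ := D.graph_connected.exists_walk_length_eq_dist v (.group x)
  rw [← hp]
  exact (Nat.le_succ _).trans (D.walk_bounds p rfl).2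

/-- The inclusion of `G` is a coarse embedding with exponential distortion. Bounds found in the
augmented space are turned into bounds for the word metric by this estimate. -/
theorem cayley_dist_le (x y : G) :
    D.cayley.dist x y ≤ 2 ^ D.graph.dist (.group x) (.group y) :=
  D.cayley_dist_base_le y (.group x)

theorem height_le_dist (x : G) (v : D.Vertex) : D.height v ≤ D.graph.dist v (.group x) := by
  obtain ⟨p, hp⟩ := D.graph_connected.exists_walk_length_eq_dist v (.group x)
  rw [← hp]
  exact (D.walk_bounds p rfl).1

theorem graph_dist_group_le (x y : G) :
    D.graph.dist (.group x) (.group y) ≤ D.cayley.dist x y := by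
  obtain ⟨p, hp⟩ := D.cayley_connected.exists_walk_length_eq_dist x y
  rw [← hp]
  clear hp
  induction p with
  | nil => simp
  | cons h p ih =>
    rw [SimpleGraph.Walk.length_cons]
    have h1 := SimpleGraph.dist_eq_one_iff_adj.2 (D.adj_of_edge (.cayley _ _ h))
    have := D.dist_tri (.group _) (.group _) (.group _) |>.trans (add_le_add h1.le ih)
    omega

theorem index_eq {i : ℕ} : i / k * k + (residue k i : ℕ) = i := by
  show i / k * k + i % k = i
  rw [mul_comm]
  exact Nat.div_add_mod i k

theorem mem_coset_iff (i : ℕ) (x : G) :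
    x ∈ D.coset i ↔ (QuotientGroup.mk (D.g i) : G ⧸ D.P (residue k i)) = QuotientGroup.mk x :=
  QuotientGroup.eq.symm

theorem index_unique {i j : ℕ} {x : G} (hi : x ∈ D.coset i) (hj : x ∈ D.coset j)
    (hr : residue k i = residue k j) : i = j := by
  rw [mem_coset_iff] at hi hj
  rw [← index_eq (k := k) (i := i)] at hi ⊢
  rw [← index_eq (k := k) (i := j)] at hj ⊢
  have e : ∀ (a : ℕ) (r : Fin k), residue k (a * k + r) = r := fun a r => by
    apply Fin.ext
    show (a * k + r) % k = r
    rw [add_comm, Nat.add_mul_mod_self_right, Nat.mod_eq_of_lt r.2]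
  rw [← hr] at hj ⊢
  have h1 := (D.g_bijective (residue k i)).1
  generalize residue k i = r at *
  have e1 := e (i / k) r
  have e2 := e (j / k) r
  rw [e1] at hi
  rw [e2] at hj
  have := h1 (hi.trans hj.symm)
  rw [this]

theorem exists_index (r : Fin k) (x : G) : ∃ i, residue k i = r ∧ x ∈ D.coset i := by
  obtain ⟨a, ha⟩ := (D.g_bijective r).2 (QuotientGroup.mk x)
  have e : residue k (a * k + r) = r := by
    apply Fin.ext
    show (a * k + r) % k = r
    rw [add_comm, Nat.add_mul_mod_self_right, Nat.mod_eq_of_lt r.2]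
  refine ⟨a * k + r, e, ?_⟩
  rw [mem_coset_iff, e]
  exact ha

/-- An element lies in exactly one coset of each subgroup, hence in at most one coset for each
residue. -/
theorem finite_index (x : G) : {i | x ∈ D.coset i}.Finite :=
  Set.Finite.of_injOn (f := residue k) (t := Set.univ) (fun _ _ => Set.mem_univ _)
    (fun _ hi _ hj h => D.index_unique hi hj h) Set.finite_univ

/-- The base points of such vertices lie in a Cayley ball, which is finite, their heights are
bounded, and only finitely many horoballs stand over a given group element. -/
theorem finite_ball_group (x : G) (n : ℕ) : {v | D.graph.dist v (.group x) ≤ n}.Finite := by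
  have hfin : ∀ (y : G) (l : ℕ),
      {v : D.Vertex | ∃ i, ∃ h : y ∈ D.coset i, v = .horo i ⟨y, h⟩ l}.Finite := fun y l => by
    have := (D.finite_index y).to_subtype
    refine (Set.finite_range fun i : {i | y ∈ D.coset i} =>
      (Vertex.horo i.1 ⟨y, i.2⟩ l : D.Vertex)).subset ?_
    rintro _ ⟨i, h, rfl⟩
    exact ⟨⟨i, h⟩, rfl⟩
  refine ((D.finite_cayley_ball x (2 ^ n)).biUnion fun y _ =>
    (Set.finite_singleton (Vertex.group y)).union
      ((Set.finite_lt_nat n).biUnion fun l _ => hfin y l)).subset fun v hv => ?_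
  have hv' : D.graph.dist v (.group x) ≤ n := hv
  have h1 : D.cayley.dist x (D.base v) ≤ 2 ^ n := by
    rw [SimpleGraph.dist_comm]
    exact (D.cayley_dist_base_le x v).trans (Nat.pow_le_pow_right (by norm_num) hv')
  have h2 := (D.height_le_dist x v).trans hv'
  refine Set.mem_biUnion h1 ?_
  cases v with
  | group y => exact Or.inl rfl
  | horo i p l =>
    refine Or.inr (Set.mem_biUnion (x := l) ?_ ⟨i, p.2, rfl⟩)
    exact h2

theorem finite_ball (a : D.Vertex) (n : ℕ) : {v | D.graph.dist a v ≤ n}.Finite := by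
  refine (D.finite_ball_group 1 (n + D.graph.dist a (.group 1))).subset fun v hv => ?_
  have hv' : D.graph.dist a v ≤ n := hv
  have h1 := D.dist_tri v a (.group 1)
  rw [SimpleGraph.dist_comm] at hv'
  show D.graph.dist v (.group 1) ≤ _
  omega

/-! ### Geodesics -/

theorem exists_geodesic (x y : D.Vertex) : ∃ c : ℕ → D.Vertex, c 0 = x ∧
    c (D.graph.dist x y) = y ∧
    ∀ s t, s ≤ t → t ≤ D.graph.dist x y → D.graph.dist (c s) (c t) = t - s := by
  obtain ⟨p, hp⟩ := D.graph_connected.exists_walk_length_eq_dist x y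
  have hle : ∀ s t, s ≤ t → t ≤ p.length → D.graph.dist (p.getVert s) (p.getVert t) ≤ t - s := by
    intro s t hst
    induction t, hst using Nat.le_induction with
    | base => simp
    | succ t hst ih =>
      intro ht
      have h1 := ih (by omega)
      have h2 := SimpleGraph.dist_eq_one_iff_adj.2 (p.adj_getVert_succ (i := t) (by omega))
      have h3 := D.dist_tri (p.getVert s) (p.getVert t) (p.getVert (t + 1))
      omega
  have h0 : p.getVert 0 = x := p.getVert_zero
  have h1 : p.getVert p.length = y := p.getVert_length
  refine ⟨p.getVert, h0, by rw [← hp]; exact h1, fun s t hst ht => ?_⟩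
  rw [← hp] at ht
  refine le_antisymm (hle s t hst ht) ?_
  have a1 := hle 0 s (Nat.zero_le _) (by omega)
  have a2 := hle t p.length ht le_rfl
  have a3 := D.dist_tri (p.getVert 0) (p.getVert s) (p.getVert p.length)
  have a4 := D.dist_tri (p.getVert s) (p.getVert t) (p.getVert p.length)
  have a5 : D.graph.dist (p.getVert 0) (p.getVert p.length) = p.length := by
    rw [h0, h1, hp]
  omega

theorem exists_between (x y : D.Vertex) {t : ℕ} (ht : t ≤ D.graph.dist x y) :
    ∃ c, D.graph.dist x c = t ∧ t + D.graph.dist c y = D.graph.dist x y := by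
  obtain ⟨c, h0, h1, h⟩ := D.exists_geodesic x y
  refine ⟨c t, ?_, ?_⟩
  · rw [← h0, h 0 t (Nat.zero_le _) ht, Nat.sub_zero]
  · have := h t _ ht le_rfl
    rw [h1] at this
    omega

/-- Limits of geodesics along an ultrafilter. -/
theorem exists_limit_ray {ι : Type*} (U : Ultrafilter ι) (e : D.Vertex) (c : ι → ℕ → D.Vertex)
    (h0 : ∀ i, c i 0 = e)
    (hc : ∀ n, ∀ᶠ i in (U : Filter ι), ∀ s t, s ≤ t → t ≤ n →
      D.graph.dist (c i s) (c i t) = t - s) :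
    ∃ l : D.Ray, l.toFun 0 = e ∧ ∀ t, ∀ᶠ i in (U : Filter ι), c i t = l.toFun t := by
  have h1 : ∀ t, ∃ v, ∀ᶠ i in (U : Filter ι), c i t = v := by
    intro t
    have h2 : ∀ᶠ i in (U : Filter ι), ∃ v ∈ {v | D.graph.dist e v ≤ t}, c i t = v := by
      filter_upwards [hc t] with i hi
      have := hi 0 t (Nat.zero_le _) le_rfl
      rw [h0] at this
      exact ⟨_, by show _ ≤ _; omega, rfl⟩
    -- At each time the geodesics take values in a finite ball, so the ultrafilter selects one
    -- vertex.
    obtain ⟨v, -, hv⟩ := (Ultrafilter.eventually_exists_mem_iff (D.finite_ball e t)).1 h2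
    exact ⟨v, hv⟩
  choose l hl using h1
  refine ⟨⟨l, fun m n hmn => ?_⟩, ?_, hl⟩
  · obtain ⟨i, h1, h2, h3⟩ := ((hl m).and ((hl n).and (hc n))).exists
    rw [← h1, ← h2]
    exact h3 m n hmn le_rfl
  · obtain ⟨i, hi⟩ := (hl 0).exists
    show l 0 = e
    rw [← hi, h0]

end PeripheralGroup
end BlownUp

namespace BlownUp
universe u v w

namespace PeripheralGroup

variable {G : Type u} [Group G] {k : ℕ} [NeZero k] (D : PeripheralGroup G k)

/-! ## Gromov products -/

/-- The four point condition. -/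
structure FourPoint (δ : ℝ) : Prop where
  nonneg : 0 ≤ δ
  min_le : ∀ p x y z : D.Vertex,
    min (D.gromovProduct p x y) (D.gromovProduct p y z) - δ ≤ D.gromovProduct p x z

variable {D}

theorem IsRelativelyHyperbolic.exists_fourPoint (h : D.IsRelativelyHyperbolic) :
    ∃ δ, D.FourPoint δ := by
  obtain ⟨δ, hδ⟩ := h
  refine ⟨δ, ?_, hδ⟩
  have := hδ (.group 1) (.group 1) (.group 1) (.group 1)
  rw [min_self] at this
  linarith

theorem FourPoint.le {δ R : ℝ} (h : D.FourPoint δ) {p x y z : D.Vertex}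
    (h1 : R ≤ D.gromovProduct p x y) (h2 : R ≤ D.gromovProduct p y z) :
    R - δ ≤ D.gromovProduct p x z := by
  have := h.min_le p x y z
  have := le_min h1 h2
  linarith

/-- The four point condition in terms of distances. -/
theorem FourPoint.dist_add_le {δ : ℝ} (h : D.FourPoint δ) (x y z w : D.Vertex) :
    (D.graph.dist x y : ℝ) + D.graph.dist z w ≤
      max ((D.graph.dist x z : ℝ) + D.graph.dist y w) (D.graph.dist x w + D.graph.dist y z)
        + 2 * δ := by
  have := h.min_le w x z y
  simp only [gromovProduct] at this
  rw [D.rdist_comm z y] at this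
  rcases min_cases (((D.graph.dist x w : ℝ) + D.graph.dist z w - D.graph.dist x z) / 2)
    (((D.graph.dist z w : ℝ) + D.graph.dist y w - D.graph.dist y z) / 2) with ⟨h1, -⟩ | ⟨h1, -⟩
  · rw [h1] at this
    have := le_max_left ((D.graph.dist x z : ℝ) + D.graph.dist y w)
      (D.graph.dist x w + D.graph.dist y z)
    linarith
  · rw [h1] at this
    have := le_max_right ((D.graph.dist x z : ℝ) + D.graph.dist y w)
      (D.graph.dist x w + D.graph.dist y z)
    linarith

variable (D)

theorem gp_comm (p x y : D.Vertex) : D.gromovProduct p x y = D.gromovProduct p y x := by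
  simp only [gromovProduct]
  rw [D.rdist_comm x y]
  ring

theorem gp_self (p x : D.Vertex) : D.gromovProduct p x x = D.graph.dist x p := by
  simp [gromovProduct]

theorem gp_nonneg (p x y : D.Vertex) : 0 ≤ D.gromovProduct p x y := by
  have := D.rdist_tri x p y
  rw [D.rdist_comm p y] at this
  simp only [gromovProduct]
  linarith

theorem gp_le (p x y : D.Vertex) : D.gromovProduct p x y ≤ D.graph.dist x p := by
  have := D.rdist_tri y x p
  rw [D.rdist_comm y x] at this
  simp only [gromovProduct]
  linarith

theorem gp_base (p q x y : D.Vertex) :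
    D.gromovProduct p x y ≤ D.gromovProduct q x y + D.graph.dist p q := by
  have h1 := D.rdist_tri x q p
  have h2 := D.rdist_tri y q p
  rw [D.rdist_comm q p] at h1 h2
  simp only [gromovProduct]
  linarith

theorem gp_move (p x y y' : D.Vertex) :
    D.gromovProduct p x y ≤ D.gromovProduct p x y' + D.graph.dist y y' := by
  have h1 := D.rdist_tri y y' p
  have h2 := D.rdist_tri x y y'
  simp only [gromovProduct]
  linarith

theorem gp_of_between {p x y : D.Vertex}
    (h : D.graph.dist p x + D.graph.dist x y = D.graph.dist p y) :
    D.gromovProduct p x y = D.graph.dist p x := by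
  have : (D.graph.dist p x : ℝ) + D.graph.dist x y = D.graph.dist p y := by exact_mod_cast h
  simp only [gromovProduct]
  rw [D.rdist_comm x p, D.rdist_comm y p]
  linarith

namespace Ray

variable {D}

theorem dist_eq (l : D.Ray) {m n : ℕ} (h : m ≤ n) :
    (D.graph.dist (l.toFun m) (l.toFun n) : ℝ) = n - m := by
  rw [l.isGeodesic m n h, Nat.cast_sub h]

theorem dist_zero (l : D.Ray) (n : ℕ) : D.graph.dist (l.toFun 0) (l.toFun n) = n := by
  rw [l.isGeodesic 0 n (Nat.zero_le _), Nat.sub_zero]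

theorem gp_zero (l : D.Ray) {m n : ℕ} (h : m ≤ n) :
    D.gromovProduct (l.toFun 0) (l.toFun m) (l.toFun n) = m := by
  rw [D.gp_of_between, l.dist_zero]
  rw [l.dist_zero, l.dist_zero, l.isGeodesic m n h]
  omega

theorem le_gp (l : D.Ray) (p : D.Vertex) {R : ℝ} {m n : ℕ}
    (hm : R + D.graph.dist (l.toFun 0) p ≤ m) (hn : R + D.graph.dist (l.toFun 0) p ≤ n) :
    R ≤ D.gromovProduct p (l.toFun m) (l.toFun n) := by
  rcases le_total m n with h | h
  · have := D.gp_base (l.toFun 0) p (l.toFun m) (l.toFun n)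
    rw [l.gp_zero h] at this
    linarith
  · have := D.gp_base (l.toFun 0) p (l.toFun n) (l.toFun m)
    rw [l.gp_zero h, D.gp_comm p] at this
    linarith

end Ray

/-! ### Eventual lower bounds of Gromov products -/

/-- `R ≤ (x m | y n)` for all large `m` and `n`. -/
def EvGe (R : ℝ) (x y : ℕ → D.Vertex) : Prop :=
  ∃ N, ∀ m ≥ N, ∀ n ≥ N, R ≤ D.gromovProduct (.group 1) (x m) (y n)

/-- `R ≤ (x m | y n)` for arbitrarily large `m` and `n`. -/
def FrGe (R : ℝ) (x y : ℕ → D.Vertex) : Prop :=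
  ∀ N, ∃ m ≥ N, ∃ n ≥ N, R ≤ D.gromovProduct (.group 1) (x m) (y n)

variable {D}

theorem evGe_iff {R : ℝ} {x y : ℕ → D.Vertex} : D.EvGe R x y ↔
    ∀ᶠ t : ℕ × ℕ in atTop, R ≤ D.gromovProduct (.group 1) (x t.1) (y t.2) := by
  rw [eventually_atTop]
  constructor
  · rintro ⟨N, h⟩
    exact ⟨(N, N), fun t ht => h _ ht.1 _ ht.2⟩
  · rintro ⟨⟨M, N⟩, h⟩
    exact ⟨max M N, fun m hm n hn => h (m, n)
      ⟨(le_max_left M N).trans hm, (le_max_right M N).trans hn⟩⟩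

theorem tendsto_gp_iff {x y : ℕ → D.Vertex} :
    Tendsto (fun t : ℕ × ℕ => D.gromovProduct (.group 1) (x t.1) (y t.2)) atTop atTop ↔
      ∀ R, D.EvGe R x y := by
  rw [tendsto_atTop]
  exact forall_congr' fun R => evGe_iff.symm

theorem EvGe.symm {R : ℝ} {x y : ℕ → D.Vertex} (h : D.EvGe R x y) : D.EvGe R y x := by
  obtain ⟨N, h⟩ := h
  exact ⟨N, fun m hm n hn => by rw [D.gp_comm]; exact h n hn m hm⟩

theorem EvGe.mono {R R' : ℝ} {x y : ℕ → D.Vertex} (h : D.EvGe R x y) (hR : R' ≤ R) :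
    D.EvGe R' x y := by
  obtain ⟨N, h⟩ := h
  exact ⟨N, fun m hm n hn => hR.trans (h m hm n hn)⟩

theorem EvGe.frGe {R : ℝ} {x y : ℕ → D.Vertex} (h : D.EvGe R x y) : D.FrGe R x y := by
  obtain ⟨N, h⟩ := h
  intro M
  exact ⟨max M N, le_max_left _ _, max M N, le_max_left _ _,
    h _ (le_max_right _ _) _ (le_max_right _ _)⟩

theorem EvGe.trans {δ R : ℝ} (hδ : D.FourPoint δ) {x y z : ℕ → D.Vertex} (h : D.EvGe R x y)
    (h' : D.EvGe R y z) : D.EvGe (R - δ) x z := by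
  obtain ⟨N, h⟩ := h
  obtain ⟨N', h'⟩ := h'
  refine ⟨max N N', fun m hm n hn => hδ.le (y := y (max N N')) ?_ ?_⟩
  · exact h _ ((le_max_left _ _).trans hm) _ (le_max_left _ _)
  · exact h' _ (le_max_right _ _) _ ((le_max_right _ _).trans hn)

theorem Ray.evGe (l : D.Ray) (R : ℝ) : D.EvGe R l.toFun l.toFun := by
  obtain ⟨N, hN⟩ := exists_nat_ge (R + D.graph.dist (l.toFun 0) (.group 1))
  exact ⟨N, fun m hm n hn => l.le_gp _ (hN.trans (by exact_mod_cast hm))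
    (hN.trans (by exact_mod_cast hn))⟩

/-- Asymptotic rays have divergent Gromov products. -/
theorem Ray.evGe_of_equiv {δ : ℝ} (hδ : D.FourPoint δ) {l l' : D.Ray} (h : l ≈ l') (R : ℝ) :
    D.EvGe R l.toFun l'.toFun := by
  obtain ⟨C, h1, -⟩ := h
  obtain ⟨N, hN⟩ := l.evGe (R + 2 * δ + C)
  obtain ⟨N', hN'⟩ := l'.evGe (R + 2 * δ)
  refine ⟨max N N', fun m hm n hn => ?_⟩
  -- So far out on `l` that the companion time `n'` on `l'` is at least `max N N'`, by the triangle
  -- inequality.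
  let M := max N N' + C + D.graph.dist (l.toFun 0) (l'.toFun 0)
  obtain ⟨n', hn'⟩ := h1 M
  have hn'N : max N N' ≤ n' := by
    have a1 := D.dist_tri (l.toFun 0) (l'.toFun n') (l.toFun M)
    have a2 := D.dist_tri (l.toFun 0) (l'.toFun 0) (l'.toFun n')
    rw [l'.dist_zero] at a2
    rw [l.dist_zero, SimpleGraph.dist_comm (u := l'.toFun n')] at a1
    simp only [M] at *
    omega
  have hMN : N ≤ M := (le_max_left N N').trans (by simp only [M]; omega)
  have b1 : R + 2 * δ ≤ D.gromovProduct (.group 1) (l.toFun m) (l'.toFun n') := by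
    have := hN m ((le_max_left _ _).trans hm) M hMN
    have h3 := D.gp_move (.group 1) (l.toFun m) (l.toFun M) (l'.toFun n')
    have h4 : (D.graph.dist (l.toFun M) (l'.toFun n') : ℝ) ≤ C := by exact_mod_cast hn'
    linarith
  have b2 := hN' n' ((le_max_right _ _).trans hn'N) n ((le_max_right _ _).trans hn)
  have := hδ.le b1 b2
  have := hδ.nonneg
  linarith

/-! ### Thin triangles and asymptotic rays. -/

theorem HasThinTriangles.dist_ray_le {δ₀ : ℝ} (hthin : D.HasThinTriangles δ₀) {l l' : D.Ray}
    (h0 : l.toFun 0 = l'.toFun 0) {t m n : ℕ}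
    (h : (t : ℝ) ≤ D.gromovProduct (l.toFun 0) (l.toFun m) (l'.toFun n)) :
    (D.graph.dist (l.toFun t) (l'.toFun t) : ℝ) ≤ δ₀ := by
  have hm : t ≤ m := by
    have := h.trans (D.gp_le _ _ _)
    rw [D.rdist_comm, l.dist_zero] at this
    exact_mod_cast this
  have hn : t ≤ n := by
    rw [D.gp_comm] at h
    have := h.trans (D.gp_le _ _ _)
    rw [h0, D.rdist_comm, l'.dist_zero] at this
    exact_mod_cast this
  refine hthin (l.toFun 0) (l.toFun m) (l'.toFun n) _ _ ?_ ?_ ?_ ?_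
  · rw [l.dist_zero, l.dist_zero, l.isGeodesic t m hm]
    omega
  · rw [h0, l'.dist_zero, l'.dist_zero, l'.isGeodesic t n hn]
    omega
  · rw [l.dist_zero, h0, l'.dist_zero]
  · rw [l.dist_zero]
    exact h

/-- The origins may differ, by a distance `A`, so two thin triangles are needed. The first, at `l
0`, carries `l t` to a point `c` of a geodesic from `l 0` to `l' n`; the second, at `l' n`, carries
`c` to `l'`. This explains `2 * δ₀`. Times `t ≤ A` are covered by the summand `2 * A`. -/
theorem HasThinTriangles.exists_dist_le {δ₀ : ℝ} (hthin : D.HasThinTriangles δ₀)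
    {l l' : D.Ray}
    (h : ∀ R : ℝ, ∃ m n, R ≤ D.gromovProduct (.group 1) (l.toFun m) (l'.toFun n)) :
    ∃ C : ℕ, ∀ t, ∃ s, D.graph.dist (l.toFun t) (l'.toFun s) ≤ C := by
  let A := D.graph.dist (l.toFun 0) (l'.toFun 0)
  obtain ⟨K, hK⟩ := exists_nat_ge (2 * δ₀)
  refine ⟨K + 2 * A, fun t => ?_⟩
  by_cases htA : t ≤ A
  · refine ⟨0, (D.dist_tri _ (l.toFun 0) _).trans ?_⟩
    rw [SimpleGraph.dist_comm (u := l.toFun t), l.dist_zero]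
    show t + A ≤ _
    omega
  obtain ⟨m, n, hmn⟩ := h (t + A + D.graph.dist (.group 1) (l.toFun 0))
  have hgp : (t : ℝ) + A ≤ D.gromovProduct (l.toFun 0) (l.toFun m) (l'.toFun n) := by
    have := D.gp_base (.group 1) (l.toFun 0) (l.toFun m) (l'.toFun n)
    linarith
  have hm : t + A ≤ m := by
    have := hgp.trans (D.gp_le _ _ _)
    rw [D.rdist_comm (l.toFun m), l.dist_zero] at this
    exact_mod_cast this
  have hn : t + A ≤ D.graph.dist (l.toFun 0) (l'.toFun n) := by
    rw [D.gp_comm] at hgp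
    have := hgp.trans (D.gp_le _ _ _)
    rw [D.rdist_comm (l'.toFun n)] at this
    exact_mod_cast this
  obtain ⟨c, hc1, hc2⟩ := D.exists_between (l.toFun 0) (l'.toFun n) (t := t) (by omega)
  have hA : (0 : ℝ) ≤ A := Nat.cast_nonneg _
  have h1 : (D.graph.dist (l.toFun t) c : ℝ) ≤ δ₀ := by
    refine hthin (l.toFun 0) (l.toFun m) (l'.toFun n) _ _ ?_ ?_ ?_ ?_
    · rw [l.dist_zero, l.dist_zero, l.isGeodesic t m (by omega)]
      omega
    · rw [hc1, hc2]
    · rw [l.dist_zero, hc1]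
    · rw [l.dist_zero]
      linarith
  have hdn : D.graph.dist (l'.toFun 0) (l'.toFun n) = n := l'.dist_zero n
  have htri := D.dist_tri (l.toFun 0) (l'.toFun 0) (l'.toFun n)
  have htri' : D.graph.dist (l.toFun 0) (l'.toFun 0) = A := rfl
  have hs : D.graph.dist c (l'.toFun n) ≤ n := by omega
  refine ⟨n - D.graph.dist c (l'.toFun n), ?_⟩
  set s := n - D.graph.dist c (l'.toFun n) with hsdef
  have hsn : D.graph.dist (l'.toFun s) (l'.toFun n) = D.graph.dist c (l'.toFun n) := by
    rw [l'.isGeodesic s n (by omega)]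
    omega
  have h2 : (D.graph.dist c (l'.toFun s) : ℝ) ≤ δ₀ := by
    refine hthin (l'.toFun n) (l.toFun 0) (l'.toFun 0) _ _ ?_ ?_ ?_ ?_
    · rw [SimpleGraph.dist_comm (u := l'.toFun n), SimpleGraph.dist_comm (u := c) (v := l.toFun 0),
        SimpleGraph.dist_comm (u := l'.toFun n), hc1]
      omega
    · have := l'.dist_zero s
      rw [SimpleGraph.dist_comm (u := l'.toFun n), SimpleGraph.dist_comm (u := l'.toFun s)
        (v := l'.toFun 0), SimpleGraph.dist_comm (u := l'.toFun n), this]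
      omega
    · rw [SimpleGraph.dist_comm (u := l'.toFun n), SimpleGraph.dist_comm (u := l'.toFun n)
        (v := l'.toFun s), hsn]
    -- The Gromov product at `l' n` is at least the distance to `c` exactly because `t` is at least
    -- `A` and `d(l 0, l' n) ≤ A + n`.
    · have b1 : ((t + D.graph.dist c (l'.toFun n) : ℕ) : ℝ) =
          (D.graph.dist (l.toFun 0) (l'.toFun n) : ℕ) := by exact_mod_cast hc2
      have b2 : ((D.graph.dist (l.toFun 0) (l'.toFun n) : ℕ) : ℝ) ≤ ((A + n : ℕ) : ℝ) := by
        exact_mod_cast (by omega)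
      have b3 : (A : ℝ) ≤ t := by exact_mod_cast (by omega)
      simp only [gromovProduct]
      rw [D.rdist_comm (l'.toFun n) c, hdn, htri']
      push_cast at b1 b2
      linarith
  have h3 : ((D.graph.dist (l.toFun t) (l'.toFun s) : ℕ) : ℝ) ≤ K := by
    have := D.rdist_tri (l.toFun t) c (l'.toFun s)
    linarith
  have h4 : D.graph.dist (l.toFun t) (l'.toFun s) ≤ K := by exact_mod_cast h3
  omega

theorem HasThinTriangles.equiv_of_gp {δ₀ : ℝ} (hthin : D.HasThinTriangles δ₀)
    {l l' : D.Ray}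
    (h : ∀ R : ℝ, ∃ m n, R ≤ D.gromovProduct (.group 1) (l.toFun m) (l'.toFun n)) : l ≈ l' := by
  obtain ⟨C, hC⟩ := hthin.exists_dist_le h
  obtain ⟨C', hC'⟩ := hthin.exists_dist_le (l := l') (l' := l) fun R => by
    obtain ⟨m, n, h⟩ := h R
    exact ⟨n, m, by rwa [D.gp_comm]⟩
  refine ⟨max C C', fun m => ?_, fun n => ?_⟩
  · obtain ⟨s, hs⟩ := hC m
    exact ⟨s, hs.trans (le_max_left _ _)⟩
  · obtain ⟨s, hs⟩ := hC' n
    exact ⟨s, hs.trans (le_max_right _ _)⟩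

theorem HasThinTriangles.endpoint_eq_of_frGe {δ₀ : ℝ} (hthin : D.HasThinTriangles δ₀) {l l' : D.Ray} (h : ∀ R : ℝ, D.FrGe R l.toFun l'.toFun) :
    D.endpoint l = D.endpoint l' :=
  Quotient.sound (hthin.equiv_of_gp fun R => by
    obtain ⟨m, -, n, -, h⟩ := h R 0
    exact ⟨m, n, h⟩)

theorem evGe_of_endpoint_eq {δ : ℝ} (hδ : D.FourPoint δ) {l l' : D.Ray}
    (h : D.endpoint l = D.endpoint l') (R : ℝ) : D.EvGe R l.toFun l'.toFun :=
  Ray.evGe_of_equiv hδ (Quotient.exact h) R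

theorem exists_endpoint_eq (ω : D.Boundary) : ∃ l : D.Ray, D.endpoint l = ω :=
  Quotient.exists_rep ω

/-- Rays from the same origin to the same point at infinity are uniformly close. -/
theorem dist_ray_le_of_endpoint_eq {δ δ₀ : ℝ} (hδ : D.FourPoint δ)
    (hthin : D.HasThinTriangles δ₀) {l l' : D.Ray} (h0 : l.toFun 0 = l'.toFun 0)
    (h : D.endpoint l = D.endpoint l') (t : ℕ) :
    (D.graph.dist (l.toFun t) (l'.toFun t) : ℝ) ≤ δ₀ := by
  obtain ⟨N, hN⟩ := evGe_of_endpoint_eq hδ h (t + D.graph.dist (.group 1) (l.toFun 0))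
  have h1 := hN N le_rfl N le_rfl
  have h2 := D.gp_base (.group 1) (l.toFun 0) (l.toFun N) (l'.toFun N)
  exact hthin.dist_ray_le h0 (m := N) (n := N) (by linarith)

/-- There is a geodesic ray from each vertex to each point at infinity. -/
theorem exists_ray {δ₀ : ℝ} (hthin : D.HasThinTriangles δ₀) (e : D.Vertex)
    (ω : D.Boundary) : ∃ l : D.Ray, l.toFun 0 = e ∧ D.endpoint l = ω := by
  obtain ⟨l', rfl⟩ := exists_endpoint_eq ω
  choose c h0 h1 hc using fun i => D.exists_geodesic e (l'.toFun i)
  have hlarge : ∀ n, ∀ᶠ i in atTop, n ≤ D.graph.dist e (l'.toFun i) := fun n => by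
    filter_upwards [eventually_ge_atTop (n + D.graph.dist e (l'.toFun 0))] with i hi
    have := D.dist_tri (l'.toFun 0) e (l'.toFun i)
    rw [l'.dist_zero, SimpleGraph.dist_comm (u := l'.toFun 0)] at this
    omega
  obtain ⟨l, hl0, hl⟩ := D.exists_limit_ray (hyperfilter ℕ) e c h0 fun n => by
    have := Nat.hyperfilter_le_atTop (hlarge n)
    filter_upwards [this] with i hi s t hst ht
    exact hc i s t hst (ht.trans hi)
  refine ⟨l, hl0, Quotient.sound (hthin.equiv_of_gp fun R => ?_)⟩
  obtain ⟨t, ht⟩ := exists_nat_ge (R + D.graph.dist e (.group 1))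
  obtain ⟨i, hi, hi'⟩ := ((hl t).and (Nat.hyperfilter_le_atTop (hlarge t))).exists
  refine ⟨t, i, ?_⟩
  have h2 : D.graph.dist e (l.toFun t) = t := by rw [← hl0, l.dist_zero]
  -- For this `i` the vertex `l t` lies on the chosen geodesic from `e` to `l' i`.
  have h3 : D.gromovProduct e (l.toFun t) (l'.toFun i) = t := by
    rw [D.gp_of_between, h2]
    have := hc i t _ hi' le_rfl
    rw [h1, hi] at this
    omega
  have h4 := D.gp_base e (.group 1) (l.toFun t) (l'.toFun i)
  linarith

/-! ### Sequences tending to points of the compactification -/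

/-- At a vertex the Gromov products remain bounded, but there the sequences are eventually equal.
The alternative allows vertices and boundary points to be treated together. -/
theorem TendsTo.evGe_or {δ : ℝ} (hδ : D.FourPoint δ) {x x' : ℕ → D.Vertex} {a : D.Bordification}
    (h : D.TendsTo x a) (h' : D.TendsTo x' a) (R : ℝ) : ∃ N, ∀ m ≥ N, ∀ n ≥ N,
      R ≤ D.gromovProduct (.group 1) (x m) (x' n) ∨ x m = x' n := by
  cases a with
  | vertex v =>
    obtain ⟨N, h⟩ := eventually_atTop.1 h
    obtain ⟨N', h'⟩ := eventually_atTop.1 h'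
    refine ⟨max N N', fun m hm n hn => Or.inr ?_⟩
    rw [h m ((le_max_left _ _).trans hm), h' n ((le_max_right _ _).trans hn)]
  | bdry ω =>
    obtain ⟨l, hl, h⟩ := h
    obtain ⟨l', hl', h'⟩ := h'
    rw [tendsto_gp_iff] at h h'
    have h1 := ((h (R + 2 * δ)).trans hδ
      ((evGe_of_endpoint_eq hδ (hl.trans hl'.symm) (R + 2 * δ)))).trans hδ
      ((h' (R + 2 * δ)).symm.mono (by linarith [hδ.nonneg]))
    obtain ⟨N, hN⟩ := h1
    refine ⟨N, fun m hm n hn => Or.inl ?_⟩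
    have := hN m hm n hn
    linarith

/-- Each change of representing sequence costs one `δ` in the four-point inequality. A bound that
holds frequently for one pair of sequences therefore holds eventually for all pairs, with loss `2 *
δ`. -/
theorem FrGe.evGe {δ R : ℝ} (hδ : D.FourPoint δ) {x x' y y' : ℕ → D.Vertex}
    {a b : D.Bordification} (h : D.FrGe R x y) (hx : D.TendsTo x a) (hx' : D.TendsTo x' a)
    (hy : D.TendsTo y b) (hy' : D.TendsTo y' b) : D.EvGe (R - 2 * δ) x' y' := by
  obtain ⟨N, hN⟩ := hx.evGe_or hδ hx' R
  obtain ⟨N', hN'⟩ := hy.evGe_or hδ hy' R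
  refine ⟨max N N', fun m' hm' n' hn' => ?_⟩
  obtain ⟨m, hm, n, hn, hmn⟩ := h (max N N')
  have h1 := hN m ((le_max_left _ _).trans hm) m' ((le_max_left _ _).trans hm')
  have h2 := hN' n ((le_max_right _ _).trans hn) n' ((le_max_right _ _).trans hn')
  have h3 := hδ.nonneg
  have h4 : R - δ ≤ D.gromovProduct (.group 1) (x' m') (y n) := by
    rcases h1 with h1 | h1
    · rw [D.gp_comm] at h1
      exact hδ.le h1 hmn
    · rw [← h1]
      linarith
  rcases h2 with h2 | h2
  · have := hδ.le h4 (h2.trans' (by linarith))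
    linarith
  · rw [← h2]
    linarith

theorem Ray.tendsTo (l : D.Ray) : D.TendsTo l.toFun (.bdry (D.endpoint l)) :=
  ⟨l, rfl, tendsto_gp_iff.2 l.evGe⟩

theorem tendsTo_const (v : D.Vertex) : D.TendsTo (fun _ => v) (.vertex v) :=
  Eventually.of_forall fun _ => rfl

theorem exists_tendsTo (a : D.Bordification) : ∃ x, D.TendsTo x a := by
  cases a with
  | vertex v => exact ⟨_, tendsTo_const v⟩
  | bdry ω =>
    obtain ⟨l, rfl⟩ := exists_endpoint_eq ω
    exact ⟨_, l.tendsTo⟩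

/-! ### Closeness of points of the Gromov compactification. -/

variable (D) in
/-- `R ≤ (a | b)`, for all representing sequences. -/
def Close (R : ℝ) (a b : D.Bordification) : Prop :=
  ∀ x y, D.TendsTo x a → D.TendsTo y b → D.EvGe R x y

theorem Close.symm {R : ℝ} {a b : D.Bordification} (h : D.Close R a b) : D.Close R b a :=
  fun x y hx hy => (h y x hy hx).symm

theorem Close.mono {R R' : ℝ} {a b : D.Bordification} (h : D.Close R a b) (hR : R' ≤ R) :
    D.Close R' a b := fun x y hx hy => (h x y hx hy).mono hR

theorem Close.trans {δ R : ℝ} (hδ : D.FourPoint δ) {a b c : D.Bordification}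
    (h : D.Close R a b) (h' : D.Close R b c) : D.Close (R - δ) a c := by
  intro x z hx hz
  obtain ⟨y, hy⟩ := exists_tendsTo b
  exact (h x y hx hy).trans hδ (h' y z hy hz)

theorem FrGe.close {δ R : ℝ} (hδ : D.FourPoint δ) {x y : ℕ → D.Vertex} {a b : D.Bordification}
    (h : D.FrGe R x y) (hx : D.TendsTo x a) (hy : D.TendsTo y b) : D.Close (R - 2 * δ) a b :=
  fun _ _ hx' hy' => h.evGe hδ hx hx' hy hy'

theorem close_bdry_self {δ : ℝ} (hδ : D.FourPoint δ) (R : ℝ) (ω : D.Boundary) :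
    D.Close R (.bdry ω) (.bdry ω) := by
  obtain ⟨l, rfl⟩ := exists_endpoint_eq ω
  refine ((l.evGe (R + 2 * δ)).frGe.close hδ l.tendsTo l.tendsTo).mono (by linarith)

theorem close_vertex_iff {R : ℝ} {x y : D.Vertex} :
    D.Close R (.vertex x) (.vertex y) ↔ R ≤ D.gromovProduct (.group 1) x y := by
  constructor
  · intro h
    obtain ⟨N, hN⟩ := h _ _ (tendsTo_const x) (tendsTo_const y)
    exact hN N le_rfl N le_rfl
  · intro h x' y' hx' hy'
    obtain ⟨N, hN⟩ := eventually_atTop.1 hx'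
    obtain ⟨N', hN'⟩ := eventually_atTop.1 hy'
    refine ⟨max N N', fun m hm n hn => ?_⟩
    rw [hN m ((le_max_left _ _).trans hm), hN' n ((le_max_right _ _).trans hn)]
    exact h

theorem Close.le_dist {R : ℝ} {x : D.Vertex} {b : D.Bordification} (h : D.Close R (.vertex x) b) :
    R ≤ D.graph.dist x (.group 1) := by
  obtain ⟨y, hy⟩ := exists_tendsTo b
  obtain ⟨N, hN⟩ := h _ _ (tendsTo_const x) hy
  exact (hN N le_rfl N le_rfl).trans (D.gp_le _ _ _)

theorem eq_of_close_bdry {δ₀ : ℝ} (hthin : D.HasThinTriangles δ₀)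
    {ω ω' : D.Boundary} (h : ∀ R : ℝ, ∃ R' ≥ R, D.Close R' (.bdry ω) (.bdry ω')) : ω = ω' := by
  obtain ⟨l, rfl⟩ := exists_endpoint_eq ω
  obtain ⟨l', rfl⟩ := exists_endpoint_eq ω'
  refine hthin.endpoint_eq_of_frGe fun R => ?_
  obtain ⟨R', hR', h⟩ := h R
  exact ((h _ _ l.tendsTo l'.tendsTo).mono hR').frGe

theorem Close.le_extGromovProduct {R : ℝ} {a b : D.Bordification} (h : D.Close R a b) :
    (R : EReal) ≤ D.extGromovProduct a b := by
  obtain ⟨x, hx⟩ := exists_tendsTo a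
  obtain ⟨y, hy⟩ := exists_tendsTo b
  refine le_trans ?_ (le_sSup ⟨x, y, hx, hy, rfl⟩)
  refine le_liminf_of_le (by isBoundedDefault) ?_
  filter_upwards [evGe_iff.1 (h x y hx hy)] with t ht
  exact_mod_cast ht

/-- Together with `Close.le_extGromovProduct` this replaces the extended Gromov product by a
relation on all representing sequences, at the price of `2 * δ`. -/
theorem close_of_lt_extGromovProduct {δ R : ℝ} (hδ : D.FourPoint δ) {a b : D.Bordification}
    (h : (R : EReal) < D.extGromovProduct a b) : D.Close (R - 2 * δ) a b := by
  obtain ⟨c, ⟨x, y, hx, hy, rfl⟩, hc⟩ := lt_sSup_iff.1 h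
  have h1 := eventually_lt_of_lt_liminf hc
  have h2 : D.EvGe R x y := evGe_iff.2 (h1.mono fun t ht => by exact_mod_cast ht.le)
  exact h2.frGe.close hδ hx hy

/-! ### The topology of the Gromov compactification -/

theorem isOpen_bordification_iff {δ : ℝ} (hδ : D.FourPoint δ) {U : Set D.Bordification} :
    IsOpen U ↔ ∀ ω, .bdry ω ∈ U → ∃ n : ℕ, ∀ z, D.Close n (.bdry ω) z → z ∈ U := by
  constructor
  · intro h ω hω
    obtain ⟨R, hR⟩ := h ω hω
    obtain ⟨n, hn⟩ := exists_nat_gt R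
    exact ⟨n, fun z hz => hR z (lt_of_lt_of_le (by exact_mod_cast hn) hz.le_extGromovProduct)⟩
  · intro h ω hω
    obtain ⟨n, hn⟩ := h ω hω
    refine ⟨n + 2 * δ, fun z hz => hn z ?_⟩
    have := close_of_lt_extGromovProduct hδ hz
    simpa using this

variable (D) in
/-- The basic entourages of the compactification. -/
def entourage (n : ℕ) : Set (D.Bordification × D.Bordification) :=
  {p | p.1 = p.2 ∨ D.Close n p.1 p.2}

theorem entourage_anti {m n : ℕ} (h : m ≤ n) : D.entourage n ⊆ D.entourage m := by
  rintro p (hp | hp)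
  · exact Or.inl hp
  · exact Or.inr (hp.mono (by exact_mod_cast h))

/-- The uniform structure of the Gromov compactification. -/
theorem exists_uniformSpace {δ : ℝ} (hδ : D.FourPoint δ) : ∃ 𝒰 : UniformSpace D.Bordification,
    𝒰.toTopologicalSpace = (inferInstance : TopologicalSpace D.Bordification) ∧
      (@uniformity _ 𝒰).HasBasis (fun _ : ℕ => True) D.entourage := by
  have hbasis : (⨅ n : ℕ, 𝓟 (D.entourage n)).HasBasis (fun _ : ℕ => True) D.entourage := by
    refine hasBasis_iInf_principal ?_
    exact directed_of_isDirected_le fun m n h => entourage_anti h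
  let core : UniformSpace.Core D.Bordification :=
    { uniformity := ⨅ n : ℕ, 𝓟 (D.entourage n)
      refl := by
        refine hbasis.ge_iff.2 fun n _ => ?_
        rintro ⟨a, b⟩ h
        exact Or.inl h
      symm := by
        refine (hbasis.tendsto_iff hbasis).2 fun n _ => ⟨n, trivial, ?_⟩
        rintro ⟨a, b⟩ (h | h)
        · exact Or.inl h.symm
        · exact Or.inr h.symm
      comp := by
        refine (hbasis.lift' (monotone_id.relComp monotone_id)).le_basis_iff hbasis |>.2 ?_
        intro n _
        obtain ⟨m, hm⟩ := exists_nat_ge (n + δ)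
        refine ⟨m, trivial, ?_⟩
        have hmn : n ≤ m := by
          have := hδ.nonneg
          exact_mod_cast (show (n : ℝ) ≤ m by linarith)
        rintro ⟨a, b⟩ ⟨c, h1, h2⟩
        rcases h1 with h1 | h1
        · obtain rfl : a = c := h1
          exact entourage_anti hmn h2
        rcases h2 with h2 | h2
        · obtain rfl : c = b := h2
          exact entourage_anti hmn (Or.inr h1)
        · exact Or.inr ((Close.trans hδ h1 h2).mono (by linarith)) }
  have htop : (UniformSpace.ofCore core).toTopologicalSpace =
      (inferInstance : TopologicalSpace D.Bordification) := by
    ext U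
    rw [@isOpen_uniformity _ (UniformSpace.ofCore core), isOpen_bordification_iff hδ]
    have hb : ∀ a : D.Bordification, ({p : D.Bordification × D.Bordification | p.1 = a → p.2 ∈ U} ∈
        core.uniformity) ↔ ∃ n : ℕ, ∀ p ∈ D.entourage n, p.1 = a → p.2 ∈ U := fun a => by
      rw [hbasis.mem_iff]
      simp only [true_and]
      rfl
    constructor
    · intro h ω hω
      obtain ⟨n, hn⟩ := (hb _).1 (h _ hω)
      exact ⟨n, fun z hz => hn (.bdry ω, z) (Or.inr hz) rfl⟩
    · intro h a ha
      refine (hb a).2 ?_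
      cases a with
      | vertex v =>
        -- A Gromov product with `v` is at most the distance from `v` to the base point, so at this
        -- level the entourage isolates `v`.
        refine ⟨D.graph.dist v (.group 1) + 1, ?_⟩
        rintro ⟨a, b⟩ hab rfl
        rcases hab with hab | hab
        · exact (show Bordification.vertex v = b from hab) ▸ ha
        · have := Close.le_dist hab
          push_cast at this
          linarith
      | bdry ω =>
        obtain ⟨n, hn⟩ := h ω ha
        refine ⟨n, ?_⟩
        rintro ⟨a, b⟩ hab rfl
        rcases hab with hab | hab
        · exact (show Bordification.bdry ω = b from hab) ▸ ha
        · exact hn b hab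
  exact ⟨UniformSpace.ofCore core, htop, hbasis⟩

theorem nhds_bdry_basis {δ : ℝ} (hδ : D.FourPoint δ) (ω : D.Boundary) :
    (𝓝 (Bordification.bdry ω : D.Bordification)).HasBasis (fun _ : ℕ => True)
      fun n => {z | D.Close n (.bdry ω) z} := by
  obtain ⟨𝒰, h𝒰, hb⟩ := exists_uniformSpace hδ
  have h1 := @nhds_basis_uniformity' _ _ 𝒰 _ _ hb (.bdry ω)
  rw [h𝒰] at h1
  refine h1.congr (fun _ => Iff.rfl) fun n _ => ?_
  ext z
  constructor
  · rintro (h | h)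
    · have h : Bordification.bdry ω = z := h
      rw [← h]
      exact close_bdry_self hδ n ω
    · exact h
  · exact fun h => Or.inr h

theorem tendsto_bdry_iff {δ : ℝ} (hδ : D.FourPoint δ) {ω : D.Boundary} {ι : Type*} {l : Filter ι}
    {z : ι → D.Bordification} : Tendsto z l (𝓝 (.bdry ω)) ↔
      ∀ R : ℝ, ∀ᶠ i in l, D.Close R (.bdry ω) (z i) := by
  rw [(nhds_bdry_basis hδ ω).tendsto_right_iff]
  constructor
  · intro h R
    obtain ⟨n, hn⟩ := exists_nat_ge R
    exact (h n trivial).mono fun i hi => Close.mono hi hn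
  · exact fun h n _ => h n

theorem isOpen_vertex (v : D.Vertex) : IsOpen {(Bordification.vertex v : D.Bordification)} := by
  intro ω hω
  cases hω

/-- The uniform structure has a countable basis, which gives a pseudometric. Points are separated
because vertices are open and two boundary points with unbounded Gromov product coincide. -/
theorem metrizableSpace_bordification {δ δ₀ : ℝ} (hδ : D.FourPoint δ) (hthin : D.HasThinTriangles δ₀) : TopologicalSpace.MetrizableSpace D.Bordification := by
  obtain ⟨𝒰, h𝒰, hb⟩ := exists_uniformSpace hδ
  have : (@uniformity _ 𝒰).IsCountablyGenerated := hb.isCountablyGenerated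
  have hp : TopologicalSpace.PseudoMetrizableSpace D.Bordification := by
    have hp := @UniformSpace.pseudoMetrizableSpace _ 𝒰 this
    rw [h𝒰] at hp
    exact hp
  have h0 : T0Space D.Bordification := by
    refine ⟨fun a b hab => ?_⟩
    cases a with
    | vertex v =>
      have h1 : b ∈ ({.vertex v} : Set D.Bordification) :=
        (hab.mem_open_iff (isOpen_vertex v)).1 rfl
      exact (show b = _ from h1).symm
    | bdry ω =>
      cases b with
      | vertex v => exact (hab.mem_open_iff (isOpen_vertex v)).2 rfl
      | bdry ω' =>
        congr 1
        refine eq_of_close_bdry hthin fun R => ⟨R, le_rfl, ?_⟩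
        obtain ⟨n, hn⟩ := exists_nat_ge R
        have h1 : {z | D.Close n (.bdry ω) z} ∈ 𝓝 (Bordification.bdry ω' : D.Bordification) := by
          rw [← show 𝓝 (Bordification.bdry ω : D.Bordification) = 𝓝 (.bdry ω') from hab]
          exact (nhds_bdry_basis hδ ω).mem_of_mem trivial
        exact Close.mono (mem_of_mem_nhds h1) hn
  infer_instance

/-- An ultrafilter that contains a ball of vertices is principal, as balls are finite. For any
other, the geodesics from the identity to the points of the compactification converge to a ray,
whose endpoint is the limit. -/
theorem compactSpace_bordification {δ δ₀ : ℝ} (hδ : D.FourPoint δ) (hthin : D.HasThinTriangles δ₀) : CompactSpace D.Bordification := by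
  refine ⟨isCompact_iff_ultrafilter_le_nhds.2 fun U _ => ?_⟩
  let o : D.Vertex := .group 1
  by_cases hU : ∃ n : ℕ, ∀ᶠ a in (U : Filter D.Bordification),
      ∃ v ∈ {v | D.graph.dist o v ≤ n}, a = .vertex v
  · obtain ⟨n, hn⟩ := hU
    obtain ⟨v, -, hv⟩ := (Ultrafilter.eventually_exists_mem_iff (D.finite_ball o n)).1 hn
    refine ⟨.vertex v, trivial, ?_⟩
    intro s hs
    filter_upwards [hv] with a ha
    rw [ha]
    exact mem_of_mem_nhds hs
  push Not at hU
  have hU' : ∀ n : ℕ, ∀ᶠ a in (U : Filter D.Bordification), ∀ v, a = .vertex v →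
      n < D.graph.dist o v := fun n => by
    filter_upwards [hU n] with a ha v hv
    by_contra hlt
    exact ha v (not_lt.1 hlt) hv
  have hc : ∀ a : D.Bordification, ∃ c : ℕ → D.Vertex, c 0 = o ∧
      ((∃ v, a = .vertex v ∧ c (D.graph.dist o v) = v ∧ ∀ s t, s ≤ t → t ≤ D.graph.dist o v →
        D.graph.dist (c s) (c t) = t - s) ∨
      ∃ l : D.Ray, l.toFun = c ∧ a = .bdry (D.endpoint l)) := by
    rintro (v | ω)
    · obtain ⟨c, h0, h1, h2⟩ := D.exists_geodesic o v
      exact ⟨c, h0, Or.inl ⟨v, rfl, h1, h2⟩⟩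
    · obtain ⟨l, h0, rfl⟩ := exists_ray hthin o ω
      exact ⟨l.toFun, h0, Or.inr ⟨l, rfl, rfl⟩⟩
  choose c h0 hc using hc
  obtain ⟨l, hl0, hl⟩ := D.exists_limit_ray U o c h0 fun n => by
    filter_upwards [hU' n] with a ha s t hst ht
    rcases hc a with ⟨v, hv, -, h⟩ | ⟨l, hl, -⟩
    · exact h s t hst (ht.trans (ha v hv).le)
    · rw [← hl]
      exact l.isGeodesic s t hst
  refine ⟨.bdry (D.endpoint l), trivial, ?_⟩
  refine (tendsto_bdry_iff hδ (z := id)).2 fun R => ?_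
  -- One `δ` is lost in comparing both sides with `l t`, and two in passing to all representing
  -- sequences.
  obtain ⟨t, ht⟩ := exists_nat_ge (R + 3 * δ)
  have hδ' := hδ.nonneg
  filter_upwards [hl t, hU' t] with a hat haU
  have hlt : ∀ m ≥ t, (R + 3 * δ) ≤ D.gromovProduct (.group 1) (l.toFun m) (l.toFun t) := by
    intro m hm
    rw [D.gp_comm]
    have := l.gp_zero hm
    rw [hl0] at this
    show _ ≤ D.gromovProduct o _ _
    rw [this]
    exact ht
  rcases hc a with ⟨v, rfl, h1, h2⟩ | ⟨l', hl', rfl⟩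
  · refine (EvGe.frGe (R := R + 3 * δ - δ) ⟨t, fun m hm n hn => hδ.le (hlt m hm) ?_⟩).close hδ l.tendsTo
      (tendsTo_const v) |>.mono (by linarith)
    rw [← hat]
    have h3 := h2 0 t (Nat.zero_le _) (haU v rfl).le
    rw [h0] at h3
    have h4 : D.gromovProduct o (c (.vertex v) t) v = t := by
      rw [D.gp_of_between, h3, Nat.sub_zero]
      have h5 := h2 t _ (haU v rfl).le le_rfl
      rw [h1] at h5
      have := haU v rfl
      omega
    show _ ≤ D.gromovProduct o _ _
    rw [h4]
    exact ht
  · refine (EvGe.frGe (R := R + 3 * δ - δ) ⟨t, fun m hm n hn => hδ.le (hlt m hm) ?_⟩).close hδ l.tendsTo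
      l'.tendsTo |>.mono (by linarith)
    rw [← hat, ← hl']
    have := l'.gp_zero hn
    rw [hl', h0, ← hl'] at this
    show _ ≤ D.gromovProduct o _ _
    rw [this]
    exact ht

end PeripheralGroup
end BlownUp

namespace BlownUp
universe u v w

namespace PeripheralGroup

variable {G : Type u} [Group G] {k : ℕ} [NeZero k] (D : PeripheralGroup G k)

/-! ## Horoballs -/

/-- The vertex lies in the `i`-th horoball or on its boundary. -/
def InHoroball (i : ℕ) (x : D.Vertex) : Prop := ∃ (p : D.coset i) (h : ℕ), x = D.vert i p h

theorem inHoroball_vert (i : ℕ) (p : D.coset i) (h : ℕ) : D.InHoroball i (D.vert i p h) :=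
  ⟨p, h, rfl⟩

theorem inHoroball_of_depth_ne {i : ℕ} {x : D.Vertex} (h : D.depth i x ≠ 0) :
    D.InHoroball i x := by
  cases x with
  | group x => exact absurd rfl h
  | horo j p l =>
    by_cases hj : j = i
    · subst hj
      exact ⟨p, l + 1, rfl⟩
    · simp [depth, hj] at h

theorem dist_vert_vert_vertical (i : ℕ) (p : D.coset i) {h m : ℕ} (hm : h ≤ m) :
    D.graph.dist (D.vert i p h) (D.vert i p m) ≤ m - h := by
  induction m, hm using Nat.le_induction with
  | base => simp
  | succ m hm ih =>
    have h1 := SimpleGraph.dist_eq_one_iff_adj.2 (D.adj_of_edge (D.edge_vert i p m))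
    have h2 := D.dist_tri (D.vert i p h) (D.vert i p m) (D.vert i p (m + 1))
    omega

theorem dist_vert_vert_horizontal (i : ℕ) (p q : D.coset i) {m : ℕ}
    (h : D.cayley.dist p q ≤ 2 ^ m) : D.graph.dist (D.vert i p m) (D.vert i q m) ≤ 1 := by
  cases m with
  | zero => exact (D.graph_dist_group_le p q).trans h
  | succ m =>
    by_cases hpq : p = q
    · simp [hpq]
    · exact (SimpleGraph.dist_eq_one_iff_adj.2
        (D.adj_of_edge (.horizontal i p q m hpq h))).le

/-- Go straight up to a level at which `p` and `g_i` are equal or joined by a horizontal edge.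
Combined with `le_dist_vert`, this makes the depth a Busemann function of the horoball up to an
error of 1. -/
theorem exists_dist_vert_le (i : ℕ) (p : D.coset i) (h : ℕ) : ∃ M, ∀ m ≥ M,
    h + D.graph.dist (D.vert i p h) (D.vert i (D.cosetRep i) m) ≤ m + 1 := by
  refine ⟨h + D.cayley.dist p (D.cosetRep i), fun m hm => ?_⟩
  have h1 := D.dist_vert_vert_vertical i p (show h ≤ m by omega)
  have h2 : D.cayley.dist p (D.cosetRep i) ≤ 2 ^ m := by
    have := (Nat.lt_two_pow_self (n := m)).le
    omega
  have h3 := D.dist_vert_vert_horizontal i p (D.cosetRep i) h2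
  have h4 := D.dist_tri (D.vert i p h) (D.vert i p m) (D.vert i (D.cosetRep i) m)
  omega

theorem le_dist_vert (i m : ℕ) (u : D.Vertex) :
    m ≤ D.depth i u + D.graph.dist u (D.vert i (D.cosetRep i) m) := by
  have := D.depth_le i (D.vert i (D.cosetRep i) m) u
  rwa [D.depth_vert, SimpleGraph.dist_comm] at this

/-- Two different horoballs diverge. -/
theorem depth_add_depth_le (i j : ℕ) (a b : D.Vertex) :
    D.depth i a + D.depth j b ≤ D.depth j a + D.depth i b + D.graph.dist a b := by
  obtain ⟨p, hp⟩ := D.graph_connected.exists_walk_length_eq_dist a b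
  rw [← hp]
  clear hp
  -- The difference of the two depths is 1-Lipschitz along edges, since no edge joins the interiors
  -- of two different horoballs.
  have key : ∀ {a b : D.Vertex}, D.Edge a b →
      D.depth i a + D.depth j b ≤ D.depth j a + D.depth i b + 1 ∧
      D.depth i b + D.depth j a ≤ D.depth j b + D.depth i a + 1 := by
    intro a b h
    cases h <;> simp only [depth] <;> (try split_ifs) <;> constructor <;> omega
  induction p with
  | nil => simp [add_comm]
  | cons h p ih =>
    rw [SimpleGraph.Walk.length_cons]
    rcases ((SimpleGraph.fromRel_adj _ _ _).1 h).2 with h | h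
    · have := (key h).1
      omega
    · have := (key h).2
      omega

variable {D}

/-- Seen from the identity, a very deep vertical point `v_m` is at distance about `m` and is at most
`m + 1 - h` away from `x`. Its Gromov product with `x` is thus at least half the distance of `x` to
the identity, up to a constant that does not depend on `x`. -/
theorem close_parabolic {δ : ℝ} (hδ : D.FourPoint δ) {i : ℕ} {x : D.Vertex}
    (hx : D.InHoroball i x) :
    D.Close (((D.graph.dist x (.group 1) : ℝ) - 1) / 2 -
      2 * D.graph.dist (.group 1) (D.vert i (D.cosetRep i) 0) - 2 * δ)
      (.bdry (D.parabolicPoint i)) (.vertex x) := by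
  obtain ⟨p, h, rfl⟩ := hx
  obtain ⟨M, hM⟩ := D.exists_dist_vert_le i p h
  refine EvGe.frGe (R := ((D.graph.dist (D.vert i p h) (.group 1) : ℝ) - 1) / 2 -
    2 * D.graph.dist (.group 1) (D.vert i (D.cosetRep i) 0)) ⟨M, fun m hm _ _ => ?_⟩ |>.close hδ
    (D.verticalRay i).tendsTo (tendsTo_const _)
  have h1 : (h : ℝ) + D.graph.dist (D.vert i p h) (D.vert i (D.cosetRep i) m) ≤ m + 1 := by
    exact_mod_cast hM m hm
  have h2 : D.graph.dist (D.vert i (D.cosetRep i) 0) (D.vert i (D.cosetRep i) m) = m :=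
    (D.verticalRay i).dist_zero m
  have h3 := D.rdist_tri (D.vert i (D.cosetRep i) 0) (.group 1) (D.vert i (D.cosetRep i) m)
  rw [h2, D.rdist_comm _ (.group 1)] at h3
  have h4 : (D.verticalRay i).toFun m = D.vert i (D.cosetRep i) m := rfl
  have h5 := D.rdist_nonneg (.group 1) (D.vert i (D.cosetRep i) 0)
  have h6 : (0 : ℝ) ≤ h := Nat.cast_nonneg h
  rw [h4]
  simp only [gromovProduct]
  rw [D.rdist_comm (D.vert i (D.cosetRep i) m) (.group 1),
    D.rdist_comm (D.vert i (D.cosetRep i) m) (D.vert i p h)]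
  linarith

/-- A family leaves all balls. -/
theorem tendsto_parabolic {δ : ℝ} (hδ : D.FourPoint δ) {i : ℕ} {ι : Type*} {l : Filter ι}
    {x : ι → D.Vertex} (hx : ∀ᶠ j in l, D.InHoroball i (x j))
    (hinf : ∀ n : ℕ, ∀ᶠ j in l, n ≤ D.graph.dist (x j) (.group 1)) :
    Tendsto (fun j => Bordification.vertex (x j)) l (𝓝 (.bdry (D.parabolicPoint i))) := by
  refine (tendsto_bdry_iff hδ).2 fun R => ?_
  obtain ⟨n, hn⟩ := exists_nat_ge
    (2 * (R + 2 * D.graph.dist (.group 1) (D.vert i (D.cosetRep i) 0) + 2 * δ) + 1)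
  filter_upwards [hx, hinf n] with j hj hj'
  refine (close_parabolic hδ hj).mono ?_
  have : (n : ℝ) ≤ D.graph.dist (x j) (.group 1) := by exact_mod_cast hj'
  linarith

/-! ### Rays leaving a horoball. -/

theorem Ray.leaves (l : D.Ray) (n : ℕ) :
    ∀ᶠ t in atTop, n ≤ D.graph.dist (l.toFun t) (.group 1) := by
  filter_upwards [eventually_ge_atTop (n + D.graph.dist (l.toFun 0) (.group 1))] with t ht
  have := D.dist_tri (l.toFun 0) (.group 1) (l.toFun t)
  rw [l.dist_zero, SimpleGraph.dist_comm (u := .group 1) (v := l.toFun t)] at this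
  omega

theorem Ray.tendsto {δ : ℝ} (hδ : D.FourPoint δ) (l : D.Ray) :
    Tendsto (fun t => Bordification.vertex (l.toFun t)) atTop (𝓝 (.bdry (D.endpoint l))) := by
  refine (tendsto_bdry_iff hδ).2 fun R => ?_
  obtain ⟨N, hN⟩ := l.evGe (R + 2 * δ)
  filter_upwards [eventually_ge_atTop N] with t ht
  refine EvGe.frGe (R := R + 2 * δ) ⟨N, fun m hm _ _ => hN m hm t ht⟩ |>.close hδ l.tendsTo
    (tendsTo_const _) |>.mono (by linarith)

/-- A ray that meets a horoball infinitely often tends to its parabolic point. -/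
theorem endpoint_eq_parabolicPoint {δ δ₀ : ℝ} (hδ : D.FourPoint δ) (hthin : D.HasThinTriangles δ₀)
    {i : ℕ} {l : D.Ray} (h : ∃ᶠ t in atTop, D.InHoroball i (l.toFun t)) :
    D.endpoint l = D.parabolicPoint i := by
  have := metrizableSpace_bordification hδ hthin
  have hne : (atTop ⊓ 𝓟 {t | D.InHoroball i (l.toFun t)}).NeBot := frequently_mem_iff_neBot.1 h
  have h1 := (l.tendsto hδ).mono_left
    (inf_le_left (a := atTop) (b := 𝓟 {t | D.InHoroball i (l.toFun t)}))
  have h2 := tendsto_parabolic hδ (i := i) (l := atTop ⊓ 𝓟 {t | D.InHoroball i (l.toFun t)})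
    (x := l.toFun) (mem_inf_of_right (mem_principal_self _))
    fun n => (l.leaves n).filter_mono inf_le_left
  have h3 := tendsto_nhds_unique h1 h2
  injection h3

/-- A geodesic between points near a horosphere is shallow only near its ends. -/
theorem FourPoint.shallow {δ : ℝ} (hδ : D.FourPoint δ) {i N : ℕ} {u p : D.Vertex} {K : ℝ}
    (hK : 0 ≤ K)
    (hgeo : (D.graph.dist (D.vert i (D.cosetRep i) N) u : ℝ) + D.graph.dist u p ≤
      D.graph.dist (D.vert i (D.cosetRep i) N) p + K)
    (hu : (D.depth i u : ℝ) ≤ K) {q : D.coset i} (hq : (D.graph.dist p (.group q) : ℝ) ≤ K) :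
    (D.graph.dist u p : ℝ) ≤ 3 * K + 1 + 2 * δ ∨
      (D.graph.dist (D.vert i (D.cosetRep i) N) u : ℝ) ≤ 3 * K + 1 + 2 * δ := by
  obtain ⟨M, hM⟩ := D.exists_dist_vert_le i q 0
  set m := max M N
  have h1 : (D.graph.dist (.group q) (D.vert i (D.cosetRep i) m) : ℝ) ≤ m + 1 := by
    have := hM m (le_max_left _ _)
    rw [zero_add] at this
    exact_mod_cast this
  have h2 : (D.graph.dist (D.vert i (D.cosetRep i) N) (D.vert i (D.cosetRep i) m) : ℝ) ≤ m := by
    have := D.dist_vert_vert_vertical i (D.cosetRep i) (le_max_right M N)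
    exact_mod_cast this.trans (Nat.sub_le _ _)
  have h3 : (m : ℝ) ≤ D.depth i u + D.graph.dist u (D.vert i (D.cosetRep i) m) := by
    exact_mod_cast D.le_dist_vert i m u
  have h4 := D.rdist_tri p (.group q) (D.vert i (D.cosetRep i) m)
  have h5 := hδ.dist_add_le u (D.vert i (D.cosetRep i) m) (D.vert i (D.cosetRep i) N) p
  rw [D.rdist_comm u (D.vert i (D.cosetRep i) N), D.rdist_comm (D.vert i (D.cosetRep i) m) p,
    D.rdist_comm (D.vert i (D.cosetRep i) m) (D.vert i (D.cosetRep i) N)] at h5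
  rcases max_cases ((D.graph.dist (D.vert i (D.cosetRep i) N) u : ℝ) +
    D.graph.dist p (D.vert i (D.cosetRep i) m)) (D.graph.dist u p +
    D.graph.dist (D.vert i (D.cosetRep i) N) (D.vert i (D.cosetRep i) m)) with ⟨h, -⟩ | ⟨h, -⟩
  · rw [h] at h5
    left
    linarith
  · rw [h] at h5
    right
    linarith

theorem FourPoint.shallow_ray {δ : ℝ} (hδ : D.FourPoint δ) {i N : ℕ} {l : D.Ray}
    (h0 : l.toFun 0 = D.vert i (D.cosetRep i) N) {K : ℝ} (hK : 0 ≤ K) {s t : ℕ} (hst : s ≤ t)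
    (hs : (D.depth i (l.toFun s) : ℝ) ≤ K) {q : D.coset i}
    (hq : (D.graph.dist (l.toFun t) (.group q) : ℝ) ≤ K) :
    (t : ℝ) ≤ s + (3 * K + 1 + 2 * δ) ∨ (s : ℝ) ≤ 3 * K + 1 + 2 * δ := by
  have h := hδ.shallow (N := N) hK ?_ hs hq
  · rw [l.dist_eq hst, ← h0, l.dist_zero] at h
    rcases h with h | h
    · left
      linarith
    · exact Or.inr h
  · rw [l.dist_eq hst, ← h0, l.dist_zero, l.dist_zero]
    linarith

/-- A ray that has left a horoball does not come back near it. -/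
theorem FourPoint.no_return {δ : ℝ} (hδ : D.FourPoint δ) {i N : ℕ} {l : D.Ray}
    (h0 : l.toFun 0 = D.vert i (D.cosetRep i) N) {K : ℝ} (hK : 0 ≤ K) {n t : ℕ} (hnt : n ≤ t)
    (hs : ∀ s, n ≤ s → s ≤ t → (D.depth i (l.toFun s) : ℝ) ≤ K) {q : D.coset i}
    (hq : (D.graph.dist (l.toFun t) (.group q) : ℝ) ≤ K) :
    (t : ℝ) ≤ n + (2 * (3 * K + 1 + 2 * δ) + 1) := by
  have hδ0 := hδ.nonneg
  set C := 3 * K + 1 + 2 * δ with hC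
  have hC0 : 0 ≤ C := by positivity
  by_contra! hcon
  have hf := Nat.floor_le hC0
  have hf' := Nat.lt_floor_add_one C
  have key : ∀ s, n ≤ s → s ≤ t → C < s → (t : ℝ) ≤ s + C := fun s h1 h2 h3 => by
    rcases hδ.shallow_ray h0 hK h2 (hs s h1 h2) hq with h | h
    · exact h
    · exact absurd h (not_le.2 h3)
  by_cases hn : C < n
  · have := key n le_rfl hnt hn
    linarith
  · have hn' : n ≤ ⌊C⌋₊ := Nat.le_floor (not_lt.1 hn)
    have hn0 : (0 : ℝ) ≤ n := Nat.cast_nonneg n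
    have hst : ⌊C⌋₊ + 1 ≤ t := by
      have : ((⌊C⌋₊ + 1 : ℕ) : ℝ) ≤ t := by push_cast; linarith
      exact_mod_cast this
    -- For `n ≤ C` the time `n` may be shallow just because it is close to the apex, so the argument
    -- starts at the first integer beyond `C`. This accounts for the second `C` and the final 1 in
    -- the bound.
    have := key (⌊C⌋₊ + 1) (by omega) hst (by push_cast; exact hf')
    push_cast at this
    linarith

/-! ### Exit points -/

variable (D) in
/-- The ray leaves the `i`-th horoball for good at time `n`, at the point `p`. -/
structure IsExit (i : ℕ) (l : D.Ray) (n : ℕ) (p : D.coset i) : Prop where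
  eq : l.toFun n = .group p
  notMem : ∀ t, n < t → ¬ D.InHoroball i (l.toFun t)

theorem IsExit.depth_eq {i : ℕ} {l : D.Ray} {n : ℕ} {p : D.coset i} (h : D.IsExit i l n p) {t : ℕ}
    (ht : n ≤ t) : D.depth i (l.toFun t) = 0 := by
  rcases ht.eq_or_lt with rfl | ht
  · rw [h.eq]
    rfl
  · by_contra hne
    exact h.notMem t ht (D.inHoroball_of_depth_ne hne)

theorem inHoroball_of_adj {i : ℕ} {x y : D.Vertex} (h : D.graph.Adj x y) (hx : D.depth i x ≠ 0) :
    D.InHoroball i y := by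
  have key : ∀ {a b : D.Vertex}, D.Edge a b → (D.depth i a ≠ 0 → D.InHoroball i b) ∧
      (D.depth i b ≠ 0 → D.InHoroball i a) := by
    intro a b hab
    cases hab with
    | cayley x y h => exact ⟨fun h => absurd rfl h, fun h => absurd rfl h⟩
    | bottom j p =>
      refine ⟨fun h => absurd rfl h, fun h => ?_⟩
      by_cases hj : j = i
      · subst hj
        exact ⟨p, 0, rfl⟩
      · simp [depth, hj] at h
    | vertical j p l =>
      by_cases hj : j = i
      · subst hj
        exact ⟨fun _ => ⟨p, l + 2, rfl⟩, fun _ => ⟨p, l + 1, rfl⟩⟩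
      · simp [depth, hj]
    | horizontal j p q l hpq h =>
      by_cases hj : j = i
      · subst hj
        exact ⟨fun _ => ⟨q, l + 1, rfl⟩, fun _ => ⟨p, l + 1, rfl⟩⟩
      · simp [depth, hj]
  rcases ((SimpleGraph.fromRel_adj _ _ _).1 h).2 with h | h
  · exact (key h).1 hx
  · exact (key h).2 hx

theorem Ray.adj (l : D.Ray) (t : ℕ) : D.graph.Adj (l.toFun t) (l.toFun (t + 1)) :=
  SimpleGraph.dist_eq_one_iff_adj.1 (by rw [l.isGeodesic t (t + 1) (by omega)]; omega)

/-- The ray does not end at `s_i`, so it has a last time in the closed horoball. At that time its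
depth is zero, because every neighbour of a vertex of positive depth is still in the closed
horoball. Hence it is also the last time in the coset. -/
theorem exists_isExit {δ δ₀ : ℝ} (hδ : D.FourPoint δ) (hthin : D.HasThinTriangles δ₀)
    {i N : ℕ} {l : D.Ray} (h0 : l.toFun 0 = D.vert i (D.cosetRep i) N)
    (hne : D.endpoint l ≠ D.parabolicPoint i) :
    ∃ p, D.IsExit i l (RayChoice.exitTime i l) p := by
  have h1 : ∀ᶠ t in atTop, ¬ D.InHoroball i (l.toFun t) := by
    by_contra h
    exact hne (endpoint_eq_parabolicPoint hδ hthin h)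
  obtain ⟨T, hT⟩ := eventually_atTop.1 h1
  let S : Set ℕ := {t | D.InHoroball i (l.toFun t)}
  have hSne : S.Nonempty := ⟨0, by show D.InHoroball i _; rw [h0]; exact D.inHoroball_vert _ _ _⟩
  have hSb : BddAbove S := ⟨T, fun t ht => by
    by_contra hlt
    exact hT t (not_le.1 hlt).le ht⟩
  have hn := Nat.sSup_mem hSne hSb
  have hlast : ∀ t, sSup S < t → ¬ D.InHoroball i (l.toFun t) := fun t ht hmem =>
    absurd (le_csSup hSb hmem) (not_le.2 ht)
  have hd : D.depth i (l.toFun (sSup S)) = 0 := by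
    by_contra hne'
    exact hlast _ (Nat.lt_succ_self _) (inHoroball_of_adj (l.adj _) hne')
  obtain ⟨p, h, hp⟩ := hn
  have hh : h = 0 := by rw [hp, D.depth_vert] at hd; exact hd
  subst hh
  have hexit : RayChoice.exitTime i l = sSup S := by
    refine le_antisymm (csSup_le_csSup hSb ⟨_, p, hp⟩ ?_) (le_csSup ⟨sSup S, ?_⟩ ⟨p, hp⟩)
    · rintro n ⟨q, hq⟩
      exact ⟨q, 0, hq⟩
    · rintro n ⟨q, hq⟩
      exact le_csSup hSb ⟨q, 0, hq⟩
  refine ⟨p, ?_, ?_⟩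
  · rw [hexit]
    exact hp
  · rw [hexit]
    exact hlast

/-- Fellow travelling rays have close exit points. -/
theorem IsExit.dist_le_of_le {δ : ℝ} (hδ : D.FourPoint δ) {i N : ℕ} {l l' : D.Ray}
    (h0 : l.toFun 0 = D.vert i (D.cosetRep i) N) {n n' : ℕ} {p p' : D.coset i}
    (h : D.IsExit i l n p) (h' : D.IsExit i l' n' p') (hnn : n ≤ n') {K : ℝ}
    (hd : (D.graph.dist (l.toFun n') (l'.toFun n') : ℝ) ≤ K) :
    (D.graph.dist (.group p) (.group p') : ℝ) ≤ K + (2 * (3 * K + 1 + 2 * δ) + 1) := by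
  have hK : 0 ≤ K := (Nat.cast_nonneg _).trans hd
  have h1 := hδ.no_return h0 hK hnn (fun s hs _ => by rw [h.depth_eq hs]; simpa using hK)
    (q := p') (by rw [← h'.eq]; exact hd)
  have h2 := D.rdist_tri (.group p) (l.toFun n') (.group p')
  rw [← h.eq, ← h'.eq, l.dist_eq hnn] at h2
  rw [← h.eq, ← h'.eq]
  linarith

theorem IsExit.dist_le {δ : ℝ} (hδ : D.FourPoint δ) {i N : ℕ} {l l' : D.Ray}
    (h0 : l.toFun 0 = D.vert i (D.cosetRep i) N) (h0' : l'.toFun 0 = D.vert i (D.cosetRep i) N)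
    {n n' : ℕ} {p p' : D.coset i} (h : D.IsExit i l n p) (h' : D.IsExit i l' n' p') {K T : ℝ}
    (hd : ∀ s : ℕ, s ≤ T → (D.graph.dist (l.toFun s) (l'.toFun s) : ℝ) ≤ K) (hn : (n : ℝ) ≤ T)
    (hn' : (n' : ℝ) ≤ T) :
    (D.graph.dist (.group p) (.group p') : ℝ) ≤ K + (2 * (3 * K + 1 + 2 * δ) + 1) := by
  rcases le_total n n' with hnn | hnn
  · exact h.dist_le_of_le hδ h0 h' hnn (hd n' hn')
  · rw [D.rdist_comm]
    exact h'.dist_le_of_le hδ h0' h hnn (by rw [D.rdist_comm]; exact hd n hn)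

/-- Rays from a common origin which are close at time `τ` fellow travel until then. -/
theorem HasThinTriangles.fellow {δ₀ : ℝ} (hthin : D.HasThinTriangles δ₀) (hδ₀ : 0 ≤ δ₀)
    {l l' : D.Ray} (h0 : l.toFun 0 = l'.toFun 0) {τ : ℕ} {K C : ℝ} (hC : 0 ≤ C)
    (hd : (D.graph.dist (l.toFun τ) (l'.toFun τ) : ℝ) ≤ K) {s : ℕ} (hs : (s : ℝ) ≤ τ + C) :
    (D.graph.dist (l.toFun s) (l'.toFun s) : ℝ) ≤ δ₀ + 2 * K + 2 * C := by
  have hK : 0 ≤ K := (Nat.cast_nonneg _).trans hd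
  -- Up to time `τ - K / 2` the Gromov product of the points at time `τ` is large enough for
  -- thinness. Afterwards the triangle inequality through time `τ` is used.
  by_cases hsτ : (s : ℝ) ≤ τ - K / 2
  · have h1 : (s : ℝ) ≤ D.gromovProduct (l.toFun 0) (l.toFun τ) (l'.toFun τ) := by
      simp only [gromovProduct]
      rw [D.rdist_comm _ (l.toFun 0), l.dist_zero, D.rdist_comm (l'.toFun τ), h0, l'.dist_zero]
      linarith
    have := hthin.dist_ray_le h0 h1
    linarith
  · have h1 := D.rdist_tri (l.toFun s) (l.toFun τ) (l'.toFun s)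
    have h2 := D.rdist_tri (l.toFun τ) (l'.toFun τ) (l'.toFun s)
    rcases le_total s τ with h | h
    · rw [l.dist_eq h] at h1
      rw [D.rdist_comm (l'.toFun τ), l'.dist_eq h] at h2
      linarith
    · rw [D.rdist_comm (l.toFun s) (l.toFun τ), l.dist_eq h] at h1
      rw [l'.dist_eq h] at h2
      linarith

/-- Rays to close points at infinity fellow travel for a long time. -/
theorem Close.dist_ray_le {δ₀ : ℝ} (hthin : D.HasThinTriangles δ₀) {l l' : D.Ray}
    (h0 : l.toFun 0 = l'.toFun 0) {R : ℝ}
    (h : D.Close R (.bdry (D.endpoint l)) (.bdry (D.endpoint l'))) {s : ℕ}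
    (hs : (s : ℝ) + D.graph.dist (.group 1) (l.toFun 0) ≤ R) :
    (D.graph.dist (l.toFun s) (l'.toFun s) : ℝ) ≤ δ₀ := by
  obtain ⟨M, hM⟩ := h _ _ l.tendsTo l'.tendsTo
  have h1 := hM M le_rfl M le_rfl
  have h2 := D.gp_base (.group 1) (l.toFun 0) (l.toFun M) (l'.toFun M)
  exact hthin.dist_ray_le h0 (m := M) (n := M) (by linarith)

end PeripheralGroup
end BlownUp

namespace BlownUp
universe u v w

namespace PeripheralGroup

variable {G : Type u} [Group G] {k : ℕ} [NeZero k] {D : PeripheralGroup G k}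

/-! ## Existence of the rays -/

variable (D) in
-- Left translation by `y` moves three fixed elements of different cosets of `P_0` to elements of
-- different cosets, at the same distance from `y` as from 1 before. Three are needed in order to
-- avoid two given horoballs.
theorem exists_near_cosets : ∃ A : ℕ, ∀ y : G, ∃ f : Fin 3 → ℕ, Function.Injective f ∧
    ∀ t, ∃ q : D.coset (f t), D.cayley.dist y q ≤ A := by
  let a : Fin 3 → G := fun t => D.g (t * k + (0 : Fin k))
  have ha : Function.Injective fun t => (QuotientGroup.mk (a t) : G ⧸ D.P 0) := fun s t h =>
    Fin.ext ((D.g_bijective 0).1 h)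
  refine ⟨Finset.univ.sup fun t => D.cayley.dist 1 (a t), fun y => ?_⟩
  choose f hf hf' using fun t => D.exists_index 0 (y * a t)
  refine ⟨f, fun s t hst => ha ?_, fun t => ⟨⟨_, hf' t⟩, ?_⟩⟩
  · have h1 := hf' s
    have h2 := hf' t
    rw [← hst] at h2
    rw [mem_coset_iff] at h1 h2
    have h3 := QuotientGroup.eq.1 (h1.symm.trans h2)
    rw [hf s] at h3
    refine QuotientGroup.eq.2 ?_
    simpa [mul_assoc] using h3
  · show D.cayley.dist y (y * a t) ≤ _
    have := D.cayley_dist_mul_left y 1 (a t)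
    rw [mul_one] at this
    rw [this]
    exact Finset.le_sup (f := fun t => D.cayley.dist 1 (a t)) (Finset.mem_univ t)

theorem exists_injective_ne {f : Fin 3 → ℕ} (hf : Function.Injective f) (i j : ℕ) :
    ∃ t, f t ≠ i ∧ f t ≠ j := by
  by_contra! h
  have h01 : f 0 ≠ f 1 := fun e => absurd (hf e) (by decide)
  have h02 : f 0 ≠ f 2 := fun e => absurd (hf e) (by decide)
  have h12 : f 1 ≠ f 2 := fun e => absurd (hf e) (by decide)
  have h0 := h 0
  have h1 := h 1
  have h2 := h 2
  by_cases a0 : f 0 = i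
  · have b1 := h1 (by omega)
    have b2 := h2 (by omega)
    omega
  · have b0 := h0 a0
    by_cases a1 : f 1 = i
    · have b2 := h2 (by omega)
      omega
    · have b1 := h1 a1
      omega

/-- Points at level `m` of two different horoballs are at least `2 * m` apart. -/
theorem gp_vert_le {i j : ℕ} (hij : i ≠ j) {x : D.Vertex} {p : D.coset i} {q : D.coset j} {A m : ℕ}
    (h : D.graph.dist (D.vert i p m) x + D.graph.dist (D.vert j q m) x ≤ 2 * m + 2 * A) :
    D.gromovProduct x (D.vert i p m) (D.vert j q m) ≤ A := by
  have h1 := D.depth_add_depth_le i j (D.vert i p m) (D.vert j q m)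
  rw [D.depth_vert, D.depth_vert, D.depth_vert_of_ne hij, D.depth_vert_of_ne hij.symm] at h1
  have h2 : (m : ℝ) + m ≤ D.graph.dist (D.vert i p m) (D.vert j q m) := by
    exact_mod_cast (by omega)
  have h3 : (D.graph.dist (D.vert i p m) x : ℝ) + D.graph.dist (D.vert j q m) x ≤
    2 * m + 2 * A := by exact_mod_cast h
  simp only [gromovProduct]
  linarith

variable (D) in
-- Viewed from `x`, two vertical directions outside the `i`-th horoball point away from each other.
-- If `x` is a group element, both lead into nearby horoballs; if `x` lies inside a horoball, one of
-- them goes straight up from `x`.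
theorem exists_diverging_cosets : ∃ A : ℕ, ∀ (i : ℕ) (x : D.Vertex), D.depth i x = 0 →
    ∃ (j j' : ℕ) (q : D.coset j) (q' : D.coset j') (M : ℕ), j ≠ i ∧ j' ≠ i ∧ ∀ m ≥ M,
      D.gromovProduct x (D.vert j q m) (D.vert j' q' m) ≤ A := by
  obtain ⟨A, hA⟩ := D.exists_near_cosets
  refine ⟨A, fun i x hx => ?_⟩
  have hvert : ∀ (y : G) (j : ℕ) (q : D.coset j) (m : ℕ), D.cayley.dist y q ≤ A →
      D.graph.dist (D.vert j q m) (.group y) ≤ m + A := by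
    intro y j q m h
    have h1 := D.dist_vert_vert_vertical j q (Nat.zero_le m)
    have h2 := D.graph_dist_group_le y q
    have h3 := D.dist_tri (.group y) (D.vert j q 0) (D.vert j q m)
    have h4 : D.graph.dist (.group y) (D.vert j q 0) ≤ A := h2.trans h
    rw [SimpleGraph.dist_comm]
    omega
  cases x with
  | group y =>
    obtain ⟨f, hf, hq⟩ := hA y
    obtain ⟨s, hs, -⟩ := exists_injective_ne hf i i
    obtain ⟨t, ht, hts⟩ := exists_injective_ne hf i (f s)
    obtain ⟨q, hq'⟩ := hq s
    obtain ⟨q', hq''⟩ := hq t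
    refine ⟨f s, f t, q, q', 0, hs, ht, fun m _ => gp_vert_le hts.symm ?_⟩
    have h1 := hvert y _ q m hq'
    have h2 := hvert y _ q' m hq''
    omega
  | horo j p l =>
    have hj : j ≠ i := fun h => by simp [depth, h] at hx
    obtain ⟨f, hf, hq⟩ := hA p
    obtain ⟨t, ht, htj⟩ := exists_injective_ne hf i j
    obtain ⟨q, hq'⟩ := hq t
    refine ⟨j, f t, p, q, l + 1, hj, ht, fun m hm => gp_vert_le htj.symm ?_⟩
    have h1 := hvert p _ q m hq'
    have h2 := D.dist_vert_vert_vertical j p hm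
    have h3 := D.dist_vert_vert_vertical j p (Nat.zero_le (l + 1))
    have h4 := D.dist_tri (D.vert (f t) q m) (.group p) (.horo j p l)
    have h5 : D.graph.dist (.group p) (.horo j p l) ≤ l + 1 := h3
    rw [SimpleGraph.dist_comm] at h2
    have h6 : D.graph.dist (D.vert j p m) (.horo j p l) ≤ m - (l + 1) := h2
    omega

theorem vert_leaves (j : ℕ) (q : D.coset j) (n : ℕ) :
    ∀ᶠ m in atTop, n ≤ D.graph.dist (D.vert j q m) (.group 1) := by
  filter_upwards [eventually_ge_atTop n] with m hm
  have := D.height_le_dist 1 (D.vert j q m)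
  have h2 := D.depth_le_height j (D.vert j q m)
  rw [D.depth_vert] at h2
  omega

/-- A small Gromov product at `x` means that `x` is near a geodesic from `e` to the deep points over
`q`. These tend to `s_j`, so the four-point inequality transfers the bound to far points of the ray,
at the cost of one `δ`. -/
theorem exists_ray_through {δ δ₀ : ℝ} (hδ : D.FourPoint δ) (hthin : D.HasThinTriangles δ₀)
    (e x : D.Vertex) {j : ℕ} {q : D.coset j} {C : ℝ}
    (h : ∃ᶠ m in atTop, D.gromovProduct x (D.vert j q m) e ≤ C) :
    ∃ l : D.Ray, l.toFun 0 = e ∧ D.endpoint l = D.parabolicPoint j ∧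
      ∃ t, (D.graph.dist x (l.toFun t) : ℝ) ≤ C + δ + δ₀ + 1 := by
  obtain ⟨l, h0, hl⟩ := exists_ray hthin e (D.parabolicPoint j)
  refine ⟨l, h0, hl, ?_⟩
  have h1 := (tendsto_bdry_iff hδ).1 (tendsto_parabolic hδ (i := j) (l := atTop)
    (x := fun m => D.vert j q m) (Eventually.of_forall fun m => D.inHoroball_vert j q m)
    (vert_leaves j q)) (C + δ + 1 + D.graph.dist (.group 1) x)
  obtain ⟨m, hm, hm'⟩ := (h.and_eventually h1).exists
  obtain ⟨n, hn⟩ := hm' _ _ (hl ▸ l.tendsTo) (tendsTo_const _)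
  have h2 := hn n le_rfl n le_rfl
  have h3 := D.gp_base (.group 1) x (l.toFun n) (D.vert j q m)
  have h4 : D.gromovProduct x (l.toFun n) e ≤ C + δ := by
    by_contra! hcon
    have h5 := hδ.min_le x (D.vert j q m) (l.toFun n) e
    rw [D.gp_comm x (D.vert j q m) (l.toFun n)] at h5
    have h6 : C + δ < min (D.gromovProduct x (l.toFun n) (D.vert j q m))
      (D.gromovProduct x (l.toFun n) e) := lt_min (by linarith) hcon
    linarith
  have hg0 := D.gp_nonneg e x (l.toFun n)
  -- Up to this time the ray is `δ₀`-close to a geodesic from `e` to `x`, and the rest of that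
  -- geodesic has length at most the product at `x` plus 1; the 1 comes from rounding.
  set t := ⌊D.gromovProduct e x (l.toFun n)⌋₊ with ht
  have ht1 : (t : ℝ) ≤ D.gromovProduct e x (l.toFun n) := Nat.floor_le hg0
  have ht2 := Nat.lt_floor_add_one (D.gromovProduct e x (l.toFun n))
  have ht3 : t ≤ D.graph.dist e x := by
    have := ht1.trans (D.gp_le _ _ _)
    rw [D.rdist_comm] at this
    exact_mod_cast this
  have ht4 : t ≤ n := by
    rw [D.gp_comm] at ht1
    have := ht1.trans (D.gp_le _ _ _)
    rw [D.rdist_comm, ← h0, l.dist_zero] at this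
    exact_mod_cast this
  obtain ⟨c, hc1, hc2⟩ := D.exists_between e x ht3
  refine ⟨t, ?_⟩
  have h5 : (D.graph.dist c (l.toFun t) : ℝ) ≤ δ₀ := by
    refine hthin e x (l.toFun n) _ _ ?_ ?_ ?_ ?_
    · rw [hc1, hc2]
    · rw [← h0, l.dist_zero, l.dist_zero, l.isGeodesic t n ht4]
      omega
    · rw [hc1, ← h0, l.dist_zero]
    · rw [hc1]
      exact ht1
  have h6 : (t : ℝ) + D.graph.dist c x = D.graph.dist e x := by exact_mod_cast hc2
  have h7 := D.rdist_tri x c (l.toFun t)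
  have h8 : D.gromovProduct e x (l.toFun n) + D.gromovProduct x (l.toFun n) e =
      D.graph.dist e x := by
    simp only [gromovProduct]
    rw [D.rdist_comm x e, D.rdist_comm x (l.toFun n)]
    ring
  rw [D.rdist_comm x c] at h7
  rw [← ht] at ht2
  linarith

/-- Points off a horoball are near rays which do not end at its parabolic point. -/
theorem exists_near_ray {δ δ₀ : ℝ} (hδ : D.FourPoint δ) (hthin : D.HasThinTriangles δ₀) :
    ∃ C : ℝ, ∀ (i : ℕ) (e x : D.Vertex), D.depth i x = 0 →
      ∃ l : D.Ray, l.toFun 0 = e ∧ D.endpoint l ≠ D.parabolicPoint i ∧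
        ∃ t, (D.graph.dist x (l.toFun t) : ℝ) ≤ C := by
  obtain ⟨A, hA⟩ := D.exists_diverging_cosets
  refine ⟨A + δ + δ + δ₀ + 1, fun i e x hx => ?_⟩
  obtain ⟨j, j', q, q', M, hj, hj', hM⟩ := hA i x hx
  -- The two directions diverge at `x`, so by the four-point inequality `e` cannot lie far along
  -- both of them.
  have key : (∃ᶠ m in atTop, D.gromovProduct x (D.vert j q m) e ≤ A + δ) ∨
      ∃ᶠ m in atTop, D.gromovProduct x (D.vert j' q' m) e ≤ A + δ := by
    rw [← frequently_or_distrib]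
    refine Eventually.frequently ?_
    filter_upwards [eventually_ge_atTop M] with m hm
    have h1 := hM m hm
    have h2 := hδ.min_le x (D.vert j q m) e (D.vert j' q' m)
    rw [D.gp_comm x e] at h2
    exact min_le_iff.1 (by linarith)
  rcases key with h | h
  · obtain ⟨l, h0, hl, t, ht⟩ := exists_ray_through hδ hthin e x h
    exact ⟨l, h0, hl ▸ D.parabolicPoint_ne hj, t, ht⟩
  · obtain ⟨l, h0, hl, t, ht⟩ := exists_ray_through hδ hthin e x h
    exact ⟨l, h0, hl ▸ D.parabolicPoint_ne hj', t, ht⟩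

theorem depth_le_real (i : ℕ) (a b : D.Vertex) :
    (D.depth i a : ℝ) ≤ D.depth i b + D.graph.dist a b := by exact_mod_cast D.depth_le i a b

theorem HasThinTriangles.nonneg {δ₀ : ℝ} (hthin : D.HasThinTriangles δ₀) : 0 ≤ δ₀ := by
  have h := hthin (.group 1) (.group 1) (.group 1) (.group 1) (.group 1) (by simp) (by simp) rfl
    (by simp [gromovProduct])
  simpa using h

/-- The point of the ray near `x` might be inside the horoball, so the time is moved forward to the
exit time if necessary. That point is shallow, being near `x`, so by `FourPoint.shallow_ray` the
shift is bounded unless it is near the apex. The latter leaves only finitely many `x`, for which a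
maximum is taken. -/
theorem nonempty_rayChoice {δ δ₀ : ℝ} (hδ : D.FourPoint δ) (hthin : D.HasThinTriangles δ₀)
    (N i : ℕ) : Nonempty (D.RayChoice N i) := by
  choose rayTo h0 hend using fun ω : D.Punctured i =>
    exists_ray hthin (D.vert i (D.cosetRep i) N) ω.1
  obtain ⟨C, hC⟩ := exists_near_ray hδ hthin
  set e := D.vert i (D.cosetRep i) N with he
  choose l hl0 hlend t ht using fun x : D.offHoroball i => hC i e x.1 x.2
  choose p hp using fun x => exists_isExit hδ hthin (hl0 x) (hlend x)
  let T : D.offHoroball i → ℕ := fun x => max (t x) (RayChoice.exitTime i (l x))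
  have hC0 : 0 ≤ C := (Nat.cast_nonneg _).trans (ht ⟨.group 1, rfl⟩)
  set B := 3 * C + 1 + 2 * δ with hB
  have hδ0 := hδ.nonneg
  have hB0 : 0 ≤ B := by positivity
  obtain ⟨r, hr⟩ := exists_nat_ge (B + C)
  have hfin : {x : D.offHoroball i | D.graph.dist e x.1 ≤ r}.Finite :=
    (D.finite_ball e r).preimage Subtype.val_injective.injOn
  obtain ⟨R, hR⟩ := (hfin.image fun x => D.graph.dist x.1 ((l x).toFun (T x))).bddAbove
  refine ⟨⟨rayTo, h0, hend, l, T, hl0, hlend, fun x => (hp x).depth_eq (le_max_right _ _),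
    max R r, fun x => ?_⟩⟩
  by_cases hx : D.graph.dist e x.1 ≤ r
  · exact (hR ⟨x, hx, rfl⟩).trans (le_max_left _ _)
  refine le_trans ?_ (le_max_right _ _)
  have hx' : (r : ℝ) < D.graph.dist e x.1 := by exact_mod_cast not_le.1 hx
  suffices h : (D.graph.dist x.1 ((l x).toFun (T x)) : ℝ) ≤ r by exact_mod_cast h
  rcases le_total (RayChoice.exitTime i (l x)) (t x) with h | h
  · rw [show T x = t x from max_eq_left h]
    linarith [ht x]
  · rw [show T x = _ from max_eq_right h]
    have hdep : (D.depth i ((l x).toFun (t x)) : ℝ) ≤ C := by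
      have h1 := depth_le_real i ((l x).toFun (t x)) x.1
      rw [show D.depth i x.1 = 0 from x.2, D.rdist_comm] at h1
      have := ht x
      push_cast at h1
      linarith
    have h2 := D.rdist_tri x.1 ((l x).toFun (t x)) ((l x).toFun (RayChoice.exitTime i (l x)))
    rw [(l x).dist_eq h] at h2
    rcases hδ.shallow_ray (hl0 x) hC0 h hdep (q := p x) (by rw [(hp x).eq]; simpa using hC0)
      with h1 | h1
    · linarith [ht x]
    · have h3 := D.rdist_tri e ((l x).toFun (t x)) x.1
      have h4 : D.graph.dist e ((l x).toFun (t x)) = t x := by rw [← hl0 x, (l x).dist_zero]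
      rw [h4, D.rdist_comm ((l x).toFun (t x)) x.1] at h3
      linarith [ht x]

/-! ## Coarse properties of the maps `L` and `F` -/

namespace RayChoice

variable {N i : ℕ} (c : D.RayChoice N i)

/-- The time at which the ray to `ω` leaves the horoball. -/
noncomputable def exit (ω : D.Punctured i) : ℕ := exitTime i (c.rayTo ω)

theorem isExit {δ δ₀ : ℝ} (hδ : D.FourPoint δ) (hthin : D.HasThinTriangles δ₀)
    (ω : D.Punctured i) : D.IsExit i (c.rayTo ω) (c.exit ω) (c.L ω) := by
  obtain ⟨p, hp⟩ := exists_isExit hδ hthin (c.rayTo_zero ω)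
    (by rw [c.rayTo_endpoint]; exact ω.2)
  have h : ∃ p : D.coset i, (c.rayTo ω).toFun (exitTime i (c.rayTo ω)) = .group p := ⟨p, hp.eq⟩
  have h1 : (c.rayTo ω).toFun (exitTime i (c.rayTo ω)) = .group (c.L ω) := by
    rw [L, dif_pos h]
    exact h.choose_spec
  exact ⟨h1, hp.notMem⟩

theorem dist_apex_L {δ δ₀ : ℝ} (hδ : D.FourPoint δ) (hthin : D.HasThinTriangles δ₀)
    (ω : D.Punctured i) : D.graph.dist (D.vert i (D.cosetRep i) N) (.group (c.L ω)) = c.exit ω := by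
  rw [← (c.isExit hδ hthin ω).eq, ← c.rayTo_zero ω, Ray.dist_zero]

/-- The map `L` is locally constant up to a uniform error. -/
theorem exists_L_local {δ δ₀ : ℝ} (hδ : D.FourPoint δ) (hthin : D.HasThinTriangles δ₀) :
    ∃ C : ℝ, ∀ ω : D.Punctured i, ∃ R : ℝ, ∀ ω' : D.Punctured i,
      D.Close R (.bdry ω.1) (.bdry ω'.1) →
      (D.graph.dist (.group (c.L ω')) (.group (c.L ω)) : ℝ) ≤ C := by
  refine ⟨δ₀ + (2 * (3 * δ₀ + 1 + 2 * δ) + 1), fun ω => ?_⟩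
  have hδ₀ := hthin.nonneg
  have hδ0 := hδ.nonneg
  set B := 3 * δ₀ + 1 + 2 * δ with hB
  have hB0 : 0 ≤ B := by positivity
  set T : ℝ := c.exit ω + 2 * B + 2 with hT
  refine ⟨T + D.graph.dist (.group 1) (D.vert i (D.cosetRep i) N), fun ω' hω => ?_⟩
  have hd : ∀ s : ℕ, s ≤ T →
      (D.graph.dist ((c.rayTo ω').toFun s) ((c.rayTo ω).toFun s) : ℝ) ≤ δ₀ := fun s hs => by
    rw [D.rdist_comm]
    refine Close.dist_ray_le hthin (by rw [c.rayTo_zero, c.rayTo_zero])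
      (by rw [c.rayTo_endpoint, c.rayTo_endpoint]; exact hω) ?_
    rw [c.rayTo_zero]
    linarith
  have he := c.isExit hδ hthin ω
  have he' := c.isExit hδ hthin ω'
  -- Let `s` be a time after the exit of `l^ω` and beyond `B`. If `l^ω'` were still to exit after
  -- `T`, it would be shallow at time `s`, since it follows `l^ω`; then it must exit by time `s +
  -- B`, which is less than `T`.
  have hn : (c.exit ω' : ℝ) ≤ T := by
    by_contra! hcon
    set s := max (c.exit ω) (⌊B⌋₊ + 1) with hs
    have hfl := Nat.floor_le hB0
    have hfl' := Nat.lt_floor_add_one B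
    have hn0 : (0 : ℝ) ≤ c.exit ω := Nat.cast_nonneg _
    have hsle : (s : ℝ) ≤ c.exit ω + B + 1 := by
      rw [hs, Nat.cast_max]
      refine max_le (by linarith) (by push_cast; linarith)
    have hsB : B < s := by
      rw [hs, Nat.cast_max]
      exact lt_max_of_lt_right (by push_cast; exact hfl')
    have hsn : s ≤ c.exit ω' := by
      have : (s : ℝ) ≤ c.exit ω' := by linarith
      exact_mod_cast this
    have hdep : (D.depth i ((c.rayTo ω').toFun s) : ℝ) ≤ δ₀ := by
      have h1 := depth_le_real i ((c.rayTo ω').toFun s) ((c.rayTo ω).toFun s)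
      rw [he.depth_eq (le_max_left _ _)] at h1
      have h2 := hd s (by linarith)
      push_cast at h1
      linarith
    rcases hδ.shallow_ray (c.rayTo_zero ω') hδ₀ hsn hdep (q := c.L ω')
      (by rw [he'.eq]; simpa using hδ₀) with h | h <;> linarith
  exact he'.dist_le hδ (c.rayTo_zero ω') (c.rayTo_zero ω) he hd hn (by rw [hT]; linarith)

/-- Points with bounded exit time stay away from the parabolic point. -/
theorem exists_not_close {δ δ₀ : ℝ} (hδ : D.FourPoint δ) (hthin : D.HasThinTriangles δ₀) (n : ℕ) :
    ∃ R : ℝ, ∀ ω : D.Punctured i, c.exit ω ≤ n →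
      ¬ D.Close R (.bdry (D.parabolicPoint i)) (.bdry ω.1) := by
  obtain ⟨m, hm⟩ := exists_nat_gt δ₀
  refine ⟨((max n m : ℕ) : ℝ) + D.graph.dist (.group 1) (D.vert i (D.cosetRep i) N),
    fun ω hω hc => ?_⟩
  -- The vertical ray from the apex has depth greater than `δ₀` at time `max n m`, while `l^ω` has
  -- already left the horoball, so the two cannot fellow travel that long.
  let v : D.Ray := ⟨fun t => D.vert i (D.cosetRep i) (N + t), fun a b hab => by
    have := (D.verticalRay i).isGeodesic (N + a) (N + b) (by omega)
    show D.graph.dist ((D.verticalRay i).toFun (N + a)) ((D.verticalRay i).toFun (N + b)) = _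
    omega⟩
  have hv0 : v.toFun 0 = D.vert i (D.cosetRep i) N := rfl
  have hv : D.endpoint v = D.parabolicPoint i :=
    endpoint_eq_parabolicPoint hδ hthin
      (Eventually.of_forall fun t => D.inHoroball_vert _ _ _).frequently
  have h1 := Close.dist_ray_le hthin (l := v) (l' := c.rayTo ω) (s := max n m)
    (by rw [hv0, c.rayTo_zero]) (by rw [hv, c.rayTo_endpoint]; exact hc) (by rw [hv0])
  have h2 := depth_le_real i (v.toFun (max n m)) ((c.rayTo ω).toFun (max n m))
  rw [(c.isExit hδ hthin ω).depth_eq (hω.trans (le_max_left _ _))] at h2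
  have h3 : D.depth i (v.toFun (max n m)) = N + max n m := D.depth_vert _ _ _
  rw [h3] at h2
  have h4 : (m : ℝ) ≤ (max n m : ℕ) := by exact_mod_cast le_max_right n m
  push_cast at h2 h4
  have h5 : (0 : ℝ) ≤ N := Nat.cast_nonneg N
  linarith

/-- The ray to `F x` passes near `x`. -/
theorem exists_dist_rayTo {δ δ₀ : ℝ} (hδ : D.FourPoint δ) (hthin : D.HasThinTriangles δ₀) :
    ∃ K : ℝ, 0 ≤ K ∧ ∀ x : D.offHoroball i,
      (D.graph.dist x.1 ((c.rayTo (c.F x)).toFun (c.time x)) : ℝ) ≤ K := by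
  obtain ⟨R, hR⟩ := c.rayNear_dist
  refine ⟨R + δ₀, add_nonneg (Nat.cast_nonneg R) hthin.nonneg, fun x => ?_⟩
  have h1 := D.rdist_tri x.1 ((c.rayNear x).toFun (c.time x))
    ((c.rayTo (c.F x)).toFun (c.time x))
  have h2 := dist_ray_le_of_endpoint_eq hδ hthin (l := c.rayNear x) (l' := c.rayTo (c.F x))
    (by rw [c.rayNear_zero, c.rayTo_zero]) (by rw [c.rayTo_endpoint]; rfl) (c.time x)
  have h3 : (D.graph.dist x.1 ((c.rayNear x).toFun (c.time x)) : ℝ) ≤ R := by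
    exact_mod_cast hR x
  linarith

/-- The ray to `F x` passes near `x`. The Gromov product of `F x` and `x` therefore grows with `x`,
and both have the same limit at infinity. -/
theorem close_F {δ δ₀ : ℝ} (hδ : D.FourPoint δ) (hthin : D.HasThinTriangles δ₀) :
    ∃ C : ℝ, ∀ x : D.offHoroball i,
      D.Close (D.graph.dist x.1 (.group 1) - C) (.bdry (c.F x).1) (.vertex x.1) := by
  obtain ⟨K, hK0, hK⟩ := c.exists_dist_rayTo hδ hthin
  set e := D.vert i (D.cosetRep i) N with he
  refine ⟨2 * K + 2 * D.graph.dist (.group 1) e + 2 * δ, fun x => ?_⟩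
  set l := c.rayTo (c.F x) with hl
  have hl0 : l.toFun 0 = e := c.rayTo_zero _
  have hlF : D.endpoint l = (c.F x).1 := c.rayTo_endpoint _
  rw [← hlF]
  refine EvGe.frGe (R := D.graph.dist x.1 (.group 1) - (2 * K + 2 * D.graph.dist (.group 1) e))
    ⟨c.time x, fun m hm _ _ => ?_⟩ |>.close hδ l.tendsTo (tendsTo_const _) |>.mono (by linarith)
  have h1 := l.gp_zero hm
  rw [hl0, D.gp_comm] at h1
  have h2 := D.gp_move e (l.toFun m) (l.toFun (c.time x)) x.1
  have h3 := hK x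
  have h4 := D.gp_base e (.group 1) (l.toFun m) x.1
  have h5 := D.rdist_tri e (l.toFun (c.time x)) x.1
  rw [← hl] at h3
  rw [D.rdist_comm] at h3
  have h6 : D.graph.dist e (l.toFun (c.time x)) = c.time x := by rw [← hl0, l.dist_zero]
  rw [← hl0, l.dist_zero] at h5
  rw [hl0] at h5
  have h7 := D.rdist_tri x.1 e (.group 1)
  rw [D.rdist_comm x.1 e] at h7
  rw [D.rdist_comm e (.group 1)] at h4 h7
  linarith

/-- Before its exit the ray is shallow at time `t_x`, being near a point of `X^i`. Hence either the
exit follows soon or `x` is near the apex. -/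
theorem time_or {δ δ₀ : ℝ} (hδ : D.FourPoint δ) (hthin : D.HasThinTriangles δ₀) :
    ∃ C : ℝ, 0 ≤ C ∧ ∀ x : D.offHoroball i, (c.exit (c.F x) : ℝ) ≤ c.time x + C ∨
      (D.graph.dist (D.vert i (D.cosetRep i) N) x.1 : ℝ) ≤ C := by
  obtain ⟨K, hK0, hK⟩ := c.exists_dist_rayTo hδ hthin
  have hδ0 := hδ.nonneg
  refine ⟨3 * K + 1 + 2 * δ + K, by positivity, fun x => ?_⟩
  have he := c.isExit hδ hthin (c.F x)
  have h0 := c.rayTo_zero (c.F x)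
  rcases le_total (c.exit (c.F x)) (c.time x) with h | h
  · left
    have : (c.exit (c.F x) : ℝ) ≤ c.time x := by exact_mod_cast h
    have : 0 ≤ 3 * K + 1 + 2 * δ + K := by positivity
    linarith
  have hdep : (D.depth i ((c.rayTo (c.F x)).toFun (c.time x)) : ℝ) ≤ K := by
    have h1 := depth_le_real i ((c.rayTo (c.F x)).toFun (c.time x)) x.1
    rw [show D.depth i x.1 = 0 from x.2, D.rdist_comm] at h1
    have := hK x
    push_cast at h1
    linarith
  rcases hδ.shallow_ray h0 hK0 h hdep (q := c.L (c.F x)) (by rw [he.eq]; simpa using hK0)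
    with h1 | h1
  · left
    linarith
  · right
    have h2 := D.rdist_tri (D.vert i (D.cosetRep i) N) ((c.rayTo (c.F x)).toFun (c.time x)) x.1
    rw [D.rdist_comm ((c.rayTo (c.F x)).toFun (c.time x)) x.1, ← h0, Ray.dist_zero] at h2
    rw [← h0]
    linarith [hK x]

/-- The map `L ∘ F` is bornologous. -/
theorem exists_LF_dist_le {δ δ₀ : ℝ} (hδ : D.FourPoint δ) (hthin : D.HasThinTriangles δ₀)
    (R : ℕ) : ∃ C : ℝ, ∀ x y : D.offHoroball i, D.graph.dist x.1 y.1 ≤ R →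
      (D.graph.dist (.group (c.L (c.F x))) (.group (c.L (c.F y))) : ℝ) ≤ C := by
  obtain ⟨K, hK0, hK⟩ := c.exists_dist_rayTo hδ hthin
  obtain ⟨B, hB0, hB⟩ := c.time_or hδ hthin
  set e := D.vert i (D.cosetRep i) N with he
  obtain ⟨r, hr⟩ := exists_nat_ge (B + R)
  have hfin : {x : D.offHoroball i | D.graph.dist e x.1 ≤ r}.Finite :=
    (D.finite_ball e r).preimage Subtype.val_injective.injOn
  -- Pairs with a point near the apex are finite in number and are bounded by a maximum.
  obtain ⟨C', hC'⟩ := ((hfin.prod hfin).image fun z =>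
    (D.graph.dist (.group (c.L (c.F z.1))) (.group (c.L (c.F z.2))) : ℝ)).bddAbove
  set K1 : ℝ := R + 2 * K with hK1
  set K2 : ℝ := δ₀ + 2 * (2 * K1) + 2 * (K1 + B) with hK2
  have hR0 : (0 : ℝ) ≤ R := Nat.cast_nonneg R
  refine ⟨max C' (K2 + (2 * (3 * K2 + 1 + 2 * δ) + 1)), fun x y hxy => ?_⟩
  have hxy' : (D.graph.dist x.1 y.1 : ℝ) ≤ R := by exact_mod_cast hxy
  have hsmall : (D.graph.dist e x.1 : ℝ) ≤ B ∨ (D.graph.dist e y.1 : ℝ) ≤ B →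
      D.graph.dist e x.1 ≤ r ∧ D.graph.dist e y.1 ≤ r := by
    intro h
    have h1 := D.rdist_tri e x.1 y.1
    have h2 := D.rdist_tri e y.1 x.1
    rw [D.rdist_comm y.1] at h2
    have : (D.graph.dist e x.1 : ℝ) ≤ r ∧ (D.graph.dist e y.1 : ℝ) ≤ r := by
      rcases h with h | h <;> constructor <;> linarith
    exact_mod_cast this
  by_cases hs : (D.graph.dist e x.1 : ℝ) ≤ B ∨ (D.graph.dist e y.1 : ℝ) ≤ B
  · exact (hC' ⟨(x, y), hsmall hs, rfl⟩).trans (le_max_left _ _)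
  rw [not_or] at hs
  have hx := (hB x).resolve_right hs.1
  have hy := (hB y).resolve_right hs.2
  refine le_trans ?_ (le_max_right _ _)
  set l := c.rayTo (c.F x) with hl
  set l' := c.rayTo (c.F y) with hl'
  have hl0 : l.toFun 0 = e := c.rayTo_zero _
  have hl0' : l'.toFun 0 = e := c.rayTo_zero _
  have h1 : (D.graph.dist (l.toFun (c.time x)) (l'.toFun (c.time y)) : ℝ) ≤ K1 := by
    have a1 := D.rdist_tri (l.toFun (c.time x)) x.1 (l'.toFun (c.time y))
    have a2 := D.rdist_tri x.1 y.1 (l'.toFun (c.time y))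
    have a3 := hK x
    have a4 := hK y
    rw [← hl] at a3
    rw [← hl'] at a4
    rw [D.rdist_comm _ x.1] at a1
    linarith
  have h2 : |(c.time x : ℝ) - c.time y| ≤ K1 := by
    have a1 := D.rdist_tri e (l.toFun (c.time x)) (l'.toFun (c.time y))
    have a2 := D.rdist_tri e (l'.toFun (c.time y)) (l.toFun (c.time x))
    have a3 : D.graph.dist e (l.toFun (c.time x)) = c.time x := by rw [← hl0, l.dist_zero]
    have a4 : D.graph.dist e (l'.toFun (c.time y)) = c.time y := by rw [← hl0', l'.dist_zero]
    rw [a3, a4] at a1 a2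
    rw [D.rdist_comm (l'.toFun _)] at a2
    rw [abs_le]
    constructor <;> linarith
  have h3 : (D.graph.dist (l.toFun (c.time x)) (l'.toFun (c.time x)) : ℝ) ≤ 2 * K1 := by
    have a1 := D.rdist_tri (l.toFun (c.time x)) (l'.toFun (c.time y)) (l'.toFun (c.time x))
    have a2 : (D.graph.dist (l'.toFun (c.time y)) (l'.toFun (c.time x)) : ℝ) ≤ K1 := by
      rw [abs_le] at h2
      rcases le_total (c.time x) (c.time y) with h | h
      · rw [D.rdist_comm, l'.dist_eq h]
        linarith
      · rw [l'.dist_eq h]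
        linarith
    linarith
  rw [abs_le] at h2
  have hK10 : 0 ≤ K1 := by positivity
  -- Both rays have left the horoball by time `t_x + K1 + B`, because `t_x` and `t_y` differ by at
  -- most `K1`; they fellow travel until then.
  refine (c.isExit hδ hthin (c.F x)).dist_le hδ hl0 hl0' (c.isExit hδ hthin (c.F y))
    (T := c.time x + (K1 + B)) (fun s hs => ?_) (by linarith) (by linarith)
  exact hthin.fellow hthin.nonneg (hl0.trans hl0'.symm) (by positivity) h3 hs

/-- The map `L ∘ F` is close to the identity on the coset. -/
theorem exists_LF_coset {δ δ₀ : ℝ} (hδ : D.FourPoint δ) (hthin : D.HasThinTriangles δ₀) :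
    ∃ C : ℝ, ∀ p : D.coset i,
      (D.graph.dist (.group (c.L (c.F ⟨.group p, rfl⟩))) (.group p) : ℝ) ≤ C := by
  obtain ⟨K, hK0, hK⟩ := c.exists_dist_rayTo hδ hthin
  obtain ⟨B, hB0, hB⟩ := c.time_or hδ hthin
  set e := D.vert i (D.cosetRep i) N with he
  obtain ⟨r, hr⟩ := exists_nat_ge B
  let x : D.coset i → D.offHoroball i := fun p => ⟨.group p, rfl⟩
  have hfin : {p : D.coset i | D.graph.dist e (.group p) ≤ r}.Finite :=
    (D.finite_ball e r).preimage (f := fun p : D.coset i => Vertex.group p.1)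
      (fun p _ q _ h => by injection h with h; exact Subtype.ext h)
  obtain ⟨C', hC'⟩ := (hfin.image fun p =>
    (D.graph.dist (.group (c.L (c.F (x p)))) (.group p) : ℝ)).bddAbove
  have hδ0 := hδ.nonneg
  set C1 := 2 * (3 * K + 1 + 2 * δ) + 1 with hC1
  refine ⟨max C' (C1 + B + K), fun p => ?_⟩
  by_cases hs : (D.graph.dist e (.group p) : ℝ) ≤ B
  · have : (D.graph.dist e (.group p) : ℝ) ≤ r := hs.trans hr
    exact (hC' ⟨p, by exact_mod_cast this, rfl⟩).trans (le_max_left _ _)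
  have hx := (hB (x p)).resolve_right hs
  refine le_trans ?_ (le_max_right _ _)
  show (D.graph.dist (.group (c.L (c.F (x p)))) (.group p) : ℝ) ≤ C1 + B + K
  have hexit := c.isExit hδ hthin (c.F (x p))
  have hd : (D.graph.dist (.group p) ((c.rayTo (c.F (x p))).toFun (c.time (x p))) : ℝ) ≤ K :=
    hK (x p)
  have hl0 := c.rayTo_zero (c.F (x p))
  set l := c.rayTo (c.F (x p)) with hl
  have h1 := D.rdist_tri (.group (c.L (c.F (x p)))) (l.toFun (c.time (x p))) (.group p)
  rw [D.rdist_comm _ (.group p)] at h1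
  rw [← hexit.eq] at h1 ⊢
  have hC10 : 0 ≤ C1 := by positivity
  rw [D.rdist_comm (.group p)] at h1
  rw [D.rdist_comm] at hd
  -- If the exit comes first, `FourPoint.no_return` bounds the delay until the ray is near `p`;
  -- otherwise `time_or` does.
  rcases le_total (c.exit (c.F (x p))) (c.time (x p)) with h | h
  · have h2 := hδ.no_return hl0 hK0 h (fun s hs _ => by rw [hexit.depth_eq hs]; simpa using hK0) hd
    rw [l.dist_eq h] at h1
    linarith
  · rw [D.rdist_comm (l.toFun (c.exit _)) (l.toFun (c.time _)), l.dist_eq h] at h1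
    linarith

end RayChoice

end PeripheralGroup
end BlownUp

namespace BlownUp
universe u v w

theorem CoarseStructure.isBdd_pullback {X : Type u} {Y : Type v} {f : X → Y}
    {E : CoarseStructure Y} {B : Set X} : (E.pullback f).IsBdd B ↔ E.IsBdd (f '' B) := by
  show Prod.map f f '' (B ×ˢ B) ∈ E.controlled ↔ _
  rw [Set.prodMap_image_prod]
  rfl

theorem CoarseStructure.finite_of_isBdd_pullback {X : Type u} {Y : Type v} {f : X → Y}
    (hf : Function.Injective f) {E : CoarseStructure Y} (hE : ∀ B, E.IsBdd B → B.Finite)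
    {B : Set X} (hB : (E.pullback f).IsBdd B) : B.Finite :=
  (hE _ (isBdd_pullback.1 hB)).of_finite_image hf.injOn

namespace PeripheralGroup
variable {G : Type u} [Group G] {k : ℕ} [NeZero k] {D : PeripheralGroup G k}

theorem mem_pullback_augCoarse {X : Type v} {f : X → D.Vertex} {A : Set (X × X)} :
    A ∈ (D.augCoarse.pullback f).controlled ↔
      ∃ R : ℕ, ∀ z ∈ A, D.graph.dist (f z.1) (f z.2) ≤ R := by
  refine exists_congr fun R => ⟨fun h z hz => h _ ⟨z, hz, rfl⟩, ?_⟩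
  rintro h _ ⟨z, hz, rfl⟩
  exact h z hz

theorem mem_pullback_groupCoarse {X : Type v} {f : X → G} {A : Set (X × X)} :
    A ∈ (D.groupCoarse.pullback f).controlled ↔
      ∃ R : ℕ, ∀ z ∈ A, D.cayley.dist (f z.1) (f z.2) ≤ R := by
  refine exists_congr fun R => ⟨fun h z hz => h _ ⟨z, hz, rfl⟩, ?_⟩
  rintro h _ ⟨z, hz, rfl⟩
  exact h z hz

theorem finite_of_isBdd_augCoarse {B : Set D.Vertex} (hB : D.augCoarse.IsBdd B) : B.Finite := by
  obtain ⟨R, hR⟩ := hB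
  rcases B.eq_empty_or_nonempty with rfl | ⟨b, hb⟩
  · exact Set.finite_empty
  · exact (D.finite_ball b R).subset fun x hx => hR (b, x) ⟨hb, hx⟩

theorem finite_of_isBdd_groupCoarse {B : Set G} (hB : D.groupCoarse.IsBdd B) : B.Finite := by
  obtain ⟨R, hR⟩ := hB
  rcases B.eq_empty_or_nonempty with rfl | ⟨b, hb⟩
  · exact Set.finite_empty
  · exact (D.finite_cayley_ball b R).subset fun x hx => hR (b, x) ⟨hb, hx⟩

variable (D) in
theorem isProperCoarse_levelCoarse (n : ℕ) : IsProperCoarse (D.levelCoarse n) :=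
  isProperCoarse_of_finite fun _ =>
    CoarseStructure.finite_of_isBdd_pullback Subtype.val_injective
      fun _ => finite_of_isBdd_augCoarse

variable (D) in
theorem isProperCoarse_groupCoarse [TopologicalSpace G] [DiscreteTopology G] :
    IsProperCoarse D.groupCoarse :=
  isProperCoarse_of_finite fun _ => finite_of_isBdd_groupCoarse

variable (D) in
theorem isProperCoarse_peripheralCoarse [TopologicalSpace G] [DiscreteTopology G] (r : Fin k) :
    IsProperCoarse (D.peripheralCoarse r) :=
  isProperCoarse_of_finite fun _ =>
    CoarseStructure.finite_of_isBdd_pullback Subtype.val_injective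
      fun _ => finite_of_isBdd_groupCoarse

instance : Countable D.Vertex := by
  rw [← Set.countable_univ_iff]
  refine (Set.countable_iUnion fun n => (D.finite_ball (.group 1) n).countable).mono fun x _ =>
    Set.mem_iUnion.2 ⟨D.graph.dist (.group 1) x, le_refl (D.graph.dist (.group 1) x)⟩

theorem countable_group (D : PeripheralGroup G k) : Countable G :=
  Function.Injective.countable (f := fun x : G => (Vertex.group x : D.Vertex))
    fun _ _ h => Vertex.group.inj h

/-! ## Convergence to boundary points -/

theorem isInducing_bdry : IsInducing (Bordification.bdry : D.Boundary → D.Bordification) := ⟨rfl⟩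

theorem isClosedEmbedding_bdry :
    IsClosedEmbedding (Bordification.bdry : D.Boundary → D.Bordification) := by
  refine ⟨⟨isInducing_bdry, fun _ _ h => Bordification.bdry.inj h⟩, ?_⟩
  have : Set.range (Bordification.bdry : D.Boundary → D.Bordification) =
      (⋃ v : D.Vertex, {Bordification.vertex v})ᶜ := by
    ext a
    rcases a with v | ω <;> simp
  rw [this, isClosed_compl_iff]
  exact isOpen_iUnion fun v => isOpen_vertex v

theorem metrizableSpace_boundary {δ δ₀ : ℝ} (hδ : D.FourPoint δ) (hthin : D.HasThinTriangles δ₀) :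
    TopologicalSpace.MetrizableSpace D.Boundary :=
  have := metrizableSpace_bordification hδ hthin
  isClosedEmbedding_bdry.isEmbedding.metrizableSpace

theorem compactSpace_boundary {δ δ₀ : ℝ} (hδ : D.FourPoint δ) (hthin : D.HasThinTriangles δ₀) :
    CompactSpace D.Boundary :=
  have := compactSpace_bordification hδ hthin
  isClosedEmbedding_bdry.compactSpace

theorem secondCountableTopology_of_metrizable (X : Type*) [TopologicalSpace X] [CompactSpace X]
    [TopologicalSpace.MetrizableSpace X] : SecondCountableTopology X := by
  let _ := TopologicalSpace.metrizableSpaceMetric X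
  infer_instance

theorem tendsto_boundary_iff {δ : ℝ} (hδ : D.FourPoint δ) {ω : D.Boundary} {ι : Type*}
    {l : Filter ι} {z : ι → D.Boundary} : Tendsto z l (𝓝 ω) ↔
      ∀ R : ℝ, ∀ᶠ i in l, D.Close R (.bdry ω) (.bdry (z i)) :=
  (isInducing_bdry.tendsto_nhds_iff).trans (tendsto_bdry_iff hδ)

theorem tendsto_of_close {δ : ℝ} (hδ : D.FourPoint δ) {ω : D.Boundary} {ι : Type*}
    {l : Filter ι} {a b : ι → D.Bordification} (ha : Tendsto a l (𝓝 (.bdry ω)))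
    (h : ∀ R : ℝ, ∀ᶠ i in l, D.Close R (a i) (b i)) : Tendsto b l (𝓝 (.bdry ω)) := by
  rw [tendsto_bdry_iff hδ] at ha ⊢
  intro R
  filter_upwards [ha (R + δ), h (R + δ)] with i h1 h2
  simpa using h1.trans hδ h2

/-- The Gromov product of `x i` and `y i` is at least the distance of `x i` to the identity minus
`R`. -/
theorem tendsto_vertex_of_dist_le {δ : ℝ} (hδ : D.FourPoint δ) {ω : D.Boundary} {ι : Type*}
    {l : Filter ι} {x y : ι → D.Vertex} {R : ℕ} (h : ∀ᶠ i in l, D.graph.dist (x i) (y i) ≤ R)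
    (hinf : ∀ n : ℕ, ∀ᶠ i in l, n ≤ D.graph.dist (x i) (.group 1))
    (hx : Tendsto (fun i => Bordification.vertex (x i)) l (𝓝 (.bdry ω))) :
    Tendsto (fun i => Bordification.vertex (y i)) l (𝓝 (.bdry ω)) := by
  refine tendsto_of_close hδ hx fun R' => ?_
  obtain ⟨n, hn⟩ := exists_nat_ge (R' + R)
  filter_upwards [h, hinf n] with i h1 h2
  rw [close_vertex_iff]
  have h3 := D.gp_move (.group 1) (x i) (x i) (y i)
  rw [D.gp_self] at h3
  have h1' : (D.graph.dist (x i) (y i) : ℝ) ≤ R := by exact_mod_cast h1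
  have h2' : (n : ℝ) ≤ D.graph.dist (x i) (.group 1) := by exact_mod_cast h2
  linarith [D.rdist_comm (x i) (y i)]

theorem exists_bdry_of_leaves {ι : Type*} {l : Filter ι} [l.NeBot] {x : ι → D.Vertex}
    {a : D.Bordification} (hinf : ∀ n : ℕ, ∀ᶠ i in l, n ≤ D.graph.dist (x i) (.group 1))
    (hx : Tendsto (fun i => Bordification.vertex (x i)) l (𝓝 a)) : ∃ ω, a = .bdry ω := by
  rcases a with v | ω
  · obtain ⟨i, h1, h2⟩ := ((hx.eventually ((isOpen_vertex v).mem_nhds rfl)).and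
      (hinf (D.graph.dist v (.group 1) + 1))).exists
    rw [Bordification.vertex.inj h1] at h2
    omega
  · exact ⟨ω, rfl⟩

/-- A family in a subset of the augmented space that leaves the bounded sets tends to infinity. -/
theorem eventually_le_dist {s : Set D.Vertex} {ι : Type*} {l : Filter ι} {x : ι → s}
    (h : ∀ B, (D.augCoarse.pullback (Subtype.val : s → D.Vertex)).IsBdd B → ∀ᶠ i in l, x i ∉ B)
    (n : ℕ) : ∀ᶠ i in l, n ≤ D.graph.dist (x i).1 (.group 1) := by
  filter_upwards [h _ (CoarseStructure.isBdd_finite _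
    ((D.finite_ball (.group 1) n).preimage Subtype.val_injective.injOn))] with i hi
  have : ¬ D.graph.dist (.group 1) (x i).1 ≤ n := hi
  rw [SimpleGraph.dist_comm]
  omega

variable (D) in
theorem eventually_le_dist_augCoarse {ι : Type*} {l : Filter ι} {x : ι → D.Vertex}
    (h : ∀ B, D.augCoarse.IsBdd B → ∀ᶠ i in l, x i ∉ B)
    (n : ℕ) : ∀ᶠ i in l, n ≤ D.graph.dist (x i) (.group 1) := by
  filter_upwards [h _ (CoarseStructure.isBdd_finite _ (D.finite_ball (.group 1) n))] with i hi
  have : ¬ D.graph.dist (.group 1) (x i) ≤ n := hi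
  rw [SimpleGraph.dist_comm]
  omega

theorem isHigsonExtension_alpha {δ δ₀ : ℝ} (hδ : D.FourPoint δ) (hthin : D.HasThinTriangles δ₀) :
    IsHigsonExtension D.augCoarse Bordification.vertex D.alpha := by
  have := metrizableSpace_bordification hδ hthin
  have := compactSpace_bordification hδ hthin
  refine isHigsonExtension_of_asymptotic continuous_of_discreteTopology fun U a b hU ha hb => ?_
  have hinf := D.eventually_le_dist_augCoarse hU.left
  obtain ⟨ω, rfl⟩ := exists_bdry_of_leaves hinf ha
  obtain ⟨A, ⟨R, hR⟩, hA⟩ := hU.controlled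
  exact tendsto_nhds_unique (tendsto_vertex_of_dist_le hδ (hA.mono fun z hz => hR _ hz) hinf ha) hb

/-! ## The coarse space `∂X ∖ {s_i}` -/

namespace RayChoice
variable {N i : ℕ} (c : D.RayChoice N i) {δ δ₀ : ℝ}

theorem exists_exit_le (hδ : D.FourPoint δ) (hthin : D.HasThinTriangles δ₀)
    {B : Set (D.Punctured i)} (hB : c.puncturedCoarse.IsBdd B) : ∃ n, ∀ ω ∈ B, c.exit ω ≤ n := by
  obtain ⟨R, hR⟩ := mem_pullback_groupCoarse.1 hB
  rcases B.eq_empty_or_nonempty with rfl | ⟨b, hb⟩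
  · exact ⟨0, by simp⟩
  · refine ⟨c.exit b + R, fun ω hω => ?_⟩
    have h1 := D.dist_tri (D.vert i (D.cosetRep i) N) (.group (c.L b)) (.group (c.L ω))
    rw [c.dist_apex_L hδ hthin, c.dist_apex_L hδ hthin] at h1
    have h2 := D.graph_dist_group_le (c.L b : G) (c.L ω)
    have h3 := hR (b, ω) ⟨hb, hω⟩
    dsimp only at h3
    omega

theorem exists_eventually_L (hδ : D.FourPoint δ) (hthin : D.HasThinTriangles δ₀) :
    ∃ m : ℕ, ∀ ω : D.Punctured i, ∀ᶠ ω' in 𝓝 ω, D.cayley.dist (c.L ω' : G) (c.L ω) ≤ m := by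
  obtain ⟨C, hC⟩ := c.exists_L_local hδ hthin
  obtain ⟨n, hn⟩ := exists_nat_ge C
  refine ⟨2 ^ n, fun ω => ?_⟩
  obtain ⟨R, hR⟩ := hC ω
  have h : Tendsto (Subtype.val : D.Punctured i → D.Boundary) (𝓝 ω) (𝓝 ω.1) :=
    continuous_subtype_val.continuousAt
  filter_upwards [(tendsto_boundary_iff hδ).1 h R] with ω' hω'
  refine (D.cayley_dist_le _ _).trans (Nat.pow_le_pow_right two_pos ?_)
  exact_mod_cast (hR ω' hω').trans hn

theorem controlled_L (m : ℕ) : {z : D.Punctured i × D.Punctured i |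
    D.cayley.dist (c.L z.1 : G) (c.L z.2) ≤ m} ∈ c.puncturedCoarse.controlled :=
  mem_pullback_groupCoarse.2 ⟨m, fun _ hz => hz⟩

/-- On a bounded set the exit times are bounded, so the set stays away from `s_i` and has compact
closure in `P̂_i`. Conversely, `L` is locally constant up to a uniform error, so compact sets are
covered by finitely many bounded ones. -/
theorem isProperCoarse (hδ : D.FourPoint δ) (hthin : D.HasThinTriangles δ₀) :
    IsProperCoarse c.puncturedCoarse := by
  have := metrizableSpace_boundary hδ hthin
  have := compactSpace_boundary hδ hthin
  refine ⟨fun B hB => ?_, fun K hK => ?_⟩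
  · obtain ⟨n, hn⟩ := c.exists_exit_le hδ hthin hB
    obtain ⟨R, hR⟩ := c.exists_not_close hδ hthin n
    have hV : ∀ᶠ ω in 𝓝 (D.parabolicPoint i),
        D.Close R (.bdry (D.parabolicPoint i)) (.bdry ω) :=
      (tendsto_boundary_iff hδ).1 tendsto_id R
    obtain ⟨V, hV1, hV2, hV3⟩ := eventually_nhds_iff.1 hV
    have hK : IsCompact ((Subtype.val : D.Punctured i → D.Boundary) ⁻¹' Vᶜ) := by
      rw [(IsEmbedding.subtypeVal
        (p := fun ω => ω ≠ D.parabolicPoint i)).isInducing.isCompact_preimage_iff]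
      · exact hV2.isClosed_compl.isCompact
      · intro ω hω
        exact ⟨⟨ω, fun h => hω (h ▸ hV3)⟩, rfl⟩
    refine hK.of_isClosed_subset isClosed_closure (closure_minimal ?_
      (hV2.isClosed_compl.preimage continuous_subtype_val))
    exact fun ω hω h => hR ω (hn ω hω) (hV1 _ h)
  · obtain ⟨m, hm⟩ := c.exists_eventually_L hδ hthin
    refine hK.induction_on (p := c.puncturedCoarse.IsBdd) (CoarseStructure.isBdd_empty _)
      (fun s t hst ht => ht.mono hst) (fun s t hs ht => hs.union ht) fun ω _ => ?_
    refine ⟨_, mem_nhdsWithin_of_mem_nhds (hm ω), mem_pullback_groupCoarse.2 ⟨m + m, ?_⟩⟩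
    rintro ⟨ω₁, ω₂⟩ ⟨h1, h2⟩
    have h1' : D.cayley.dist (c.L ω₁ : G) (c.L ω) ≤ m := h1
    have h2' : D.cayley.dist (c.L ω₂ : G) (c.L ω) ≤ m := h2
    have h3 := D.cayley_tri (c.L ω₁ : G) (c.L ω) (c.L ω₂)
    rw [D.cayley.dist_comm (u := (c.L ω : G))] at h3
    dsimp only
    omega

theorem locallyCompactSpace_punctured (hδ : D.FourPoint δ) (hthin : D.HasThinTriangles δ₀)
    (i : ℕ) : LocallyCompactSpace (D.Punctured i) := by
  have := metrizableSpace_boundary hδ hthin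
  have := compactSpace_boundary hδ hthin
  exact (isOpen_ne (x := D.parabolicPoint i)).locallyCompactSpace

theorem metrizableSpace_punctured (hδ : D.FourPoint δ) (hthin : D.HasThinTriangles δ₀)
    (i : ℕ) : TopologicalSpace.MetrizableSpace (D.Punctured i) := by
  have := metrizableSpace_boundary hδ hthin
  exact (IsEmbedding.subtypeVal (p := fun ω => ω ≠ D.parabolicPoint i)).metrizableSpace

theorem secondCountableTopology_punctured (hδ : D.FourPoint δ) (hthin : D.HasThinTriangles δ₀)
    (i : ℕ) : SecondCountableTopology (D.Punctured i) := by
  have := metrizableSpace_boundary hδ hthin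
  have := compactSpace_boundary hδ hthin
  have := secondCountableTopology_of_metrizable D.Boundary
  exact (IsEmbedding.subtypeVal
    (p := fun ω => ω ≠ D.parabolicPoint i)).isInducing.secondCountableTopology

/-! ### The map `hF` -/

theorem close_F_of_leaves (hδ : D.FourPoint δ) (hthin : D.HasThinTriangles δ₀)
    {ι : Type*} {l : Filter ι} {x : ι → D.offHoroball i}
    (hinf : ∀ n : ℕ, ∀ᶠ j in l, n ≤ D.graph.dist (x j).1 (.group 1)) (R : ℝ) :
    ∀ᶠ j in l, D.Close R (.bdry (c.F (x j)).1) (.vertex (x j).1) := by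
  obtain ⟨C, hC⟩ := c.close_F hδ hthin
  obtain ⟨n, hn⟩ := exists_nat_ge (R + C)
  filter_upwards [hinf n] with j hj
  refine (hC (x j)).mono ?_
  have : (n : ℝ) ≤ D.graph.dist (x j).1 (.group 1) := by exact_mod_cast hj
  linarith

theorem tendsto_F_iff (hδ : D.FourPoint δ) (hthin : D.HasThinTriangles δ₀)
    {ι : Type*} {l : Filter ι} {x : ι → D.offHoroball i}
    (hinf : ∀ n : ℕ, ∀ᶠ j in l, n ≤ D.graph.dist (x j).1 (.group 1)) {ω : D.Boundary} :
    Tendsto (fun j => (c.F (x j)).1) l (𝓝 ω) ↔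
      Tendsto (fun j => Bordification.vertex (x j).1) l (𝓝 (.bdry ω)) := by
  rw [isInducing_bdry.tendsto_nhds_iff]
  exact ⟨fun h => tendsto_of_close hδ h fun R => c.close_F_of_leaves hδ hthin hinf R,
    fun h => tendsto_of_close hδ h fun R =>
      (c.close_F_of_leaves hδ hthin hinf R).mono fun _ h => h.symm⟩

theorem exists_F_dist_le (hδ : D.FourPoint δ) (hthin : D.HasThinTriangles δ₀)
    (R : ℕ) : ∃ m : ℕ, ∀ x y : D.offHoroball i, D.graph.dist x.1 y.1 ≤ R →
      D.cayley.dist (c.L (c.F x) : G) (c.L (c.F y)) ≤ m := by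
  obtain ⟨C, hC⟩ := c.exists_LF_dist_le hδ hthin R
  obtain ⟨n, hn⟩ := exists_nat_ge C
  refine ⟨2 ^ n, fun x y h => (D.cayley_dist_le _ _).trans (Nat.pow_le_pow_right two_pos ?_)⟩
  exact_mod_cast (hC x y h).trans hn

/-- Given an asymptotic pair in `X^i`, either its image leaves the bounded sets of `P̂_i` and is
asymptotic since `L ∘ F` is bornologous, or along the ultrafilter it stays in a compact set. In the
latter case `F x` converges in `P̂_i`, hence `x`, its partner `y` and finally `F y` have the same
limit. -/
theorem isHigsonExtension_hF (hδ : D.FourPoint δ) (hthin : D.HasThinTriangles δ₀) :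
    IsHigsonExtension (D.omitCoarse i) (fun x => toHigson c.puncturedCoarse (c.F x)) c.hF := by
  refine isHigsonExtension_of_asymptotic continuous_of_discreteTopology fun U a b hU ha hb => ?_
  obtain ⟨A, hA, hUA⟩ := hU.controlled
  obtain ⟨R, hR⟩ := mem_pullback_augCoarse.1 hA
  obtain ⟨m, hm⟩ := c.exists_F_dist_le hδ hthin R
  have hUm : ∀ᶠ z in (U : Filter (D.offHoroball i × D.offHoroball i)),
      D.cayley.dist (c.L (c.F z.1) : G) (c.L (c.F z.2)) ≤ m :=
    hUA.mono fun z hz => hm _ _ (hR _ hz)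
  by_cases hB : ∀ B, c.puncturedCoarse.IsBdd B →
      ∀ᶠ z in (U : Filter (D.offHoroball i × D.offHoroball i)), c.F z.1 ∉ B
  · have has : IsAsymptotic c.puncturedCoarse (U : Filter (D.offHoroball i × D.offHoroball i))
        (fun z => c.F z.1) (fun z => c.F z.2) := by
      refine ⟨⟨_, c.controlled_L m, hUm⟩, hB, fun B hBb => ?_⟩
      filter_upwards [hB _ (hBb.thicken (c.controlled_L m)), hUm] with z h1 h2 h3
      refine h1 ⟨c.F z.2, h3, ?_⟩
      show D.cayley.dist (c.L (c.F z.2) : G) (c.L (c.F z.1)) ≤ m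
      rwa [SimpleGraph.dist_comm]
    refine higsonComp_ext fun g => ?_
    have h1 := has.tendsto_sub g.2
    have h2 := (tendsto_higsonComp_iff.1 hb g).sub (tendsto_higsonComp_iff.1 ha g)
    exact (sub_eq_zero.1 (tendsto_nhds_unique h2 h1)).symm
  · push Not at hB
    obtain ⟨B, hBb, hB⟩ := hB
    have hK := (c.isProperCoarse hδ hthin).isCompact_closure B hBb
    obtain ⟨ω, -, hω⟩ := hK.ultrafilter_le_nhds' (U.map fun z => c.F z.1)
      (hB.mono fun z hz => subset_closure hz)
    have h1 : Tendsto (fun z : D.offHoroball i × D.offHoroball i => c.F z.1) U (𝓝 ω) := hω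
    have hinf1 := eventually_le_dist hU.left
    have hinf2 := eventually_le_dist hU.right
    have h2 := (c.tendsto_F_iff hδ hthin hinf1).1
      ((continuous_subtype_val.tendsto ω).comp h1)
    have h3 := tendsto_vertex_of_dist_le hδ (hUA.mono fun z hz => hR _ hz) hinf1 h2
    have h4 : Tendsto (fun z : D.offHoroball i × D.offHoroball i => c.F z.2) U (𝓝 ω) :=
      tendsto_subtype_rng.2 ((c.tendsto_F_iff hδ hthin hinf2).2 h3)
    rw [tendsto_nhds_unique ha (((continuous_toHigson _).tendsto ω).comp h1),
      tendsto_nhds_unique hb (((continuous_toHigson _).tendsto ω).comp h4)]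

theorem hF_eq_of_tendsto (hδ : D.FourPoint δ) (hthin : D.HasThinTriangles δ₀)
    {ι : Type*} {l : Filter ι} [l.NeBot] {x : ι → D.offHoroball i}
    {χ : HigsonComp (D.omitCoarse i)}
    (hx : Tendsto (fun j => toHigson (D.omitCoarse i) (x j)) l (𝓝 χ))
    (hinf : ∀ n : ℕ, ∀ᶠ j in l, n ≤ D.graph.dist (x j).1 (.group 1)) {ω : D.Boundary}
    (hω : Tendsto (fun j => Bordification.vertex (x j).1) l (𝓝 (.bdry ω)))
    (h : ω ≠ D.parabolicPoint i) : c.hF χ = toHigson c.puncturedCoarse ⟨ω, h⟩ := by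
  have h1 : Tendsto (fun j => c.F (x j)) l (𝓝 ⟨ω, h⟩) :=
    tendsto_subtype_rng.2 ((c.tendsto_F_iff hδ hthin hinf).2 hω)
  exact tendsto_nhds_unique ((c.isHigsonExtension_hF hδ hthin).tendsto hx)
    (((continuous_toHigson _).tendsto _).comp h1)

theorem eventually_notMem_of_tendsto (hδ : D.FourPoint δ) (hthin : D.HasThinTriangles δ₀)
    {ι : Type*} {l : Filter ι} {u : ι → D.Punctured i}
    (hu : Tendsto (fun j => (u j).1) l (𝓝 (D.parabolicPoint i))) {B : Set (D.Punctured i)}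
    (hB : c.puncturedCoarse.IsBdd B) : ∀ᶠ j in l, u j ∉ B := by
  have := metrizableSpace_boundary hδ hthin
  have hK := (((c.isProperCoarse hδ hthin).isCompact_closure B hB).image
    continuous_subtype_val).isClosed
  have h : D.parabolicPoint i ∉ Subtype.val '' closure B := by
    rintro ⟨ω, -, hω⟩
    exact ω.2 hω
  filter_upwards [hu.eventually (hK.isOpen_compl.mem_nhds h)] with j hj hjB
  exact hj ⟨_, subset_closure hjB, rfl⟩

theorem hF_mem_corona_of_tendsto (hδ : D.FourPoint δ) (hthin : D.HasThinTriangles δ₀)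
    {ι : Type*} {l : Filter ι} [l.NeBot] {x : ι → D.offHoroball i}
    {χ : HigsonComp (D.omitCoarse i)}
    (hx : Tendsto (fun j => toHigson (D.omitCoarse i) (x j)) l (𝓝 χ))
    (hinf : ∀ n : ℕ, ∀ᶠ j in l, n ≤ D.graph.dist (x j).1 (.group 1))
    (hω : Tendsto (fun j => Bordification.vertex (x j).1) l (𝓝 (.bdry (D.parabolicPoint i)))) :
    ¬ ∃ ω, toHigson c.puncturedCoarse ω = c.hF χ := by
  have := metrizableSpace_punctured hδ hthin i
  have := locallyCompactSpace_punctured hδ hthin i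
  exact (c.isProperCoarse hδ hthin).mem_corona
    ((c.isHigsonExtension_hF hδ hthin).tendsto hx)
    fun B hB => c.eventually_notMem_of_tendsto hδ hthin
      ((c.tendsto_F_iff hδ hthin hinf).2 hω) hB

/-! ### The corona of `∂X ∖ {s_i}` -/

theorem cayley_dist_toPeripheral (ω ω' : D.Punctured i) :
    D.cayley.dist (c.toPeripheral ω : G) (c.toPeripheral ω') =
      D.cayley.dist (c.L ω : G) (c.L ω') :=
  D.cayley_dist_mul_left _ _ _

theorem isCoarseMap_toPeripheral :
    IsCoarseMap c.puncturedCoarse (D.peripheralCoarse (residue k i)) c.toPeripheral where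
  controlled A hA := by
    obtain ⟨R, hR⟩ := mem_pullback_groupCoarse.1 hA
    refine mem_pullback_groupCoarse.2 ⟨R, ?_⟩
    rintro _ ⟨z, hz, rfl⟩
    exact (c.cayley_dist_toPeripheral z.1 z.2).le.trans (hR z hz)
  proper B hB := by
    obtain ⟨R, hR⟩ := mem_pullback_groupCoarse.1 hB
    refine mem_pullback_groupCoarse.2 ⟨R, fun z hz => ?_⟩
    exact (c.cayley_dist_toPeripheral z.1 z.2).ge.trans (hR (_, _) ⟨hz.1, hz.2⟩)

variable [TopologicalSpace G]

/-- `L` depends on a choice of rays and need not be continuous. Its local constancy up to a uniform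
error is enough on the corona. -/
theorem exists_tendsto_toPeripheral (hδ : D.FourPoint δ) (hthin : D.HasThinTriangles δ₀)
    {χ : HigsonComp c.puncturedCoarse} (hχ : ¬ ∃ x, toHigson c.puncturedCoarse x = χ) :
    ∃ θ, Tendsto (fun ω => toHigson (D.peripheralCoarse (residue k i)) (c.toPeripheral ω))
      (higsonFilter c.puncturedCoarse χ) (𝓝 θ) := by
  have := metrizableSpace_punctured hδ hthin i
  let _ := TopologicalSpace.metrizableSpaceMetric (D.Punctured i)
  obtain ⟨m, hm⟩ := c.exists_eventually_L hδ hthin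
  refine c.isCoarseMap_toPeripheral.exists_tendsto_of_local (c.isProperCoarse hδ hthin)
    (A := {z | D.cayley.dist (z.1 : G) z.2 ≤ m})
    (mem_pullback_groupCoarse.2 ⟨m, fun _ hz => hz⟩) (fun ω => ?_) hχ
  filter_upwards [hm ω] with ω' h
  exact (c.cayley_dist_toPeripheral ω' ω).le.trans h

theorem tendsto_hPeripheral (hδ : D.FourPoint δ) (hthin : D.HasThinTriangles δ₀)
    {χ : HigsonComp c.puncturedCoarse} (hχ : ¬ ∃ x, toHigson c.puncturedCoarse x = χ) :
    Tendsto (fun ω => toHigson (D.peripheralCoarse (residue k i)) (c.toPeripheral ω))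
      (higsonFilter c.puncturedCoarse χ) (𝓝 (c.hPeripheral χ)) :=
  tendsto_higsonExt (c.exists_tendsto_toPeripheral hδ hthin hχ)

theorem hPeripheral_mem_corona [DiscreteTopology G] (hδ : D.FourPoint δ)
    (hthin : D.HasThinTriangles δ₀) {χ : HigsonComp c.puncturedCoarse}
    (hχ : ¬ ∃ x, toHigson c.puncturedCoarse x = χ) :
    ¬ ∃ x, toHigson (D.peripheralCoarse (residue k i)) x = c.hPeripheral χ :=
  (D.isProperCoarse_peripheralCoarse _).mem_corona (c.tendsto_hPeripheral hδ hthin hχ)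
    fun _ hB => c.isCoarseMap_toPeripheral.eventually_notMem (c.isProperCoarse hδ hthin) hχ hB

variable {W : Fin k → Type w} [∀ r, Nonempty (W r)]
  {ζ : ∀ r, HigsonCorona (D.peripheralCoarse r) → W r}

theorem zeta_eq {χ : HigsonCorona c.puncturedCoarse}
    (h : ¬ ∃ x, toHigson (D.peripheralCoarse (residue k i)) x = c.hPeripheral χ.1) :
    c.zeta ζ χ = ζ (residue k i) ⟨c.hPeripheral χ.1, h⟩ := dif_pos h

theorem isCorona_zeta [DiscreteTopology G] [∀ r, TopologicalSpace (W r)] (hδ : D.FourPoint δ)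
    (hthin : D.HasThinTriangles δ₀) (hζ : ∀ r, IsCorona (ζ r)) : IsCorona (c.zeta ζ) where
  compact := (hζ _).compact
  metrizable := (hζ _).metrizable
  continuous := by
    have h1 : ContinuousOn c.hPeripheral {χ | ¬ ∃ x, toHigson c.puncturedCoarse x = χ} :=
      continuousOn_higsonExt fun χ hχ => c.exists_tendsto_toPeripheral hδ hthin hχ
    have h2 : Continuous fun χ : HigsonCorona c.puncturedCoarse =>
        (⟨c.hPeripheral χ.1, c.hPeripheral_mem_corona hδ hthin χ.2⟩ :
          HigsonCorona (D.peripheralCoarse (residue k i))) :=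
      (continuousOn_iff_continuous_domRestrict.1 h1).subtype_mk _
    exact ((hζ _).continuous.comp h2).congr fun χ => (c.zeta_eq _).symm

end RayChoice
end PeripheralGroup
end BlownUp

namespace BlownUp
universe u v w

section Limits

variable {X : Type u} [TopologicalSpace X] {E : CoarseStructure X}

theorem IsAsymptotic.tendsto_toHigson {ι : Type*} {l : Filter ι} {x y : ι → X}
    (h : IsAsymptotic E l x y) {χ : HigsonComp E}
    (hx : Tendsto (fun j => toHigson E (x j)) l (𝓝 χ)) :
    Tendsto (fun j => toHigson E (y j)) l (𝓝 χ) := by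
  refine tendsto_higsonComp_iff.2 fun g => ?_
  have := (tendsto_higsonComp_iff.1 hx g).add (h.tendsto_sub g.2)
  rw [add_zero] at this
  exact this.congr fun j => add_sub_cancel _ _

theorem IsProperCoarse.exists_corona_of_leaves [T2Space X] [LocallyCompactSpace X]
    (hE : IsProperCoarse E) {ι : Type*} {l : Filter ι} [l.NeBot] {x : ι → X}
    (hx : ∀ B, E.IsBdd B → ∀ᶠ j in l, x j ∉ B) :
    ∃ (U : Ultrafilter ι) (χ : HigsonCorona E), (U : Filter ι) ≤ l ∧
      Tendsto (fun j => toHigson E (x j)) U (𝓝 χ.1) := by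
  obtain ⟨χ, -, hχ⟩ := isCompact_univ.ultrafilter_le_nhds'
    ((Ultrafilter.of l).map fun j => toHigson E (x j)) Filter.univ_mem
  have h1 : Tendsto (fun j => toHigson E (x j)) (Ultrafilter.of l) (𝓝 χ) := hχ
  exact ⟨Ultrafilter.of l, ⟨χ, hE.mem_corona h1 fun B hB => Ultrafilter.of_le l (hx B hB)⟩,
    Ultrafilter.of_le l, h1⟩

end Limits

namespace PeripheralGroup
variable {G : Type u} [Group G] {k : ℕ} [NeZero k] {D : PeripheralGroup G k}

instance : Nonempty D.Boundary := ⟨D.parabolicPoint 0⟩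

/-! ## The collapse of `P̂_i ∪ W_i` to `∂X` -/

namespace RayChoice
variable {N i : ℕ} (c : D.RayChoice N i) {δ δ₀ : ℝ}

/-- The complement of an open neighbourhood of `s_i` is compact in `P̂_i`, hence bounded, and a
corona point avoids it. -/
theorem tendsto_val_of_corona (hδ : D.FourPoint δ) (hthin : D.HasThinTriangles δ₀)
    {χ : HigsonComp c.puncturedCoarse} (hχ : ¬ ∃ ω, toHigson c.puncturedCoarse ω = χ) :
    Tendsto (Subtype.val : D.Punctured i → D.Boundary) (higsonFilter c.puncturedCoarse χ)
      (𝓝 (D.parabolicPoint i)) := by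
  have := compactSpace_boundary hδ hthin
  refine tendsto_nhds.2 fun V hV hs => ?_
  have hK : IsCompact ((Subtype.val : D.Punctured i → D.Boundary) ⁻¹' Vᶜ) := by
    rw [(IsEmbedding.subtypeVal
      (p := fun ω => ω ≠ D.parabolicPoint i)).isInducing.isCompact_preimage_iff]
    · exact hV.isClosed_compl.isCompact
    · intro ω hω
      exact ⟨⟨ω, fun h => hω (h ▸ hs)⟩, rfl⟩
  filter_upwards [(c.isProperCoarse hδ hthin).compl_mem_higsonFilter hχ
    ((c.isProperCoarse hδ hthin).isBdd_of_isCompact _ hK)] with ω hω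
  by_contra h
  exact hω h

variable [TopologicalSpace G] {W : Fin k → Type w} [∀ r, Nonempty (W r)]
  {ζ : ∀ r, HigsonCorona (D.peripheralCoarse r) → W r}

/-- The map `P̂_i ∪ W_i → ∂X` which collapses `W_i` to `s_i`. -/
def toBoundary : CoronaUnion (c.zeta ζ) → D.Boundary
  | .inner ω => ω.1
  | .outer _ => D.parabolicPoint i

variable {c}

theorem eq_inner_of_toBoundary {a : CoronaUnion (c.zeta ζ)} {ω : D.Boundary}
    (h : c.toBoundary a = ω) (hω : ω ≠ D.parabolicPoint i) : a = .inner ⟨ω, hω⟩ := by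
  subst h
  cases a with
  | inner ω => rfl
  | outer z => exact absurd rfl hω

theorem exists_eq_outer_of_toBoundary {a : CoronaUnion (c.zeta ζ)}
    (h : c.toBoundary a = D.parabolicPoint i) : ∃ z, a = .outer z := by
  cases a with
  | inner ω => exact absurd h ω.2
  | outer z => exact ⟨z, rfl⟩

/-- The inclusion `P̂_i → ∂X` extends to `hP̂_i` with constant value `s_i` on the corona, so it can
be glued to the constant map on `W_i`. -/
theorem continuous_toBoundary [∀ r, TopologicalSpace (W r)] (hδ : D.FourPoint δ)
    (hthin : D.HasThinTriangles δ₀) :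
    Continuous (c.toBoundary : CoronaUnion (c.zeta ζ) → D.Boundary) := by
  have := metrizableSpace_boundary hδ hthin
  have := metrizableSpace_punctured hδ hthin i
  have := locallyCompactSpace_punctured hδ hthin i
  have hE := c.isProperCoarse hδ hthin
  have hext : ∀ χ, ∃ ω, Tendsto (Subtype.val : D.Punctured i → D.Boundary)
      (higsonFilter c.puncturedCoarse χ) (𝓝 ω) := by
    intro χ
    by_cases hχ : ∃ ω, toHigson c.puncturedCoarse ω = χ
    · obtain ⟨ω, rfl⟩ := hχ
      rw [hE.higsonFilter_toHigson_eq]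
      exact ⟨_, continuous_subtype_val.tendsto ω⟩
    · exact ⟨_, c.tendsto_val_of_corona hδ hthin hχ⟩
  have hF := isHigsonExtension_higsonExt continuous_subtype_val hext
  have h1 := hE.continuous_glue (ζ := c.zeta ζ) (w := fun _ => D.parabolicPoint i) hF.1
    continuous_const fun χ => tendsto_nhds_unique (tendsto_higsonExt (hext χ.1))
      (c.tendsto_val_of_corona hδ hthin χ.2)
  convert h1 using 1
  ext a
  cases a with
  | inner ω => exact (hF.2 ω).symm
  | outer z => rfl

end RayChoice

/-! ## The blown-up spaces are compact and metrizable -/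

section Blowup

variable [TopologicalSpace G] {N : ℕ} {W : Fin k → Type w}
  {c : ∀ i, D.RayChoice N i} {ζ : ∀ r, HigsonCorona (D.peripheralCoarse r) → W r} {δ δ₀ : ℝ}

namespace Blowup

theorem exists_eq_blown {n : ℕ} {i : Fin n} {x : Blowup c ζ n}
    (h : x.collapse = D.parabolicPoint i) : ∃ z, x = blown i z := by
  cases x with
  | base ω => exact absurd h (ω.2 i)
  | blown j z =>
    have hji : j = i := by
      by_contra hn
      exact D.parabolicPoint_ne (fun e => hn (Fin.ext e)) h
    subst hji
    exact ⟨z, rfl⟩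

theorem exists_eq_base {n : ℕ} {x : Blowup c ζ n}
    (h : ∀ i : Fin n, x.collapse ≠ D.parabolicPoint i) : x = base ⟨x.collapse, h⟩ := by
  cases x with
  | base ω => rfl
  | blown j z => exact absurd rfl (h j)

theorem collapse_proj {n : ℕ} (x : Blowup c ζ (n + 1)) : (proj x).collapse = x.collapse := by
  cases x with
  | base ω => rfl
  | blown i z =>
    by_cases h : i.1 < n
    · rw [proj, dif_pos h]
      rfl
    · rw [proj, dif_neg h]
      rfl

variable [∀ r, Nonempty (W r)]

theorem sigma_blown {n : ℕ} (i : Fin n) (z : W (residue k i)) :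
    sigma i (blown i z : Blowup c ζ n) = .outer z := by
  simp [sigma]

theorem toBoundary_sigma {n : ℕ} (i : Fin n) (x : Blowup c ζ n) :
    (c i).toBoundary (sigma i x) = x.collapse := by
  cases x with
  | base ω => rfl
  | blown j z =>
    by_cases h : j = i
    · subst h
      rw [sigma_blown]
      rfl
    · rw [sigma, dif_neg h]
      rfl

theorem ext_collapse_sigma {n : ℕ} {x y : Blowup c ζ n} (h : x.collapse = y.collapse)
    (hs : ∀ i, sigma i x = sigma i y) : x = y := by
  by_cases hx : ∃ i : Fin n, x.collapse = D.parabolicPoint i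
  · obtain ⟨i, hi⟩ := hx
    obtain ⟨z, rfl⟩ := exists_eq_blown hi
    obtain ⟨z', rfl⟩ := exists_eq_blown (h ▸ hi)
    have h1 := hs i
    rw [sigma_blown, sigma_blown] at h1
    rw [CoronaUnion.outer.inj h1]
  · push Not at hx
    rw [exists_eq_base hx, exists_eq_base (x := y) (h ▸ hx)]
    congr 2

/-- The point `ω` equals `s_i` for at most one `i`. Only that coordinate can be a point of `W_i`,
and all others are determined by `ω`. -/
theorem exists_collapse_sigma {n : ℕ} (ω : D.Boundary) (a : ∀ i : Fin n, CoronaUnion ((c i).zeta ζ))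
    (h : ∀ i : Fin n, (c i).toBoundary (a i) = ω) :
    ∃ x : Blowup c ζ n, x.collapse = ω ∧ ∀ i, sigma i x = a i := by
  by_cases hω : ∃ i : Fin n, ω = D.parabolicPoint i
  · obtain ⟨i, rfl⟩ := hω
    obtain ⟨z, hz⟩ := RayChoice.exists_eq_outer_of_toBoundary (h i)
    refine ⟨blown i z, rfl, fun j => ?_⟩
    by_cases hij : i = j
    · subst hij
      rw [sigma_blown, hz]
    · rw [sigma, dif_neg hij]
      exact (RayChoice.eq_inner_of_toBoundary (h j) _).symm
  · push Not at hω
    exact ⟨base ⟨ω, hω⟩, rfl, fun i => (RayChoice.eq_inner_of_toBoundary (h i) (hω i)).symm⟩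

theorem sigma_proj {n : ℕ} (i : Fin n) (x : Blowup c ζ (n + 1)) :
    sigma i (proj x) = sigma i.castSucc x := by
  by_cases hx : x.collapse = D.parabolicPoint i
  · obtain ⟨z, rfl⟩ := exists_eq_blown (i := i.castSucc) hx
    rw [sigma_blown, proj, dif_pos (show i.castSucc.1 < n from i.2)]
    exact sigma_blown i z
  · have h1 := toBoundary_sigma i (proj x)
    rw [collapse_proj] at h1
    rw [RayChoice.eq_inner_of_toBoundary h1 hx]
    exact (RayChoice.eq_inner_of_toBoundary (toBoundary_sigma i.castSucc x) hx).symm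

variable (c ζ) in
/-- The embedding of `∂X_n` into a product. -/
noncomputable def toProd (n : ℕ) (x : Blowup c ζ n) :
    D.Boundary × ∀ i : Fin n, CoronaUnion ((c i).zeta ζ) := (x.collapse, fun i => sigma i x)

/-- This describes `∂X_n` as a fibre product over `∂X`. The factor `∂X` is kept so that `n = 0`
needs no separate treatment. -/
theorem range_toProd (n : ℕ) :
    Set.range (toProd c ζ n) = {p | ∀ i : Fin n, (c i).toBoundary (p.2 i) = p.1} := by
  ext ⟨ω, a⟩
  constructor
  · rintro ⟨x, h⟩
    rw [← h]
    exact fun i => toBoundary_sigma i x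
  · intro h
    obtain ⟨x, h1, h2⟩ := exists_collapse_sigma ω a h
    exact ⟨x, Prod.ext h1 (funext h2)⟩

variable [∀ r, TopologicalSpace (W r)]

theorem isInducing_toProd (n : ℕ) : IsInducing (toProd c ζ n) := by
  constructor
  rw [instTopologicalSpaceProd, induced_inf, induced_compose, induced_compose, Pi.topologicalSpace,
    induced_iInf]
  simp only [induced_compose]
  rfl

theorem isClosedEmbedding_toProd (hδ : D.FourPoint δ) (hthin : D.HasThinTriangles δ₀) (n : ℕ) :
    IsClosedEmbedding (toProd c ζ n) := by
  have := metrizableSpace_boundary hδ hthin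
  refine ⟨⟨isInducing_toProd n, fun x y h => ?_⟩, ?_⟩
  · exact ext_collapse_sigma (congrArg Prod.fst h) fun i => congrFun (congrArg Prod.snd h) i
  · rw [range_toProd, Set.ofPred_forall]
    exact isClosed_iInter fun i => isClosed_eq
      ((RayChoice.continuous_toBoundary hδ hthin).comp ((continuous_apply i).comp continuous_snd))
      continuous_fst

theorem continuous_iff {T : Type*} [TopologicalSpace T] {n : ℕ} {f : T → Blowup c ζ n} :
    Continuous f ↔ Continuous (fun t => (f t).collapse) ∧ ∀ i, Continuous fun t => sigma i (f t) :=
  (isInducing_toProd n).continuous_iff.trans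
    (continuous_prodMk.trans (and_congr Iff.rfl continuous_pi_iff))

theorem continuous_proj (n : ℕ) : Continuous (proj : Blowup c ζ (n + 1) → Blowup c ζ n) := by
  have h := continuous_iff.1 (continuous_id (X := Blowup c ζ (n + 1)))
  refine continuous_iff.2 ⟨h.1.congr fun x => (collapse_proj x).symm, fun i => ?_⟩
  exact (h.2 i.castSucc).congr fun x => (sigma_proj i x).symm

theorem compactSpace (hδ : D.FourPoint δ) (hthin : D.HasThinTriangles δ₀)
    (hζ : ∀ r, IsCorona (ζ r)) (n : ℕ) : CompactSpace (Blowup c ζ n) := by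
  have := compactSpace_boundary hδ hthin
  have : ∀ i : Fin n, CompactSpace (CoronaUnion ((c i).zeta ζ)) := fun i => by
    have := RayChoice.metrizableSpace_punctured hδ hthin i
    have := RayChoice.locallyCompactSpace_punctured hδ hthin i
    have := (hζ (residue k i)).compact
    exact ((c i).isProperCoarse hδ hthin).compactSpace_coronaUnion
  exact (isClosedEmbedding_toProd hδ hthin n).compactSpace

theorem metrizableSpace [DiscreteTopology G] (hδ : D.FourPoint δ) (hthin : D.HasThinTriangles δ₀)
    (hζ : ∀ r, IsCorona (ζ r)) (n : ℕ) : TopologicalSpace.MetrizableSpace (Blowup c ζ n) := by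
  have := metrizableSpace_boundary hδ hthin
  have : ∀ i : Fin n, TopologicalSpace.MetrizableSpace (CoronaUnion ((c i).zeta ζ)) := fun i => by
    have := RayChoice.metrizableSpace_punctured hδ hthin i
    have := RayChoice.locallyCompactSpace_punctured hδ hthin i
    have := RayChoice.secondCountableTopology_punctured hδ hthin i
    exact ((c i).isProperCoarse hδ hthin).metrizableSpace_coronaUnion
      ((c i).isCorona_zeta hδ hthin hζ)
  exact (isClosedEmbedding_toProd hδ hthin n).isEmbedding.metrizableSpace

end Blowup

variable [∀ r, Nonempty (W r)] [∀ r, TopologicalSpace (W r)]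

theorem isClosed_blowupLimit [DiscreteTopology G] (hδ : D.FourPoint δ)
    (hthin : D.HasThinTriangles δ₀) (hζ : ∀ r, IsCorona (ζ r)) :
    IsClosed {x : ∀ n, Blowup c ζ n | ∀ n, Blowup.proj (x (n + 1)) = x n} := by
  have := fun n => Blowup.metrizableSpace (c := c) hδ hthin hζ n
  rw [Set.ofPred_forall]
  exact isClosed_iInter fun n => isClosed_eq
    ((Blowup.continuous_proj n).comp (continuous_apply _)) (continuous_apply _)

theorem compactSpace_blowupLimit [DiscreteTopology G] (hδ : D.FourPoint δ)
    (hthin : D.HasThinTriangles δ₀) (hζ : ∀ r, IsCorona (ζ r)) :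
    CompactSpace (BlowupLimit c ζ) := by
  have := fun n => Blowup.compactSpace (c := c) hδ hthin hζ n
  exact isCompact_iff_compactSpace.1 (isClosed_blowupLimit hδ hthin hζ).isCompact

theorem metrizableSpace_blowupLimit [DiscreteTopology G] (hδ : D.FourPoint δ)
    (hthin : D.HasThinTriangles δ₀) (hζ : ∀ r, IsCorona (ζ r)) :
    TopologicalSpace.MetrizableSpace (BlowupLimit c ζ) := by
  have h1 := fun n => Blowup.compactSpace (c := c) hδ hthin hζ n
  have h2 := fun n => Blowup.metrizableSpace (c := c) hδ hthin hζ n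
  have h3 := fun n => secondCountableTopology_of_metrizable (Blowup c ζ n)
  have : TopologicalSpace.MetrizableSpace (∀ n, Blowup c ζ n) :=
    TopologicalSpace.metrizableSpace_of_t3_secondCountable _
  exact (IsEmbedding.subtypeVal
    (p := fun x : ∀ n, Blowup c ζ n => ∀ n, Blowup.proj (x (n + 1)) = x n)).metrizableSpace

end Blowup

end PeripheralGroup
end BlownUp

namespace BlownUp
universe u v w

namespace PeripheralGroup
variable {G : Type u} [Group G] {k : ℕ} [NeZero k] {D : PeripheralGroup G k} {δ δ₀ : ℝ}

/-! ## The inclusions between the subspaces of the augmented space -/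

variable (D) in
theorem isCoarseMap_levelToOmit {n : ℕ} (i : Fin n) :
    IsCoarseMap (D.levelCoarse n) (D.omitCoarse i) (D.levelToOmit i) where
  controlled A hA := by
    obtain ⟨R, hR⟩ := mem_pullback_augCoarse.1 hA
    refine mem_pullback_augCoarse.2 ⟨R, ?_⟩
    rintro _ ⟨z, hz, rfl⟩
    exact hR z hz
  proper B hB := by
    obtain ⟨R, hR⟩ := mem_pullback_augCoarse.1 hB
    exact mem_pullback_augCoarse.2 ⟨R, fun z hz => hR (_, _) ⟨hz.1, hz.2⟩⟩

variable (D) in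
theorem isCoarseMap_groupToLevel (n : ℕ) :
    IsCoarseMap D.groupCoarse (D.levelCoarse n) (D.groupToLevel n) where
  controlled A hA := by
    obtain ⟨R, hR⟩ := hA
    refine mem_pullback_augCoarse.2 ⟨R, ?_⟩
    rintro _ ⟨z, hz, rfl⟩
    exact (D.graph_dist_group_le z.1 z.2).trans (hR z hz)
  proper B hB :=
    CoarseStructure.isBdd_finite _ ((CoarseStructure.finite_of_isBdd_pullback
      Subtype.val_injective (fun _ => finite_of_isBdd_augCoarse) hB).preimage
        fun _ _ _ _ h => Vertex.group.inj (congrArg Subtype.val h))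

variable (D) in
theorem isHigsonExtension_levelVal (n : ℕ) : IsHigsonExtension (D.levelCoarse n)
    (fun x => toHigson D.augCoarse x.1) (higsonMap (D.levelCoarse n) D.augCoarse Subtype.val) :=
  isCoarseMap_pullback_val.isHigsonExtension continuous_of_discreteTopology

variable (D) in
theorem isHigsonExtension_levelToOmit {n : ℕ} (i : Fin n) : IsHigsonExtension (D.levelCoarse n)
    (fun x => toHigson (D.omitCoarse i) (D.levelToOmit i x))
    (higsonMap (D.levelCoarse n) (D.omitCoarse i) (D.levelToOmit i)) :=
  (D.isCoarseMap_levelToOmit i).isHigsonExtension continuous_of_discreteTopology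

theorem isHigsonExtension_alphaLevel (hδ : D.FourPoint δ) (hthin : D.HasThinTriangles δ₀) (n : ℕ) :
    IsHigsonExtension (D.levelCoarse n) (fun x => Bordification.vertex x.1) (D.alphaLevel n) where
  left := (isHigsonExtension_alpha hδ hthin).1.comp (D.isHigsonExtension_levelVal n).1
  right x := by
    rw [alphaLevel, (D.isHigsonExtension_levelVal n).2, (isHigsonExtension_alpha hδ hthin).2]

variable (D) in
theorem leaves_of_levelCorona {n : ℕ} (χ : HigsonCorona (D.levelCoarse n)) (m : ℕ) :
    ∀ᶠ x in higsonFilter (D.levelCoarse n) χ.1, m ≤ D.graph.dist x.1 (.group 1) :=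
  eventually_le_dist (fun _ hB =>
    (D.isProperCoarse_levelCoarse n).compl_mem_higsonFilter χ.2 hB) m

theorem exists_alphaLevel_eq (hδ : D.FourPoint δ) (hthin : D.HasThinTriangles δ₀) {n : ℕ}
    (χ : HigsonCorona (D.levelCoarse n)) : ∃ ω, D.alphaLevel n χ.1 = .bdry ω :=
  exists_bdry_of_leaves (D.leaves_of_levelCorona χ)
    ((isHigsonExtension_alphaLevel hδ hthin n).tendsto (tendsto_toHigson_higsonFilter _ _))

/-- Where `alpha` takes the value `s_i`, the points `F_i(x)` tend to `s_i` and leave all bounded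
sets of `P̂_i`. This is why `ξ_n` takes its value in `W_i` there. -/
theorem hF_level_mem_corona {N : ℕ} {c : ∀ i, D.RayChoice N i} (hδ : D.FourPoint δ)
    (hthin : D.HasThinTriangles δ₀) {n : ℕ} {i : Fin n} {χ : HigsonCorona (D.levelCoarse n)}
    (h : D.alphaLevel n χ.1 = .bdry (D.parabolicPoint i)) :
    ¬ ∃ ω, toHigson (c i).puncturedCoarse ω =
      (c i).hF (higsonMap (D.levelCoarse n) (D.omitCoarse i) (D.levelToOmit i) χ.1) := by
  have h1 := (isHigsonExtension_alphaLevel hδ hthin n).tendsto (tendsto_toHigson_higsonFilter _ χ.1)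
  rw [h] at h1
  exact (c i).hF_mem_corona_of_tendsto hδ hthin
    ((D.isHigsonExtension_levelToOmit i).tendsto (tendsto_toHigson_higsonFilter _ χ.1))
    (D.leaves_of_levelCorona χ) h1

/-! ## Sequences of group elements -/

theorem coset_leaves (i : ℕ) {l : Filter (D.P (residue k i))}
    (hl : ∀ B : Set (D.P (residue k i)), B.Finite → Bᶜ ∈ l) (n : ℕ) :
    ∀ᶠ p : D.P (residue k i) in l, n ≤ D.graph.dist (.group (D.g i * p)) (.group 1) := by
  filter_upwards [hl _ ((D.finite_ball (.group 1) n).preimage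
    (f := fun p : D.P (residue k i) => (Vertex.group (D.g i * p) : D.Vertex))
    fun _ _ _ _ h => Subtype.ext (mul_left_cancel (Vertex.group.inj h)))] with p hp
  have : ¬ D.graph.dist (.group 1) (.group (D.g i * p)) ≤ n := hp
  rw [SimpleGraph.dist_comm]
  omega

theorem mul_mem_coset (i : ℕ) (p : D.P (residue k i)) : D.g i * p ∈ D.coset i := by
  simp [coset]

theorem coset_tendsto (hδ : D.FourPoint δ) (i : ℕ) {l : Filter (D.P (residue k i))}
    (hl : ∀ B : Set (D.P (residue k i)), B.Finite → Bᶜ ∈ l) :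
    Tendsto (fun p : D.P (residue k i) =>
      (Bordification.vertex (.group (D.g i * p)) : D.Bordification)) l
      (𝓝 (.bdry (D.parabolicPoint i))) :=
  tendsto_parabolic hδ (.of_forall fun p => D.inHoroball_vert i ⟨_, mul_mem_coset i p⟩ 0)
    (coset_leaves i hl)

/-- One can leave a horoball only through `G`, so a ray that avoids `G` from some time on stays in a
single horoball. -/
theorem endpoint_eq_parabolicPoint_of_notMem_group (hδ : D.FourPoint δ)
    (hthin : D.HasThinTriangles δ₀) {l : D.Ray}
    (h : ∀ᶠ t in atTop, ¬ ∃ x, l.toFun t = .group x) :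
    ∃ i, D.endpoint l = D.parabolicPoint i := by
  obtain ⟨T, hT⟩ := eventually_atTop.1 h
  obtain ⟨i, hi⟩ : ∃ i, D.depth i (l.toFun T) ≠ 0 := by
    cases hx : l.toFun T with
    | group x => exact absurd ⟨x, hx⟩ (hT T le_rfl)
    | horo i p m => exact ⟨i, by simp [depth]⟩
  have hd : ∀ t, T ≤ t → D.depth i (l.toFun t) ≠ 0 := by
    intro t ht
    induction t, ht using Nat.le_induction with
    | base => exact hi
    | succ t ht ih =>
      obtain ⟨p, m, hp⟩ := inHoroball_of_adj (l.adj t) ih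
      rw [hp, depth_vert]
      rintro rfl
      exact hT (t + 1) (by omega) ⟨_, hp⟩
  refine ⟨i, endpoint_eq_parabolicPoint hδ hthin (Eventually.frequently ?_)⟩
  exact eventually_atTop.2 ⟨T, fun t ht => D.inHoroball_of_depth_ne (hd t ht)⟩

/-- The orbit of `G` accumulates at every boundary point. -/
theorem exists_group_tendsto (hδ : D.FourPoint δ) (hthin : D.HasThinTriangles δ₀)
    (ω : D.Boundary) : ∃ l : Filter G, l.NeBot ∧
      (∀ n : ℕ, ∀ᶠ x in l, n ≤ D.graph.dist (.group x) (.group 1)) ∧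
      Tendsto (fun x => (Bordification.vertex (.group x) : D.Bordification)) l (𝓝 (.bdry ω)) := by
  obtain ⟨l, rfl⟩ := exists_endpoint_eq ω
  by_cases h : ∃ᶠ t in atTop, ∃ x, l.toFun t = .group x
  · have hx : ∀ t, ∃ y : G, (∃ x, l.toFun t = .group x) → l.toFun t = .group y := fun t => by
      by_cases hx : ∃ x, l.toFun t = .group x
      · exact ⟨hx.choose, fun _ => hx.choose_spec⟩
      · exact ⟨1, fun h => absurd h hx⟩
    choose x hx using hx
    have hne : (atTop ⊓ 𝓟 {t | ∃ x, l.toFun t = .group x}).NeBot :=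
      frequently_mem_iff_neBot.1 h
    have hev : ∀ᶠ t in atTop ⊓ 𝓟 {t | ∃ x, l.toFun t = .group x}, l.toFun t = .group (x t) :=
      mem_inf_of_right fun t ht => hx t ht
    refine ⟨map x (atTop ⊓ 𝓟 {t | ∃ x, l.toFun t = .group x}), hne.map x, fun n => ?_, ?_⟩
    · refine eventually_map.2 ?_
      filter_upwards [mem_inf_of_left (l.leaves n), hev] with t h1 h2
      rw [← h2]
      exact h1
    · refine tendsto_map'_iff.2 (((l.tendsto hδ).mono_left inf_le_left).congr' ?_)
      filter_upwards [hev] with t h2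
      rw [Function.comp_apply, h2]
  -- Otherwise the ray ends at a parabolic point, which is approached by the elements of the
  -- infinite coset `g_i P_(i)`.
  · obtain ⟨i, hi⟩ := endpoint_eq_parabolicPoint_of_notMem_group hδ hthin (not_frequently.1 h)
    have := D.P_infinite (residue k i)
    have hl : ∀ B : Set (D.P (residue k i)), B.Finite → Bᶜ ∈ cofinite := fun B hB =>
      hB.compl_mem_cofinite
    rw [hi]
    exact ⟨map (fun p : D.P (residue k i) => D.g i * p) cofinite, inferInstance,
      fun n => eventually_map.2 (coset_leaves i hl n), tendsto_map'_iff.2 (coset_tendsto hδ i hl)⟩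

variable (D) in
theorem eventually_notMem_of_leaves {ι : Type*} {l : Filter ι} {x : ι → G}
    (h : ∀ n : ℕ, ∀ᶠ j in l, n ≤ D.graph.dist (.group (x j)) (.group 1)) {B : Set G}
    (hB : D.groupCoarse.IsBdd B) : ∀ᶠ j in l, x j ∉ B := by
  obtain ⟨n, hn⟩ := ((finite_of_isBdd_groupCoarse hB).image fun x =>
    D.graph.dist (.group x) (.group 1)).bddAbove
  filter_upwards [h (n + 1)] with j hj hjB
  have : D.graph.dist (.group (x j)) (.group 1) ≤ n := hn (Set.mem_image_of_mem _ hjB)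
  omega

/-- By `exists_LF_coset` and left invariance, both elements are at uniformly bounded word distance.
-/
theorem isAsymptotic_toPeripheral (hδ : D.FourPoint δ) (hthin : D.HasThinTriangles δ₀) {N i : ℕ}
    (c : D.RayChoice N i) {l : Filter (D.P (residue k i))}
    (hl : ∀ B, (D.peripheralCoarse (residue k i)).IsBdd B → ∀ᶠ p in l, p ∉ B) :
    IsAsymptotic (D.peripheralCoarse (residue k i)) l (fun p => p)
      fun p => c.toPeripheral (c.F ⟨.group (D.g i * p), rfl⟩) := by
  obtain ⟨C, hC⟩ := c.exists_LF_coset hδ hthin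
  obtain ⟨m, hm⟩ := exists_nat_ge C
  have hd (p : D.P (residue k i)) : D.cayley.dist
      (c.toPeripheral (c.F ⟨.group (D.g i * p), rfl⟩) : G) p ≤ 2 ^ m := by
    have h1 : D.cayley.dist (c.toPeripheral (c.F ⟨.group (D.g i * p), rfl⟩) : G) p =
        D.cayley.dist (c.L (c.F ⟨.group (D.g i * p), rfl⟩) : G) (D.g i * p) := by
      rw [← D.cayley_dist_mul_left (D.g i)]
      simp [RayChoice.toPeripheral]
    rw [h1]
    refine (D.cayley_dist_le _ _).trans (Nat.pow_le_pow_right two_pos ?_)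
    exact_mod_cast (hC ⟨_, mul_mem_coset i p⟩).trans hm
  have hA : {z : D.P (residue k i) × D.P (residue k i) | D.cayley.dist (z.1 : G) z.2 ≤ 2 ^ m} ∈
      (D.peripheralCoarse (residue k i)).controlled :=
    mem_pullback_groupCoarse.2 ⟨2 ^ m, fun _ hz => hz⟩
  refine ⟨⟨_, hA, .of_forall fun p => ?_⟩, hl, fun B hB => ?_⟩
  · rw [Set.mem_ofPred_eq, SimpleGraph.dist_comm]
    exact hd p
  · filter_upwards [hl _ (hB.thicken hA)] with p h1 h2
    exact h1 ⟨_, h2, hd p⟩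

/-! ## The maps `ξ_n` -/

section Xi

variable [TopologicalSpace G] {N : ℕ} {W : Fin k → Type w} [∀ r, Nonempty (W r)]

/-- The composite `hX_n → hX^i → hP̂_i → P̂_i ∪ W_i`. -/
noncomputable def levelBar (c : ∀ i, D.RayChoice N i)
    (ζ : ∀ r, HigsonCorona (D.peripheralCoarse r) → W r) {n : ℕ} (i : Fin n)
    (χ : HigsonComp (D.levelCoarse n)) : CoronaUnion ((c i).zeta ζ) :=
  coronaBar ((c i).zeta ζ)
    ((c i).hF (higsonMap (D.levelCoarse n) (D.omitCoarse i) (D.levelToOmit i) χ))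

variable {c : ∀ i, D.RayChoice N i} {ζ : ∀ r, HigsonCorona (D.peripheralCoarse r) → W r}

/-- If `alpha` takes the value `s_i`, the image in `hP̂_i` is a corona point; otherwise it is the
boundary point `ω` itself. This compatibility turns the coordinate maps into a map to the fibre
product `∂X_n`. -/
theorem toBoundary_levelBar (hδ : D.FourPoint δ) (hthin : D.HasThinTriangles δ₀) {n : ℕ}
    (i : Fin n) {χ : HigsonCorona (D.levelCoarse n)} {ω : D.Boundary}
    (h : D.alphaLevel n χ.1 = .bdry ω) : (c i).toBoundary (levelBar c ζ i χ.1) = ω := by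
  by_cases hω : ω = D.parabolicPoint i
  · subst hω
    rw [levelBar, coronaBar_of_mem (hF_level_mem_corona hδ hthin h)]
    rfl
  · have := RayChoice.metrizableSpace_punctured hδ hthin i
    have := RayChoice.locallyCompactSpace_punctured hδ hthin i
    have h1 := (isHigsonExtension_alphaLevel hδ hthin n).tendsto
      (tendsto_toHigson_higsonFilter _ χ.1)
    rw [h] at h1
    rw [levelBar, (c i).hF_eq_of_tendsto hδ hthin
      ((D.isHigsonExtension_levelToOmit i).tendsto (tendsto_toHigson_higsonFilter _ χ.1))
      (D.leaves_of_levelCorona χ) h1 hω, ((c i).isProperCoarse hδ hthin).coronaBar_toHigson]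
    rfl

/-- `ξ : νX_n → ∂X_n` is compatible with the maps from `∂X_n` to `∂X` and `P̂_i ∪ W_i`. -/
structure IsCompatible (n : ℕ) (ξ : HigsonCorona (D.levelCoarse n) → Blowup c ζ n) : Prop where
  collapse : ∀ χ, Bordification.bdry (ξ χ).collapse = D.alphaLevel n χ.1
  sigma : ∀ χ i, Blowup.sigma i (ξ χ) = levelBar c ζ i χ.1

theorem exists_isCompatible (hδ : D.FourPoint δ) (hthin : D.HasThinTriangles δ₀) (n : ℕ) :
    ∃ ξ : HigsonCorona (D.levelCoarse n) → Blowup c ζ n, IsCompatible n ξ := by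
  have (χ : HigsonCorona (D.levelCoarse n)) : ∃ x : Blowup c ζ n,
      Bordification.bdry x.collapse = D.alphaLevel n χ.1 ∧
        ∀ i, Blowup.sigma i x = levelBar c ζ i χ.1 := by
    obtain ⟨ω, hω⟩ := exists_alphaLevel_eq hδ hthin χ
    obtain ⟨x, rfl, hx⟩ := Blowup.exists_collapse_sigma ω (fun i => levelBar c ζ i χ.1)
      fun i => toBoundary_levelBar hδ hthin i hω
    exact ⟨x, hω.symm, hx⟩
  choose ξ h1 h2 using this
  exact ⟨ξ, h1, h2⟩

variable {n : ℕ} {ξ : HigsonCorona (D.levelCoarse n) → Blowup c ζ n}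

theorem IsCompatible.exists_eq_blown (h : IsCompatible n ξ) (hδ : D.FourPoint δ)
    (hthin : D.HasThinTriangles δ₀) {i : Fin n} {χ : HigsonCorona (D.levelCoarse n)}
    (hχ : D.alphaLevel n χ.1 = .bdry (D.parabolicPoint i)) :
    ξ χ = .blown i ((c i).zeta ζ ⟨_, hF_level_mem_corona hδ hthin hχ⟩) := by
  obtain ⟨z, hz⟩ := Blowup.exists_eq_blown (Bordification.bdry.inj ((h.collapse χ).trans hχ))
  have h1 := h.sigma χ i
  rw [hz, Blowup.sigma_blown, levelBar, coronaBar_of_mem (hF_level_mem_corona hδ hthin hχ)] at h1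
  rw [hz, CoronaUnion.outer.inj h1]

theorem IsCompatible.isXi (h : IsCompatible n ξ) (hδ : D.FourPoint δ)
    (hthin : D.HasThinTriangles δ₀) : IsXi c ζ n ξ := by
  refine fun χ => ⟨fun hχ => ?_, fun i hχ => ?_⟩
  · have h1 := h.collapse χ
    refine ⟨_, h1.symm, Blowup.exists_eq_base fun i hi => hχ i ?_⟩
    rw [← h1, hi]
  · exact ⟨_, coronaBar_of_mem (hF_level_mem_corona hδ hthin hχ), h.exists_eq_blown hδ hthin hχ⟩

theorem IsCompatible.isCorona [DiscreteTopology G] [∀ r, TopologicalSpace (W r)]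
    (h : IsCompatible n ξ) (hδ : D.FourPoint δ) (hthin : D.HasThinTriangles δ₀)
    (hζ : ∀ r, IsCorona (ζ r)) : IsCorona ξ where
  compact := Blowup.compactSpace hδ hthin hζ n
  metrizable := Blowup.metrizableSpace hδ hthin hζ n
  continuous := by
    refine Blowup.continuous_iff.2 ⟨?_, fun i => ?_⟩
    · refine isInducing_bdry.continuous_iff.2 ?_
      exact ((isHigsonExtension_alphaLevel hδ hthin n).1.comp continuous_subtype_val).congr
        fun χ => (h.collapse χ).symm
    · exact (continuous_coronaBar.comp (((c i).isHigsonExtension_hF hδ hthin).1.comp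
        ((D.isHigsonExtension_levelToOmit i).1.comp continuous_subtype_val))).congr
        fun χ => (h.sigma χ i).symm

theorem zeta_eq_of_hPeripheral_eq {i : ℕ} (c : D.RayChoice N i)
    {θ : HigsonCorona (D.peripheralCoarse (residue k i))} {χ : HigsonCorona c.puncturedCoarse}
    (h : c.hPeripheral χ.1 = θ.1) : c.zeta ζ χ = ζ _ θ := by
  rw [c.zeta_eq (h ▸ θ.2)]
  exact congrArg _ (Subtype.ext h)

/-! ## The map `ξ_∞` -/

variable [DiscreteTopology G]

variable (D) in
theorem isHigsonExtension_groupToLevel (n : ℕ) : IsHigsonExtension D.groupCoarse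
    (fun x => toHigson (D.levelCoarse n) (D.groupToLevel n x))
    (higsonMap D.groupCoarse (D.levelCoarse n) (D.groupToLevel n)) :=
  (D.isCoarseMap_groupToLevel n).isHigsonExtension continuous_of_discreteTopology

variable (D) in
/-- The map `νG → νX_n`. -/
noncomputable def groupCorona (n : ℕ) (χ : HigsonCorona D.groupCoarse) :
    HigsonCorona (D.levelCoarse n) :=
  ⟨higsonMap D.groupCoarse (D.levelCoarse n) (D.groupToLevel n) χ.1,
    (D.isCoarseMap_groupToLevel n).higsonMap_mem_corona D.isProperCoarse_groupCoarse
      (D.isProperCoarse_levelCoarse n) continuous_of_discreteTopology χ.2⟩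

variable (D) in
theorem continuous_groupCorona (n : ℕ) : Continuous (D.groupCorona n) :=
  ((D.isHigsonExtension_groupToLevel n).1.comp continuous_subtype_val).subtype_mk _

theorem tendsto_groupCorona {ι : Type*} {l : Filter ι} {x : ι → G} {χ : HigsonCorona D.groupCoarse}
    (hx : Tendsto (fun j => toHigson D.groupCoarse (x j)) l (𝓝 χ.1)) (n : ℕ) :
    Tendsto (fun j => toHigson (D.levelCoarse n) (D.groupToLevel n (x j))) l
      (𝓝 (D.groupCorona n χ).1) :=
  (D.isHigsonExtension_groupToLevel n).tendsto hx

theorem tendsto_alphaLevel_groupCorona (hδ : D.FourPoint δ) (hthin : D.HasThinTriangles δ₀)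
    {ι : Type*} {l : Filter ι} {x : ι → G} {χ : HigsonCorona D.groupCoarse}
    (hx : Tendsto (fun j => toHigson D.groupCoarse (x j)) l (𝓝 χ.1)) (n : ℕ) :
    Tendsto (fun j => (Bordification.vertex (.group (x j)) : D.Bordification)) l
      (𝓝 (D.alphaLevel n (D.groupCorona n χ).1)) :=
  (isHigsonExtension_alphaLevel hδ hthin n).tendsto (tendsto_groupCorona hx n)

/-- Both sides have the same coordinates, as these are limits along one and the same filter on `G`.
-/
theorem proj_groupCorona (hδ : D.FourPoint δ) (hthin : D.HasThinTriangles δ₀)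
    {ξ : ∀ n, HigsonCorona (D.levelCoarse n) → Blowup c ζ n} (h : ∀ n, IsCompatible n (ξ n))
    (χ : HigsonCorona D.groupCoarse) (n : ℕ) :
    Blowup.proj (ξ (n + 1) (D.groupCorona (n + 1) χ)) = ξ n (D.groupCorona n χ) := by
  have := metrizableSpace_bordification hδ hthin
  have hχ := tendsto_toHigson_higsonFilter D.groupCoarse χ.1
  refine Blowup.ext_collapse_sigma (Bordification.bdry.inj ?_) fun i => ?_
  · rw [Blowup.collapse_proj, (h _).collapse, (h _).collapse]
    exact tendsto_nhds_unique (tendsto_alphaLevel_groupCorona hδ hthin hχ (n + 1))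
      (tendsto_alphaLevel_groupCorona hδ hthin hχ n)
  · rw [Blowup.sigma_proj, (h _).sigma, (h _).sigma]
    refine congrArg (fun θ => coronaBar ((c i).zeta ζ) ((c i).hF θ)) ?_
    exact tendsto_nhds_unique
      ((D.isHigsonExtension_levelToOmit i.castSucc).tendsto (tendsto_groupCorona hχ (n + 1)))
      ((D.isHigsonExtension_levelToOmit i).tendsto (tendsto_groupCorona hχ n))

/-! ## Surjectivity -/

/-- Along `l` the points `F_i(g_i p)` tend to the image of `ψ`, while their images in `P_(i)` are
asymptotic to `p`, which tends to `θ`. -/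
theorem hPeripheral_hF_eq (hδ : D.FourPoint δ) (hthin : D.HasThinTriangles δ₀) {i : ℕ}
    (c : D.RayChoice N i) {θ : HigsonCorona (D.peripheralCoarse (residue k i))}
    {l : Filter (D.P (residue k i))} [l.NeBot]
    (hl : l ≤ higsonFilter (D.peripheralCoarse (residue k i)) θ.1)
    {ψ : HigsonComp (D.omitCoarse i)}
    (hψ : Tendsto (fun p : D.P (residue k i) => toHigson (D.omitCoarse i)
      ⟨.group (D.g i * p), rfl⟩) l (𝓝 ψ))
    (h : ¬ ∃ ω, toHigson c.puncturedCoarse ω = c.hF ψ) : c.hPeripheral (c.hF ψ) = θ.1 := by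
  have h3 := (c.isHigsonExtension_hF hδ hthin).tendsto hψ
  have h4 : Tendsto (fun p : D.P (residue k i) => c.F ⟨.group (D.g i * p), rfl⟩) l
      (higsonFilter c.puncturedCoarse (c.hF ψ)) := tendsto_comap_iff.2 h3
  have h5 := (isAsymptotic_toPeripheral hδ hthin c (l := l) fun B hB =>
    hl ((D.isProperCoarse_peripheralCoarse _).compl_mem_higsonFilter θ.2 hB)).tendsto_toHigson
      ((tendsto_toHigson_higsonFilter _ θ.1).mono_left hl)
  exact tendsto_nhds_unique ((c.tendsto_hPeripheral hδ hthin h).comp h4) h5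

theorem exists_xi_eq_of_collapse (hδ : D.FourPoint δ) (hthin : D.HasThinTriangles δ₀)
    (h : IsCompatible n ξ) {x : Blowup c ζ n} (hx : ∀ i : Fin n, x.collapse ≠ D.parabolicPoint i) :
    ∃ χ : HigsonCorona D.groupCoarse, ξ (D.groupCorona n χ) = x := by
  have := metrizableSpace_bordification hδ hthin
  obtain ⟨l, hl, h1, h2⟩ := exists_group_tendsto hδ hthin x.collapse
  obtain ⟨U, χ, hU, hχ⟩ := D.isProperCoarse_groupCoarse.exists_corona_of_leaves
    (fun B hB => D.eventually_notMem_of_leaves h1 hB)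
  have h3 : (ξ (D.groupCorona n χ)).collapse = x.collapse := Bordification.bdry.inj
    ((h.collapse _).trans (tendsto_nhds_unique
      (tendsto_alphaLevel_groupCorona hδ hthin hχ n) (h2.mono_left hU)))
  refine ⟨χ, ?_⟩
  rw [Blowup.exists_eq_base hx, Blowup.exists_eq_base (x := ξ (D.groupCorona n χ)) (h3 ▸ hx)]
  congr 2

/-- Translate the filter of `θ` by `g_i` into `G` and take any limit point `χ` in `νG`. -/
theorem exists_xi_eq_blown (hδ : D.FourPoint δ) (hthin : D.HasThinTriangles δ₀)
    (h : IsCompatible n ξ) (i : Fin n) (θ : HigsonCorona (D.peripheralCoarse (residue k i))) :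
    ∃ χ : HigsonCorona D.groupCoarse, ξ (D.groupCorona n χ) = .blown i (ζ _ θ) := by
  have := metrizableSpace_bordification hδ hthin
  have hl (B) (hB : (D.peripheralCoarse (residue k i)).IsBdd B) :
      Bᶜ ∈ higsonFilter (D.peripheralCoarse (residue k i)) θ.1 :=
    (D.isProperCoarse_peripheralCoarse _).compl_mem_higsonFilter θ.2 hB
  have hfin (B) (hB : B.Finite) := hl B (CoarseStructure.isBdd_finite _ hB)
  obtain ⟨U, χ, hU, hχ⟩ := D.isProperCoarse_groupCoarse.exists_corona_of_leaves
    (x := fun p : D.P (residue k i) => D.g i * p)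
    (fun B hB => D.eventually_notMem_of_leaves (coset_leaves (i : ℕ) hfin) hB)
  have h1 : D.alphaLevel n (D.groupCorona n χ).1 = .bdry (D.parabolicPoint i) :=
    tendsto_nhds_unique (tendsto_alphaLevel_groupCorona hδ hthin hχ n)
      ((coset_tendsto hδ (i : ℕ) hfin).mono_left hU)
  have hψ := hF_level_mem_corona (c := c) hδ hthin h1
  have h2 := (D.isHigsonExtension_levelToOmit i).tendsto (tendsto_groupCorona hχ n)
  have h3 := hPeripheral_hF_eq hδ hthin (c i) hU h2 hψ
  refine ⟨χ, ?_⟩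
  rw [h.exists_eq_blown hδ hthin h1, zeta_eq_of_hPeripheral_eq (c i) (χ := ⟨_, hψ⟩) h3]

theorem exists_xi_eq (hδ : D.FourPoint δ) (hthin : D.HasThinTriangles δ₀)
    (h : IsCompatible n ξ) (hζ : ∀ r, Function.Surjective (ζ r)) (x : Blowup c ζ n) :
    ∃ χ : HigsonCorona D.groupCoarse, ξ (D.groupCorona n χ) = x := by
  by_cases hx : ∃ i : Fin n, x.collapse = D.parabolicPoint i
  · obtain ⟨i, hi⟩ := hx
    obtain ⟨z, rfl⟩ := Blowup.exists_eq_blown hi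
    obtain ⟨θ, rfl⟩ := hζ _ z
    exact exists_xi_eq_blown hδ hthin h i θ
  · push Not at hx
    exact exists_xi_eq_of_collapse hδ hthin h hx

variable [∀ r, TopologicalSpace (W r)] {ξ : ∀ n, HigsonCorona (D.levelCoarse n) → Blowup c ζ n}

/-- The map `ξ_∞ : νG → ∂X_∞`. -/
noncomputable def xiLimit (hδ : D.FourPoint δ) (hthin : D.HasThinTriangles δ₀)
    (h : ∀ n, IsCompatible n (ξ n)) (χ : HigsonCorona D.groupCoarse) : BlowupLimit c ζ :=
  ⟨fun n => ξ n (D.groupCorona n χ), proj_groupCorona hδ hthin h χ⟩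

theorem isCorona_xiLimit (hδ : D.FourPoint δ) (hthin : D.HasThinTriangles δ₀)
    (h : ∀ n, IsCompatible n (ξ n)) (hζ : ∀ r, IsCorona (ζ r)) :
    IsCorona (xiLimit hδ hthin h) where
  compact := compactSpace_blowupLimit hδ hthin hζ
  metrizable := metrizableSpace_blowupLimit hδ hthin hζ
  continuous := (continuous_pi fun n =>
    ((h n).isCorona hδ hthin hζ).continuous.comp (D.continuous_groupCorona n)).subtype_mk _

/-- The sets of `χ` with the prescribed `n`-th coordinate are closed, nonempty by `exists_xi_eq`,
and decreasing by `proj_groupCorona`. By compactness of `νG` they have a common point. -/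
theorem surjective_xiLimit (hδ : D.FourPoint δ) (hthin : D.HasThinTriangles δ₀)
    (h : ∀ n, IsCompatible n (ξ n)) (hζ : ∀ r, IsCorona (ζ r))
    (hs : ∀ r, Function.Surjective (ζ r)) : Function.Surjective (xiLimit hδ hthin h) := by
  intro x
  have := D.isProperCoarse_groupCoarse.compactSpace_corona
  have := fun n => Blowup.metrizableSpace (c := c) hδ hthin hζ n
  have hcl (n : ℕ) : IsClosed {χ : HigsonCorona D.groupCoarse | ξ n (D.groupCorona n χ) = x.1 n} :=
    isClosed_eq (((h n).isCorona hδ hthin hζ).continuous.comp (D.continuous_groupCorona n))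
      continuous_const
  obtain ⟨χ, hχ⟩ := IsCompact.nonempty_iInter_of_sequence_nonempty_isCompact_isClosed
    (fun n => {χ : HigsonCorona D.groupCoarse | ξ n (D.groupCorona n χ) = x.1 n})
    (fun n χ hχ => by
      have hχ' : ξ (n + 1) (D.groupCorona (n + 1) χ) = x.1 (n + 1) := hχ
      show ξ n (D.groupCorona n χ) = x.1 n
      rw [← proj_groupCorona hδ hthin h, hχ', x.2])
    (fun n => exists_xi_eq hδ hthin (h n) hs (x.1 n)) (hcl 0).isCompact hcl
  exact ⟨χ, Subtype.ext (funext fun n => Set.mem_iInter.1 hχ n)⟩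

end Xi
end PeripheralGroup
end BlownUp

/-! ### The proposition. -/

theorem proposition8 {G : Type*} [Group G] [TopologicalSpace G] [DiscreteTopology G]
    {k : ℕ} [NeZero k] (D : BlownUp.PeripheralGroup G k) (hyp : D.IsRelativelyHyperbolic)
    (δ₀ : ℝ) (hδ₀ : 0 < δ₀) (hthin : D.HasThinTriangles δ₀) (N : ℕ) (hN : δ₀ + 1 < N)
    {W : Fin k → Type*} [∀ r, TopologicalSpace (W r)] [∀ r, Nonempty (W r)]
    (ζ : ∀ r, BlownUp.HigsonCorona (D.peripheralCoarse r) → W r)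
    (hζ : ∀ r, BlownUp.IsCorona (ζ r)) :
    (∀ i, Nonempty (D.RayChoice N i)) ∧
    ∀ c : ∀ i, D.RayChoice N i,
      -- the maps used in the construction are well defined
      BlownUp.IsHigsonExtension D.augCoarse
        BlownUp.PeripheralGroup.Bordification.vertex D.alpha ∧
      (∀ i, BlownUp.IsHigsonExtension (D.omitCoarse i)
        (fun x => BlownUp.toHigson (c i).puncturedCoarse ((c i).F x)) (c i).hF) ∧
      (∀ i, BlownUp.IsCorona ((c i).zeta ζ) ∧
        ∀ χ : BlownUp.HigsonCorona (c i).puncturedCoarse,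
          ¬ ∃ x, BlownUp.toHigson (D.peripheralCoarse (BlownUp.residue k i)) x =
            (c i).hPeripheral χ.1) ∧
      -- the maps `ξ_n` and `ξ_∞`
      ∃ (ξ : ∀ n, BlownUp.HigsonCorona (D.levelCoarse n) →
            BlownUp.PeripheralGroup.Blowup c ζ n)
        (ξ' : BlownUp.HigsonCorona D.groupCoarse → BlownUp.PeripheralGroup.BlowupLimit c ζ),
        (∀ n, BlownUp.PeripheralGroup.IsXi c ζ n (ξ n)) ∧
        BlownUp.PeripheralGroup.IsXiLimit c ζ ξ ξ' ∧
        (∀ n, BlownUp.IsCorona (ξ n)) ∧ BlownUp.IsCorona ξ' ∧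
        ((∀ r, Function.Surjective (ζ r)) →
          (∀ n, Function.Surjective (ξ n) ∧ BlownUp.IsCoarseCompactification (ξ n)) ∧
          Function.Surjective ξ' ∧ BlownUp.IsCoarseCompactification ξ') := by
  obtain ⟨δ, hδ⟩ := hyp.exists_fourPoint
  refine ⟨BlownUp.PeripheralGroup.nonempty_rayChoice hδ hthin N, fun c =>
    ⟨BlownUp.PeripheralGroup.isHigsonExtension_alpha hδ hthin,
      fun i => (c i).isHigsonExtension_hF hδ hthin,
      fun i => ⟨(c i).isCorona_zeta hδ hthin hζ,
        fun χ => (c i).hPeripheral_mem_corona hδ hthin χ.2⟩, ?_⟩⟩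
  choose ξ hξ using BlownUp.PeripheralGroup.exists_isCompatible (c := c) (ζ := ζ) hδ hthin
  have hn := fun n => (hξ n).isCorona hδ hthin hζ
  have hlim := BlownUp.PeripheralGroup.isCorona_xiLimit hδ hthin hξ hζ
  refine ⟨ξ, BlownUp.PeripheralGroup.xiLimit hδ hthin hξ, fun n => (hξ n).isXi hδ hthin,
    fun χ n => ⟨D.groupCorona n χ, rfl, rfl⟩, hn, hlim, fun hs => ?_⟩
  have hG := D.countable_group
  have hsn (n) : Function.Surjective (ξ n) := fun x => by
    obtain ⟨χ, hχ⟩ := BlownUp.PeripheralGroup.exists_xi_eq hδ hthin (hξ n) hs x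
    exact ⟨_, hχ⟩
  have hsl := BlownUp.PeripheralGroup.surjective_xiLimit hδ hthin hξ hζ hs
  exact ⟨fun n => ⟨hsn n, (D.isProperCoarse_levelCoarse n).isCoarseCompactification (hn n) (hsn n)⟩,
    hsl, D.isProperCoarse_groupCoarse.isCoarseCompactification hlim hsl⟩
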